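/- \textbf{Setting.} Let $(\Sigma^{2n},\omega)$ be a complex manifold of dimension $2n$ with a closed nondegenerate holomorphic 2-form, and let $f\ast h=\sum_{k\ge 0}\hbar^k\Delta_k(f,h)$ be a closed $\ast$-product on it: each $\Delta_k$ is a holomorphic bidifferential operator of order at most $k$ in each argument, $\ast$ is associative with unit $1$, $\Delta_0(f,h)=fh$, $\Delta_1(f,h)-\Delta_1(h,f)=i\{f,h\}_{\rm Poisson}$, and $\int\frac{\omega^n}{n!}(f\ast h-h\ast f)=0$, where the integral is over closed coordinate tori (products of circles in a holomorphic chart) near which $f,h$ are holomorphic. Let $U\subset\mathbb C^4$ be open with coordinates $z^\alpha=(w,z)$, $z^{\tilde\alpha}=(\tilde w,\tilde z)$, and let $ds^2=2g_{\alpha\tilde\beta}dz^\alpha dz^{\tilde\beta}$ be a holomorphic nondegenerate metric on $U$ which is Kähler ($d\Omega=0$ for $\Omega=g_{\alpha\tilde\beta}dz^\alpha\wedge dz^{\tilde\beta}$) and heavenly: with $\Gamma^\sigma_{\beta\gamma}=g^{\sigma\tilde\tau}\partial_\gamma g_{\beta\tilde\tau}$, the curvature 2-forms with components $R_{\tilde\alpha\beta\gamma\tilde\delta}=-g_{\sigma\tilde\alpha}\partial_{\tilde\delta}\Gamma^\sigma_{\beta\gamma}$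 in $dz^\gamma\wedge dz^{\tilde\delta}$ are self-dual. A 2-form is self-dual if its wedge products with $d\tilde w\wedge d\tilde z$, $\Omega$ and $dw\wedge dz$ vanish. Put $g=\det(g_{\alpha\tilde\beta})$ and $\epsilon^{12}=-\epsilon^{21}=1$. For open $V\subset U$ let $\mathcal Q(V)$ be the set of formal series $\sum_{m\ge1}\sum_{k\ge-m}t^m\hbar^kA_{m,k}$ with $A_{m,k}$ holomorphic on $\Sigma\times V$, with the $\ast$-product along $\Sigma$ and the bracket $\{A,B\}=\frac1{i\hbar}(A\ast B-B\ast A)$, and let $e^{\mathcal Q}(V)=1+\mathcal Q(V)$. The self-dual Yang--Mills (SDYM) equations for a $\mathcal Q$-valued 1-form $A$ state that $F=dA+\frac12\{A,A\}$ is self-dual. A \emph{patch} is $V=B\times\tilde B\subset U$ with $B,\tilde B\subset\mathbb C^2$ open and convex, in the variables $(w,z)$ and $(\tilde w,\tilde z)$. \textbf{Theorem.} (1) On every patch $g=G(w,z)\,\tilde G(\tilde w,\tilde z)$ with $G$, $\tilde G$ holomorphic. (2) On every patch $V$, each solution $A$ of the SDYM equations with components in $i\hbar\,\mathcal Q(V)$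 is carried by a gauge transformation $A\mapsto c\ast A\ast c^{-1}+i\hbar\,c\ast dc^{-1}$, $c\in e^{\mathcal Q}(V)$, to the form $A_\alpha=0$, $A_{\tilde\alpha}=i\hbar J^{-1}\ast\partial_{\tilde\alpha}J$ with $J\in e^{\mathcal Q}(V)$. (3) For $J\in e^{\mathcal Q}(U)$, the connection $A=i\hbar J^{-1}\ast\tilde\partial J$ has components in $i\hbar\,\mathcal Q(U)$, and it solves the SDYM equations if and only if $J$ solves Yang's equation $g^{\tilde\beta\alpha}\partial_\alpha(J^{-1}\ast\partial_{\tilde\beta}J)=0$. Suppose now that $g=G(w,z)\tilde G(\tilde w,\tilde z)$ on $U$. For a series $\Theta$ let $A[\Theta]$ be the connection $A_\alpha=0$, $A_{\tilde\alpha}=\frac1G\epsilon^{\beta\gamma}g_{\gamma\tilde\alpha}\partial_\beta\Theta$, and let the \emph{master equation} be $$g^{\tilde\beta\alpha}\partial_{\tilde\beta}\partial_\alpha\Theta+\frac1{2G}\epsilon^{\alpha\beta}\{\partial_\alpha\Theta,\partial_\beta\Theta\}=0 .$$ (4) For $\Theta\in\mathcal Q(U)$, $A[\Theta]$ solves the SDYM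 equations if and only if $\Theta$ solves the master equation. (5) On every patch $V$: $J\in e^{\mathcal Q}(V)$ solves Yang's equation if and only if there is a solution $\Theta\in i\hbar\,\mathcal Q(V)$ of the master equation with $i\hbar J^{-1}\ast\tilde\partial J=A[\Theta]$; and $\Theta\in i\hbar\,\mathcal Q(V)$ solves the master equation if and only if there is a solution $J\in e^{\mathcal Q}(V)$ of Yang's equation with $i\hbar J^{-1}\ast\tilde\partial J=A[\Theta]$. (6) $\Theta\in\mathcal Q(U)$ solves the master equation if and only if it is a stationary point of the action $$S=\frac12\int\omega^n\Big[\tilde G\tilde\epsilon\wedge\tfrac13\Theta\ast\{\partial\Theta,\partial\Theta\}+\Omega\wedge\partial\Theta\wedge\tilde\partial\Theta\Big],\qquad \tilde\epsilon=d\tilde w\wedge d\tilde z,$$ that is, if and only if, for every closed contour in $\Sigma\times U$ that is the product of a torus in a holomorphic chart of $\Sigma$, a torus in $(w,z)$ and a torus in $(\tilde w,\tilde z)$, and for every $\mathcal Q$-valued variation $\eta$ holomorphic near the contour, $\frac{d}{ds}\big|_{s=0}S[\Theta+s\eta]=0$, coefficientwise in $t$ and $\hbar$. -/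

import Mathlib

open scoped Manifold ContDiff Topology
open Set Filter

noncomputable section

namespace StarSDYM

/-- The model space of the phase space: `ℂ^{2n}`. -/
abbrev Phase (n : ℕ) : Type := Fin (2 * n) → ℂ

/-- Coordinates `((w, z), (w̃, z̃))` on the four-dimensional base. -/
abbrev Base : Type := (Fin 2 → ℂ) × (Fin 2 → ℂ)

/-- Indices of the four coordinates: `inl 0, inl 1, inr 0, inr 1` are `w, z, w̃, z̃`. -/
abbrev Idx : Type := Fin 2 ⊕ Fin 2

/-! ### The complex symplectic manifold -/

section PhaseSpace

variable (n : ℕ) {P : Type*} [TopologicalSpace P] [ChartedSpace (Phase n) P]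

/-- `f` is holomorphic in a neighbourhood of `x`. -/
def HolAt (f : P → ℂ) (x : P) : Prop :=
  ∀ᶠ x' in 𝓝 x, MDifferentiableAt 𝓘(ℂ, Phase n) 𝓘(ℂ, ℂ) f x'

variable {n} in
/-- The component matrix `ω_{ij}` of a bilinear form on the tangent bundle, in the chart `φ`, at
the point with coordinates `y`. -/
def formComp
    (w : ∀ x : P, TangentSpace 𝓘(ℂ, Phase n) x →L[ℂ] TangentSpace 𝓘(ℂ, Phase n) x →L[ℂ] ℂ)
    (φ : OpenPartialHomeomorph P (Phase n)) (y : Phase n) :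
    Matrix (Fin (2 * n)) (Fin (2 * n)) ℂ :=
  Matrix.of fun i j =>
    w (φ.symm y)
      (mfderiv 𝓘(ℂ, Phase n) 𝓘(ℂ, Phase n) φ.symm y (Pi.single i (1 : ℂ) : Phase n))
      (mfderiv 𝓘(ℂ, Phase n) 𝓘(ℂ, Phase n) φ.symm y (Pi.single j (1 : ℂ) : Phase n))

/-- A holomorphic symplectic form: a closed nondegenerate holomorphic 2-form. -/
structure SymplecticForm (P : Type*) [TopologicalSpace P] [ChartedSpace (Phase n) P] where
  form : ∀ x : P, TangentSpace 𝓘(ℂ, Phase n) x →L[ℂ] TangentSpace 𝓘(ℂ, Phase n) x →L[ℂ] ℂ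
  alternating : ∀ x v, form x v v = 0
  nondegenerate : ∀ x v, (∀ v', form x v v' = 0) → v = 0
  holomorphic : ∀ φ ∈ IsManifold.maximalAtlas 𝓘(ℂ, Phase n) ω P, ∀ i j,
    DifferentiableOn ℂ (fun y => formComp form φ y i j) φ.target
  closed : ∀ φ ∈ IsManifold.maximalAtlas 𝓘(ℂ, Phase n) ω P, ∀ y ∈ φ.target, ∀ i j k,
    fderiv ℂ (fun y' => formComp form φ y' j k) y (Pi.single i 1)
      + fderiv ℂ (fun y' => formComp form φ y' k i) y (Pi.single j 1)
      + fderiv ℂ (fun y' => formComp form φ y' i j) y (Pi.single k 1) = 0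

variable {n}

/-- The coefficient of `ω^n = ω ∧ ⋯ ∧ ω` with respect to `dy^1 ∧ ⋯ ∧ dy^{2n}`, in the chart `φ`:
`2^{-n} ∑_σ sgn σ ∏_i ω_{σ(2i) σ(2i+1)}`. -/
def SymplecticForm.topPower (Ω : SymplecticForm n P) (φ : OpenPartialHomeomorph P (Phase n))
    (y : Phase n) : ℂ :=
  (1 / 2 ^ n) * ∑ σ : Equiv.Perm (Fin (2 * n)), ((Equiv.Perm.sign σ : ℤ) : ℂ) *
    ∏ i : Fin n, formComp Ω.form φ y (σ ⟨2 * i.1, by omega⟩) (σ ⟨2 * i.1 + 1, by omega⟩)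

/-- The Poisson bracket `ω^{ij} ∂_i f ∂_j h` computed in the chart `φ`, where `ω^{ij}` is the
inverse matrix of `ω_{ij}`. -/
def SymplecticForm.poisson (Ω : SymplecticForm n P) (φ : OpenPartialHomeomorph P (Phase n))
    (f h : P → ℂ) (x : P) : ℂ :=
  ∑ i, ∑ j, (formComp Ω.form φ (φ x))⁻¹ i j *
    fderiv ℂ (f ∘ φ.symm) (φ x) (Pi.single i 1) * fderiv ℂ (h ∘ φ.symm) (φ x) (Pi.single j 1)

/-- The iterated partial derivative `∂_{s_1} ⋯ ∂_{s_a} f` at `x`, in the chart `φ`. -/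
def coordDeriv (φ : OpenPartialHomeomorph P (Phase n)) (f : P → ℂ) {a : ℕ}
    (s : Fin a → Fin (2 * n)) (x : P) : ℂ :=
  iteratedFDeriv ℂ a (f ∘ φ.symm) (φ x) fun l => Pi.single (s l) 1

/-- The torus `{y : |y_i - c_i| = R_i for all i}`. -/
def torusSet {ι : Type*} (c : ι → ℂ) (R : ι → ℝ) : Set (ι → ℂ) := {y | ∀ i, ‖y i - c i‖ = R i}

/-- A closed (holomorphic) `*`-product `f * h = ∑_k ħ^k Δ_k(f, h)` on a complex symplectic
manifold: `Δ_k` is a holomorphic bidifferential operator of order at most `k` in each argument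
(so it acts on functions holomorphic near a point), `*` is associative with unit `1`, deforms the
pointwise product in the direction of the Poisson bracket, and `tr (f * h) = tr (h * f)` for the
trace `∫ ω^n / n!`, the integral being over closed `2n`-dimensional coordinate tori. -/
structure StarProduct (Ω : SymplecticForm n P) where
  Δ : ℕ → (P → ℂ) → (P → ℂ) → P → ℂ
  bidifferential : ∀ k, ∀ φ ∈ IsManifold.maximalAtlas 𝓘(ℂ, Phase n) ω P,
    ∃ C : ∀ a b : ℕ, (Fin a → Fin (2 * n)) → (Fin b → Fin (2 * n)) → Phase n → ℂ,
      (∀ a b s s', DifferentiableOn ℂ (C a b s s') φ.target) ∧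
      ∀ x ∈ φ.source, ∀ f h : P → ℂ, HolAt n f x → HolAt n h x →
        Δ k f h x = ∑ a ∈ Finset.range (k + 1), ∑ b ∈ Finset.range (k + 1),
          ∑ s : Fin a → Fin (2 * n), ∑ s' : Fin b → Fin (2 * n),
            C a b s s' (φ x) * coordDeriv φ f s x * coordDeriv φ h s' x
  zeroth : ∀ (x : P) (f h : P → ℂ), HolAt n f x → HolAt n h x → Δ 0 f h x = f x * h x
  first : ∀ φ ∈ IsManifold.maximalAtlas 𝓘(ℂ, Phase n) ω P, ∀ x ∈ φ.source,
    ∀ f h : P → ℂ, HolAt n f x → HolAt n h x →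
      Δ 1 f h x - Δ 1 h f x = Complex.I * Ω.poisson φ f h x
  one_left : ∀ k, k ≠ 0 → ∀ (x : P) (f : P → ℂ), HolAt n f x → Δ k (fun _ => 1) f x = 0
  one_right : ∀ k, k ≠ 0 → ∀ (x : P) (f : P → ℂ), HolAt n f x → Δ k f (fun _ => 1) x = 0
  assoc : ∀ (k : ℕ) (x : P) (f h l : P → ℂ), HolAt n f x → HolAt n h x → HolAt n l x →
    ∑ ab ∈ Finset.HasAntidiagonal.antidiagonal k, Δ ab.1 (Δ ab.2 f h) l x
      = ∑ ab ∈ Finset.HasAntidiagonal.antidiagonal k, Δ ab.1 f (Δ ab.2 h l) x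
  trace : ∀ φ ∈ IsManifold.maximalAtlas 𝓘(ℂ, Phase n) ω P,
    ∀ (c : Phase n) (R : Fin (2 * n) → ℝ), (∀ i, 0 < R i) → torusSet c R ⊆ φ.target →
    ∀ f h : P → ℂ, (∀ y ∈ torusSet c R, HolAt n f (φ.symm y) ∧ HolAt n h (φ.symm y)) → ∀ k,
      torusIntegral (fun y => (Ω.topPower φ y / (n.factorial : ℂ)) *
        (Δ k f h (φ.symm y) - Δ k h f (φ.symm y))) c R = 0

end PhaseSpace

/-! ### The base: complexified Kähler and heavenly metrics -/

/-- The coordinate vector in the direction `i`. -/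
def dirVec : Idx → Base
  | Sum.inl α => (Pi.single α 1, 0)
  | Sum.inr α => (0, Pi.single α 1)

/-- The partial derivative of a function on the base. -/
def pd (i : Idx) (f : Base → ℂ) (p : Base) : ℂ := fderiv ℂ f p (dirVec i)

/-- `ε_{αβ} = ε^{αβ}`. -/
def eps : Matrix (Fin 2) (Fin 2) ℂ := !![0, 1; -1, 0]

/-- The components `F_{ij}` of the 2-form `b_{ij} dz^i ∧ dz^j = (1/2) F_{ij} dz^i ∧ dz^j`. -/
def twoForm (b : Idx → Idx → ℂ) (i j : Idx) : ℂ := b i j - b j i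

/-- The array `b` with `b_{αβ} = c α β` for two untilded indices, and all other entries `0`. -/
def typeHH (c : Fin 2 → Fin 2 → ℂ) : Idx → Idx → ℂ
  | Sum.inl α, Sum.inl β => c α β
  | _, _ => 0

/-- The array `b` with `b_{α̃β̃} = c α β` for two tilded indices, and all other entries `0`. -/
def typeTT (c : Fin 2 → Fin 2 → ℂ) : Idx → Idx → ℂ
  | Sum.inr α, Sum.inr β => c α β
  | _, _ => 0

/-- The array `b` with `b_{αβ̃} = c α β`, and all other entries `0`. -/
def typeHT (c : Fin 2 → Fin 2 → ℂ) : Idx → Idx → ℂ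
  | Sum.inl α, Sum.inr β => c α β
  | _, _ => 0

/-- The coefficient of `dw ∧ dz ∧ dw̃ ∧ dz̃` in the wedge product of the 2-forms with components
`S` and `F`. -/
def wedge (S F : Idx → Idx → ℂ) : ℂ :=
  S (.inl 0) (.inl 1) * F (.inr 0) (.inr 1) - S (.inl 0) (.inr 0) * F (.inl 1) (.inr 1)
    + S (.inl 0) (.inr 1) * F (.inl 1) (.inr 0) + S (.inl 1) (.inr 0) * F (.inl 0) (.inr 1)
    - S (.inl 1) (.inr 1) * F (.inl 0) (.inr 0) + S (.inr 0) (.inr 1) * F (.inl 0) (.inl 1)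

/-- `dw ∧ dz = (1/2) ε_{αβ} dz^α ∧ dz^β`. -/
def dwdz : Idx → Idx → ℂ := twoForm (typeHH fun α β => 1 / 2 * eps α β)

/-- `ε̃ = (1/2) ε_{α̃β̃} dz^α̃ ∧ dz^β̃ = dw̃ ∧ dz̃`. -/
def epsTilde : Idx → Idx → ℂ := twoForm (typeTT fun α β => 1 / 2 * eps α β)

/-- The components `g_{αβ̃}`, as functions of the coordinates, of the metric
`2 g_{αβ̃} dz^α dz^β̃`. -/
abbrev Metric : Type := Fin 2 → Fin 2 → Base → ℂ

/-- The matrix `(g_{αβ̃})` at a point; its determinant is `g`. -/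
def Metric.mat (g : Metric) (p : Base) : Matrix (Fin 2) (Fin 2) ℂ := Matrix.of fun α β => g α β p

/-- The inverse metric `g^{β̃α}`, so that `g^{β̃α} g_{αγ̃} = δ^β̃_γ̃`. -/
def Metric.inv (g : Metric) (β α : Fin 2) (p : Base) : ℂ := (g.mat p)⁻¹ β α

/-- The Kähler form `Ω = g_{αβ̃} dz^α ∧ dz^β̃`. -/
def Metric.kahlerForm (g : Metric) (p : Base) : Idx → Idx → ℂ :=
  twoForm (typeHT fun α β => g α β p)

/-- `g` is a complexified Kähler metric on `U`: holomorphic, nondegenerate, and `dΩ = 0`. -/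
structure Metric.IsKahler (g : Metric) (U : Set Base) : Prop where
  holomorphic : ∀ α β, DifferentiableOn ℂ (g α β) U
  nondegenerate : ∀ p ∈ U, (g.mat p).det ≠ 0
  closed_left : ∀ p ∈ U, ∀ α γ β, pd (.inl γ) (g α β) p = pd (.inl α) (g γ β) p
  closed_right : ∀ p ∈ U, ∀ α β γ, pd (.inr γ) (g α β) p = pd (.inr β) (g α γ) p

/-- `Γ^σ_{βγ} = g^{στ̃} ∂_γ g_{βτ̃}`, the Levi-Civita connection of a Kähler metric. -/
def Metric.christoffel (g : Metric) (σ β γ : Fin 2) (p : Base) : ℂ :=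
  ∑ τ, g.inv τ σ p * pd (.inl γ) (g β τ) p

/-- `R_{α̃βγδ̃} = - g_{σα̃} ∂_δ̃ Γ^σ_{βγ}`. -/
def Metric.curvature (g : Metric) (α β γ δ : Fin 2) (p : Base) : ℂ :=
  -∑ σ, g σ α p * pd (.inr δ) (g.christoffel σ β γ) p

/-- A 2-form is self-dual at `p` iff its wedge products with the basis `dw̃ ∧ dz̃`, `Ω`, `dw ∧ dz`
of anti-self-dual forms vanish. -/
def Metric.IsSelfDual (g : Metric) (p : Base) (F : Idx → Idx → ℂ) : Prop :=
  wedge epsTilde F = 0 ∧ wedge (g.kahlerForm p) F = 0 ∧ wedge dwdz F = 0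

/-- The space is heavenly: all curvature 2-forms `R_{α̃βγδ̃} dz^γ ∧ dz^δ̃` are self-dual. -/
def Metric.IsHeavenly (g : Metric) (U : Set Base) : Prop :=
  ∀ p ∈ U, ∀ α β, g.IsSelfDual p (twoForm (typeHT fun γ δ => g.curvature α β γ δ p))

/-- `g = det (g_{αβ̃}) = G(w, z) G̃(w̃, z̃)` on `U`. -/
def Metric.Factors (g : Metric) (U : Set Base) (G Gt : (Fin 2 → ℂ) → ℂ) : Prop :=
  ∀ p ∈ U, (g.mat p).det = G p.1 * Gt p.2

/-! ### Formal series with coefficients depending on the base point -/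

/-- Formal series `∑ t^m ħ^k A_{m,k}(x, p)`, `x` in phase space and `p` in the base. -/
abbrev FSeries (P : Type*) : Type _ := ℕ → ℤ → P × Base → ℂ

namespace FSeries

section Basic

variable {P : Type*}

/-- The partial derivative along the base, coefficientwise. -/
def d (i : Idx) (A : FSeries P) : FSeries P := fun m k q => pd i (fun p => A m k (q.1, p)) q.2

/-- Multiplication by `iħ`. -/
def mulIħ (A : FSeries P) : FSeries P := fun m k q => Complex.I * A m (k - 1) q

/-- Multiplication by `1/(iħ)`. -/
def divIħ (A : FSeries P) : FSeries P := fun m k q => Complex.I⁻¹ * A m (k + 1) q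

/-- The constant series `1`. -/
def unit : FSeries P := fun m k _ => if m = 0 ∧ k = 0 then 1 else 0

/-- Equality over the open set `W`. -/
def EqOver (W : Set (P × Base)) (A B : FSeries P) : Prop := ∀ m k, ∀ q ∈ W, A m k q = B m k q

variable (n : ℕ) [TopologicalSpace P] [ChartedSpace (Phase n) P]

/-- `A` is, over `W`, an `𝒜`-valued function: coefficients jointly holomorphic, and
`A_{m,k} = 0` for `k < -m`. -/
structure IsA (W : Set (P × Base)) (A : FSeries P) : Prop where
  holomorphic : ∀ m k, MDifferentiableOn (𝓘(ℂ, Phase n).prod 𝓘(ℂ, Base)) 𝓘(ℂ, ℂ) (A m k) W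
  support : ∀ (m : ℕ) (k : ℤ), k < -(m : ℤ) → ∀ q ∈ W, A m k q = 0

/-- `A` is, over `W`, a `𝒬`-valued function: `𝒜`-valued with vanishing free element. -/
structure IsQ (W : Set (P × Base)) (A : FSeries P) : Prop extends IsA n W A where
  free : ∀ k, ∀ q ∈ W, A 0 k q = 0

/-- `A` is, over `W`, a function with values in the group `e^𝒬`: free element `1`. -/
structure IsExpQ (W : Set (P × Base)) (A : FSeries P) : Prop extends IsA n W A where
  free : ∀ k, ∀ q ∈ W, A 0 k q = if k = 0 then 1 else 0

end Basic

section Algebra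

variable {n : ℕ} {P : Type*} [TopologicalSpace P] [ChartedSpace (Phase n) P]
  {Ω : SymplecticForm n P} (S : StarProduct Ω)

/-- The `*`-product of `𝒜`-valued functions, computed fibrewise over the base:
`∑ t^{m₁+m₂} ħ^{-(m₁+m₂)} ∑ ħ^{s+j₁+j₂} Δ_s(A_{m₁, j₁-m₁}, B_{m₂, j₂-m₂})`. -/
def star (A B : FSeries P) : FSeries P := fun m k q =>
  if k + m < 0 then 0 else
    ∑ mm ∈ Finset.HasAntidiagonal.antidiagonal m, ∑ sr ∈ Finset.HasAntidiagonal.antidiagonal (k + m).toNat,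
      ∑ jj ∈ Finset.HasAntidiagonal.antidiagonal sr.2,
        S.Δ sr.1 (fun x => A mm.1 ((jj.1 : ℤ) - mm.1) (x, q.2))
          (fun x => B mm.2 ((jj.2 : ℤ) - mm.2) (x, q.2)) q.1

/-- The bracket `{A, B} = (1/iħ) (A * B - B * A)`. -/
def bracket (A B : FSeries P) : FSeries P := divIħ (star S A B - star S B A)

/-- The `*`-powers. -/
def starPow (A : FSeries P) : ℕ → FSeries P
  | 0 => unit
  | l + 1 => star S A (starPow A l)

/-- The `*`-inverse `A⁻¹ = ∑_l (-1)^l (A - 1)^l` of a series with free element `1`; only the terms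
with `l ≤ m` contribute at `t^m`. -/
def starInv (A : FSeries P) : FSeries P := fun m k q =>
  ∑ l ∈ Finset.range (m + 1), (-1 : ℂ) ^ l * starPow S (A - unit) l m k q

end Algebra

end FSeries

/-! ### Gauge theory -/

section Gauge

open FSeries

variable {n : ℕ} {P : Type*} [TopologicalSpace P] [ChartedSpace (Phase n) P]
  {Ω : SymplecticForm n P} (S : StarProduct Ω)

/-- The components `F_{ij} = ∂_i A_j - ∂_j A_i + {A_i, A_j}` of the curvature
`F = dA + (1/2) {A, A}`. -/
def curvatureForm (A : Idx → FSeries P) (i j : Idx) : FSeries P :=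
  (A j).d i - (A i).d j + bracket S (A i) (A j)

/-- The self-dual Yang-Mills equations over `W`: the curvature form is self-dual. -/
def IsSDYM (g : Metric) (W : Set (P × Base)) (A : Idx → FSeries P) : Prop :=
  ∀ m k, ∀ q ∈ W, g.IsSelfDual q.2 fun i j => curvatureForm S A i j m k q

/-- The gauge transform `c * A * c⁻¹ + iħ c * d(c⁻¹)`. -/
def gaugeTransform (c : FSeries P) (A : Idx → FSeries P) (i : Idx) : FSeries P :=
  star S (star S c (A i)) (starInv S c) + mulIħ (star S c ((starInv S c).d i))

/-- The connection `A = iħ J⁻¹ * ∂̃J`. -/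
def connOfJ (J : FSeries P) : Idx → FSeries P
  | .inl _ => 0
  | .inr α => mulIħ (star S (starInv S J) (J.d (.inr α)))

/-- Yang's equation `g^{β̃α} ∂_α (J⁻¹ * ∂_β̃ J) = 0` over `W`. -/
def IsYang (g : Metric) (W : Set (P × Base)) (J : FSeries P) : Prop :=
  ∀ m k, ∀ q ∈ W,
    ∑ β, ∑ α, g.inv β α q.2 * (star S (starInv S J) (J.d (.inr β))).d (.inl α) m k q = 0

/-- The connection `A_α = 0`, `A_α̃ = (1/G) ε^{βγ} g_{γα̃} ∂_β Θ`. -/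
def connOfTheta (g : Metric) (G : (Fin 2 → ℂ) → ℂ) (Θ : FSeries P) : Idx → FSeries P
  | .inl _ => 0
  | .inr α => fun m k q =>
      (G q.2.1)⁻¹ * ∑ β, ∑ γ, eps β γ * g γ α q.2 * Θ.d (.inl β) m k q

/-- The left-hand side `g^{β̃α} ∂_β̃ ∂_α Θ + (1/2G) ε^{αβ} {∂_α Θ, ∂_β Θ}` of the master
equation. -/
def masterExpr (g : Metric) (G : (Fin 2 → ℂ) → ℂ) (Θ : FSeries P) : FSeries P := fun m k q =>
  (∑ β, ∑ α, g.inv β α q.2 * (Θ.d (.inl α)).d (.inr β) m k q)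
    + (2 * G q.2.1)⁻¹ * ∑ α, ∑ β, eps α β * bracket S (Θ.d (.inl α)) (Θ.d (.inl β)) m k q

/-- The master equation over `W`. -/
def IsMaster (g : Metric) (G : (Fin 2 → ℂ) → ℂ) (W : Set (P × Base)) (Θ : FSeries P) : Prop :=
  EqOver W (masterExpr S g G Θ) 0

/-- The coefficient of `dw ∧ dz ∧ dw̃ ∧ dz̃` in the Lagrangian 4-form
`G̃ ε̃ ∧ (1/3) Θ * {∂Θ, ∂Θ} + Ω ∧ ∂Θ ∧ ∂̃Θ`. -/
def lagrangian (g : Metric) (Gt : (Fin 2 → ℂ) → ℂ) (Θ : FSeries P) : FSeries P := fun m k q =>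
  wedge (fun i j => Gt q.2.2 * epsTilde i j)
      (twoForm (typeHH fun α β =>
        1 / 3 * star S Θ (bracket S (Θ.d (.inl α)) (Θ.d (.inl β))) m k q))
    + wedge (g.kahlerForm q.2)
      (twoForm (typeHT fun α β => star S (Θ.d (.inl α)) (Θ.d (.inr β)) m k q))

/-- A closed contour of integration in (phase space) × (base): the product of a torus in a chart
of the phase space and of tori in the coordinates `(w, z)` and `(w̃, z̃)`. -/
structure Contour (n : ℕ) (P : Type*) [TopologicalSpace P] [ChartedSpace (Phase n) P] where
  chart : OpenPartialHomeomorph P (Phase n)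
  chart_mem : chart ∈ IsManifold.maximalAtlas 𝓘(ℂ, Phase n) ω P
  c : Phase n
  R : Fin (2 * n) → ℝ
  c₁ : Fin 2 → ℂ
  R₁ : Fin 2 → ℝ
  c₂ : Fin 2 → ℂ
  R₂ : Fin 2 → ℝ
  R_pos : ∀ i, 0 < R i
  R₁_pos : ∀ i, 0 < R₁ i
  R₂_pos : ∀ i, 0 < R₂ i
  torus_subset : torusSet c R ⊆ chart.target

/-- The points of the contour. -/
def Contour.carrier (T : Contour n P) : Set (P × Base) :=
  (T.chart.symm '' torusSet T.c T.R) ×ˢ (torusSet T.c₁ T.R₁ ×ˢ torusSet T.c₂ T.R₂)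

/-- The action `S[Θ] = (1/2) ∫ ω^n [G̃ ε̃ ∧ (1/3) Θ * {∂Θ, ∂Θ} + Ω ∧ ∂Θ ∧ ∂̃Θ]` over the contour:
its coefficient at `t^m ħ^k`. -/
def action (g : Metric) (Gt : (Fin 2 → ℂ) → ℂ) (T : Contour n P) (Θ : FSeries P)
    (m : ℕ) (k : ℤ) : ℂ :=
  1 / 2 * torusIntegral (fun y => torusIntegral (fun u => torusIntegral (fun v =>
    Ω.topPower T.chart y * lagrangian S g Gt Θ m k (T.chart.symm y, (u, v)))
      T.c₂ T.R₂) T.c₁ T.R₁) T.c T.R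

/-- `Θ` is a stationary point of the action over `univ ×ˢ U`: for every closed contour there and
every `𝒬`-valued variation `η` holomorphic near the contour, `d/ds S[Θ + s η] = 0` at `s = 0`. -/
def IsStationary (g : Metric) (Gt : (Fin 2 → ℂ) → ℂ) (U : Set Base) (Θ : FSeries P) : Prop :=
  ∀ T : Contour n P, T.carrier ⊆ univ ×ˢ U →
    ∀ (W : Set (P × Base)), IsOpen W → T.carrier ⊆ W → ∀ η : FSeries P, IsQ n W η →
      ∀ m k, HasDerivAt (fun s : ℂ => action S g Gt T (Θ + s • η) m k) 0 0

end Gauge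

end StarSDYM

end

noncomputable section

set_option linter.unusedSectionVars false

namespace StarSDYM

/-! ### Holomorphic functions of several variables -/

section SeveralVariables

variable {E : Type*} [NormedAddCommGroup E] [NormedSpace ℂ E]

/-! Put `τ = t/ħ`. Then `t^m ħ^k` becomes `τ^m ħ^j` with `j = k + m`, and the condition `k ≥ -m`
becomes `j ≥ 0`. Over an open set `W` of (phase space) × (base) the formal series therefore form the
ring `SAlg S W = X[[ħ]][[τ]]`, where `X` is the space of holomorphic functions on `W` and the
product is deformed in `ħ`. In this ring `ħ` is central and is not a zero divisor. Commutators are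
divisible by `ħ` because `Δ_0` is commutative, which makes the bracket meaningful. Base derivatives
are derivations and functions of the base are scalars. All of this rests on bidifferential operators
acting well on jointly holomorphic families, hence the opening block on Cauchy's formula in several
variables. `toAlg` carries the equations on series to equations in the ring.

The series in `𝒬` form the ideal generated by `τ`, so formal constructions converge degree by degree
in `τ`. `geom` is the inverse of `1 + u`. `Retraction.exists_gauge` solves `∂c = c * a` for a flat
`a` along two of the four directions, by Picard iteration on top of a Poincaré lemma with parameters
(`Retraction.exists_primitive`).

Geometry: self-duality of the curvature 2-forms, after the Kähler symmetry `curvature_swap`, says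
that the Ricci form `∂̃∂ log g` vanishes (`Metric.IsKahler.pd_log_det`). On a convex patch this
makes `g` a product.

Gauge theory: the wedge with `dw̃ ∧ dz̃` gives `F_{wz} = 0`, the wedge with `dw ∧ dz` gives
`F_{w̃z̃} = 0`, and the wedge with `Ω` gives a trace condition on `F_{αβ̃}`. Flatness in the two
half-spaces of directions yields `c` and `h` with `∂c = c * a` and `∂̃h = h * a`. In the gauge `c`
only the tilded components survive, and they are `J⁻¹ * ∂̃J` with `J = h * c⁻¹`. In that gauge the
two flatness conditions are automatic and the trace condition is Yang's equation. For `A[Θ]` the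
roles are exchanged: the Kähler condition together with `g = G G̃` makes the trace vanish
identically (`trace_lowered`), while `F_{w̃z̃}` is `G̃` times the master expression
(`curvatureForm_connOfTheta`). Passing from `J` to `Θ` is the Poincaré lemma in `(w, z)`, since
Yang's equation says that a certain 1-form is closed. Passing from `Θ` to `J` is `exists_gauge` in
`(w̃, z̃)`.

Action: integration over a contour is a trace, and base derivatives integrate to zero. Since `dΩ =
0` and `G̃` does not depend on `(w, z)`, integration by parts and cyclicity give the first variation
`tr (η * E)` with `E = det(g)` times the master expression (`hasDerivAt_action`, `eulerSeries_eq`).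
Conversely, take `η = τ · (Cauchy kernel)` on shrinking tori around a point. By induction on the
power of `ħ`, the pairing isolates the mean over the torus of one coefficient of `E` times the
density of `ω^n`. In the limit that coefficient vanishes at the centre, because the density is
nonzero, being up to a factor the Pfaffian of a nondegenerate form
(`SymplecticForm.topPower_ne_zero`). -/

omit [NormedSpace ℂ E] in
theorem continuousOn_intervalIntegral {Φ : E → ℝ → ℂ} {O : Set E} (a b : ℝ)
    (hΦ : ContinuousOn (Function.uncurry Φ) (O ×ˢ univ)) :
    ContinuousOn (fun z => ∫ s in a..b, Φ z s) O := by
  rw [continuousOn_iff_continuous_domRestrict]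
  have h : Continuous (Function.uncurry fun (z : O) (s : ℝ) => Φ z s) := by
    have h1 : Continuous fun w : O × ℝ => ((w.1 : E), w.2) := by fun_prop
    exact hΦ.comp_continuous h1 fun w => ⟨w.1.2, mem_univ _⟩
  exact intervalIntegral.continuous_parametric_intervalIntegral_of_continuous' h a b

/-- The dominating constant comes from compactness of (closed ball) × `[a, b]`, on which the
continuous derivative is bounded. -/
theorem hasFDerivAt_intervalIntegral [FiniteDimensional ℂ E] {Φ : E → ℝ → ℂ}
    {Φ' : E → ℝ → E →L[ℂ] ℂ} {O : Set E} (hO : IsOpen O) {a b : ℝ} (hab : a ≤ b)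
    (hcont : ∀ z ∈ O, ContinuousOn (Φ z) (Icc a b))
    (hcont' : ContinuousOn (Function.uncurry Φ') (O ×ˢ Icc a b))
    (hderiv : ∀ z ∈ O, ∀ s ∈ Icc a b, HasFDerivAt (fun z => Φ z s) (Φ' z s) z) {z : E}
    (hz : z ∈ O) :
    HasFDerivAt (fun z => ∫ s in a..b, Φ z s) (∫ s in a..b, Φ' z s) z := by
  have : ProperSpace E := FiniteDimensional.proper ℂ E
  obtain ⟨ε, hε, hball⟩ := Metric.nhds_basis_closedBall.mem_iff.1 (hO.mem_nhds hz)
  have hK : IsCompact (Metric.closedBall z ε ×ˢ Icc a b) :=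
    (isCompact_closedBall z ε).prod isCompact_Icc
  obtain ⟨C, hC⟩ := hK.exists_bound_of_continuousOn
    (hcont'.mono (prod_mono hball Subset.rfl))
  have hsub : uIoc a b ⊆ Icc a b := by
    rw [uIoc_of_le hab]; exact Ioc_subset_Icc_self
  have hz' : ContinuousOn (Φ' z) (Icc a b) :=
    hcont'.comp (f := fun s => (z, s)) (by fun_prop) fun s hs => ⟨hz, hs⟩
  refine intervalIntegral.hasFDerivAt_integral_of_dominated_of_fderiv_le
    (bound := fun _ => C) (F' := Φ') (Metric.closedBall_mem_nhds z hε) ?_ ?_ ?_ ?_ ?_ ?_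
  · filter_upwards [hO.mem_nhds hz] with y hy
    exact ((hcont y hy).mono hsub).aestronglyMeasurable measurableSet_uIoc
  · exact (hcont z hz).intervalIntegrable_of_Icc hab
  · exact (hz'.mono hsub).aestronglyMeasurable measurableSet_uIoc
  · exact Eventually.of_forall fun s hs y hy => hC (y, s) ⟨hy, hsub hs⟩
  · simp
  · exact Eventually.of_forall fun s hs y hy => hderiv y (hball hy) s (hsub hs)

variable {F : E → ℂ} {O : Set E}

/-- Cauchy's formula for `ζ ↦ F (z + ζ v)` at `ζ = 0`. It expresses a directional derivative through
values of `F` alone, so regularity of `F` passes to its derivative. -/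
theorem fderiv_apply_eq_circleIntegral {z v : E} (hO : IsOpen O) (hF : DifferentiableOn ℂ F O)
    {r : ℝ} (hr : 0 < r) (hsub : ∀ ζ ∈ Metric.closedBall (0 : ℂ) r, z + ζ • v ∈ O) :
    fderiv ℂ F z v = (2 * Real.pi * Complex.I : ℂ)⁻¹ •
      ∮ ζ in C(0, r), ((ζ - 0) ^ 2)⁻¹ • F (z + ζ • v) := by
  have hcont : Continuous fun ζ : ℂ => z + ζ • v := by fun_prop
  have hU : IsOpen ((fun ζ : ℂ => z + ζ • v) ⁻¹' O) := hO.preimage hcont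
  rw [Complex.two_pi_I_inv_smul_circleIntegral_sub_sq_inv_smul_of_differentiable hU hsub ?_
    (Metric.mem_ball_self hr)]
  · have h0 : z ∈ O := by simpa using hsub 0 (Metric.mem_closedBall_self hr.le)
    have h1 : HasFDerivAt F (fderiv ℂ F z) (z + (0 : ℂ) • v) := by
      simpa using ((hF z h0).differentiableAt (hO.mem_nhds h0)).hasFDerivAt
    have h2 : HasDerivAt (fun ζ : ℂ => z + ζ • v) v 0 := by
      simpa using ((hasDerivAt_id (0 : ℂ)).smul_const v).const_add z
    exact (h1.comp_hasDerivAt (0 : ℂ) h2).deriv.symm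
  · exact hF.comp (by fun_prop) fun ζ hζ => hζ

theorem exists_radius (hO : IsOpen O) {z : E} (hz : z ∈ O) (v : E) :
    ∃ r > 0, ∃ ε > 0, ∀ y ∈ Metric.ball z ε, ∀ ζ ∈ Metric.closedBall (0 : ℂ) r,
      y + ζ • v ∈ O := by
  have hcont : Continuous fun w : E × ℂ => w.1 + w.2 • v := by fun_prop
  have : (fun w : E × ℂ => w.1 + w.2 • v) ⁻¹' O ∈ 𝓝 (z, (0 : ℂ)) :=
    hcont.continuousAt.preimage_mem_nhds (hO.mem_nhds (by simpa using hz))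
  rw [nhds_prod_eq, (Metric.nhds_basis_ball.prod Metric.nhds_basis_closedBall).mem_iff] at this
  obtain ⟨⟨ε, r⟩, ⟨hε, hr⟩, h⟩ := this
  exact ⟨r, hr, ε, hε, fun y hy ζ hζ =>
    @h (y, ζ) ⟨hy, hζ⟩⟩

theorem circleIntegral_formula (F : E → ℂ) (z v : E) (r : ℝ) :
    (∮ ζ in C(0, r), ((ζ - 0) ^ 2)⁻¹ • F (z + ζ • v)) = ∫ θ in (0 : ℝ)..2 * Real.pi,
      (circleMap 0 r θ * Complex.I * (circleMap 0 r θ ^ 2)⁻¹) • F (z + circleMap 0 r θ • v) := by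
  simp [circleIntegral, mul_assoc]

theorem circleMap_mem_closedBall' {r : ℝ} (hr : 0 < r) (θ : ℝ) :
    circleMap 0 r θ ∈ Metric.closedBall (0 : ℂ) r :=
  Metric.sphere_subset_closedBall (circleMap_mem_sphere 0 hr.le θ)

theorem continuous_circleKernel {r : ℝ} (hr : 0 < r) :
    Continuous fun θ : ℝ => circleMap 0 r θ * Complex.I * (circleMap 0 r θ ^ 2)⁻¹ := by
  have h0 : ∀ θ : ℝ, circleMap 0 r θ ^ 2 ≠ 0 := fun θ =>
    pow_ne_zero _ (circleMap_ne_center hr.ne')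
  have := continuous_circleMap 0 r
  fun_prop (disch := exact h0 _)

theorem continuousOn_fderiv_of_differentiableOn [FiniteDimensional ℂ E] (hO : IsOpen O)
    (hF : DifferentiableOn ℂ F O) : ContinuousOn (fderiv ℂ F) O := by
  rw [continuousOn_clm_apply]
  intro v z hz
  obtain ⟨r, hr, ε, hε, h⟩ := exists_radius hO hz v
  have heq : ∀ y ∈ Metric.ball z ε, fderiv ℂ F y v = _ := fun y hy =>
    fderiv_apply_eq_circleIntegral hO hF hr (h y hy)
  have hc : ContinuousOn (fun y => ∮ ζ in C(0, r), ((ζ - 0) ^ 2)⁻¹ • F (y + ζ • v))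
      (Metric.ball z ε) := by
    simp_rw [circleIntegral_formula]
    refine continuousOn_intervalIntegral 0 _ ?_
    refine ContinuousOn.smul ((continuous_circleKernel hr).comp continuous_snd).continuousOn ?_
    refine hF.continuousOn.comp (f := fun w : E × ℝ => w.1 + circleMap 0 r w.2 • v) ?_ ?_
    · have := continuous_circleMap 0 r
      fun_prop
    · exact fun w hw => h _ hw.1 _ (circleMap_mem_closedBall' hr _)
  have hc2 := ((continuousOn_const (c := (2 * Real.pi * Complex.I : ℂ)⁻¹)).smul hc).congr heq
  exact ((hc2 z (Metric.mem_ball_self hε)).continuousAt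
    (Metric.ball_mem_nhds z hε)).continuousWithinAt

/-- Differentiation under the Cauchy integral; the domination needs the continuity of `fderiv` just
obtained from the same formula. This is the induction step for smoothness of all orders. -/
theorem differentiableOn_fderiv_apply [FiniteDimensional ℂ E] (hO : IsOpen O)
    (hF : DifferentiableOn ℂ F O) (v : E) : DifferentiableOn ℂ (fun z => fderiv ℂ F z v) O := by
  intro z hz
  obtain ⟨r, hr, ε, hε, h⟩ := exists_radius hO hz v
  have heq : ∀ y ∈ Metric.ball z ε, fderiv ℂ F y v = _ := fun y hy =>
    fderiv_apply_eq_circleIntegral hO hF hr (h y hy)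
  have hcm := continuous_circleMap 0 r
  have hd : DifferentiableAt ℂ (fun y => ∮ ζ in C(0, r), ((ζ - 0) ^ 2)⁻¹ • F (y + ζ • v)) z := by
    simp_rw [circleIntegral_formula]
    refine HasFDerivAt.differentiableAt (hasFDerivAt_intervalIntegral (O := Metric.ball z ε) Metric.isOpen_ball
      Real.two_pi_pos.le (Φ' := fun y θ => (circleMap 0 r θ * Complex.I * (circleMap 0 r θ ^ 2)⁻¹) •
        fderiv ℂ F (y + circleMap 0 r θ • v)) ?_ ?_ ?_ (Metric.mem_ball_self hε))
    · intro y hy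
      refine ContinuousOn.smul (continuous_circleKernel hr).continuousOn ?_
      exact hF.continuousOn.comp (by fun_prop) fun θ _ =>
        h _ hy _ (circleMap_mem_closedBall' hr _)
    · refine ContinuousOn.smul ((continuous_circleKernel hr).comp continuous_snd).continuousOn ?_
      refine (continuousOn_fderiv_of_differentiableOn hO hF).comp
        (f := fun w : E × ℝ => w.1 + circleMap 0 r w.2 • v) ?_ ?_
      · fun_prop
      · exact fun w hw => h _ hw.1 _ (circleMap_mem_closedBall' hr _)
    · intro y hy θ _
      have hm := h _ hy _ (circleMap_mem_closedBall' hr θ)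
      have h1 := ((hF _ hm).differentiableAt (hO.mem_nhds hm)).hasFDerivAt
      have h2 : HasFDerivAt (fun y => y + circleMap 0 r θ • v) (ContinuousLinearMap.id ℂ E) y :=
        (hasFDerivAt_id y).add_const _
      have h3 : HasFDerivAt (fun y => F (y + circleMap 0 r θ • v))
          (fderiv ℂ F (y + circleMap 0 r θ • v)) y := HasFDerivAt.comp y h1 h2
      exact h3.const_smul (circleMap 0 r θ * Complex.I * (circleMap 0 r θ ^ 2)⁻¹)
  refine DifferentiableAt.differentiableWithinAt ?_
  refine (hd.const_mul (2 * Real.pi * Complex.I : ℂ)⁻¹).congr_of_eventuallyEq ?_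
  filter_upwards [Metric.ball_mem_nhds z hε] with y hy using heq y hy

theorem contDiffOn_nat_of_differentiableOn [FiniteDimensional ℂ E] (hO : IsOpen O)
    (hF : DifferentiableOn ℂ F O) (n : ℕ) : ContDiffOn ℂ n F O := by
  induction n generalizing F with
  | zero => exact contDiffOn_zero.2 hF.continuousOn
  | succ n ih =>
    rw [Nat.cast_add, Nat.cast_one, contDiffOn_succ_iff_fderiv_of_isOpen hO]
    refine ⟨hF, by simp, ?_⟩
    rw [contDiffOn_clm_apply]
    exact fun v => ih (differentiableOn_fderiv_apply hO hF v)

theorem fderiv_fderiv_comm [FiniteDimensional ℂ E] (hO : IsOpen O)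
    (hF : DifferentiableOn ℂ F O) {z : E} (hz : z ∈ O) (v w : E) :
    fderiv ℂ (fun y => fderiv ℂ F y v) z w = fderiv ℂ (fun y => fderiv ℂ F y w) z v := by
  have h2 : ContDiffAt ℂ 2 F z := (contDiffOn_nat_of_differentiableOn hO hF 2).contDiffAt
    (hO.mem_nhds hz)
  have hd : DifferentiableAt ℂ (fderiv ℂ F) z :=
    (h2.fderiv_right (m := 1) (by norm_num)).differentiableAt (by norm_num)
  have hs := second_derivative_symmetric_of_eventually (𝕜 := ℂ) (f := F) (f' := fderiv ℂ F)
    (f'' := fderiv ℂ (fderiv ℂ F) z) (x := z)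
    (by filter_upwards [hO.mem_nhds hz] with y hy using
      ((hF y hy).differentiableAt (hO.mem_nhds hy)).hasFDerivAt) hd.hasFDerivAt
  rw [fderiv_clm_apply hd (differentiableAt_const _), fderiv_clm_apply hd (differentiableAt_const _)]
  simpa using hs w v

/-- The iterated directional derivative `∂_{v_0} ⋯ ∂_{v_{a-1}} F`. -/
def dirDeriv (F : E → ℂ) : {a : ℕ} → (Fin a → E) → E → ℂ
  | 0, _ => F
  | _ + 1, v => fun z => fderiv ℂ (dirDeriv F (Fin.tail v)) z (v 0)

theorem differentiableOn_dirDeriv [FiniteDimensional ℂ E] (hO : IsOpen O)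
    (hF : DifferentiableOn ℂ F O) {a : ℕ} (v : Fin a → E) :
    DifferentiableOn ℂ (dirDeriv F v) O := by
  induction a with
  | zero => exact hF
  | succ a ih => exact differentiableOn_fderiv_apply hO (ih _) _

theorem iteratedFDeriv_eq_dirDeriv [FiniteDimensional ℂ E] (hO : IsOpen O)
    (hF : DifferentiableOn ℂ F O) {a : ℕ} (v : Fin a → E) {z : E} (hz : z ∈ O) :
    iteratedFDeriv ℂ a F z v = dirDeriv F v z := by
  induction a generalizing z with
  | zero => simp [dirDeriv]
  | succ a ih =>
    rw [iteratedFDeriv_succ_apply_left]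
    have hd : DifferentiableAt ℂ (iteratedFDeriv ℂ a F) z := by
      have h1 : ContDiffAt ℂ (a + 1 : ℕ) F z :=
        (contDiffOn_nat_of_differentiableOn hO hF (a + 1)).contDiffAt (hO.mem_nhds hz)
      exact h1.differentiableAt_iteratedFDeriv (by exact_mod_cast Nat.lt_succ_self a)
    have h2 : fderiv ℂ (dirDeriv F (Fin.tail v)) z =
        fderiv ℂ (fun y => iteratedFDeriv ℂ a F y (Fin.tail v)) z := by
      refine Filter.EventuallyEq.fderiv_eq ?_
      filter_upwards [hO.mem_nhds hz] with y hy using (ih _ hy).symm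
    simp only [dirDeriv, h2]
    have h3 := (ContinuousMultilinearMap.apply ℂ (fun _ : Fin a => E) ℂ
      (Fin.tail v)).hasFDerivAt.comp z hd.hasFDerivAt
    have h4 : fderiv ℂ (fun y => iteratedFDeriv ℂ a F y (Fin.tail v)) z = _ := h3.fderiv
    rw [h4]
    rfl

theorem fderiv_dirDeriv_comm [FiniteDimensional ℂ E] (hO : IsOpen O)
    (hF : DifferentiableOn ℂ F O) {a : ℕ} (v : Fin a → E) (w : E) {z : E} (hz : z ∈ O) :
    fderiv ℂ (dirDeriv F v) z w = dirDeriv (fun y => fderiv ℂ F y w) v z := by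
  induction a generalizing z with
  | zero => rfl
  | succ a ih =>
    simp only [dirDeriv]
    rw [fderiv_fderiv_comm hO (differentiableOn_dirDeriv hO hF _) hz]
    congr 1
    refine Filter.EventuallyEq.fderiv_eq ?_
    filter_upwards [hO.mem_nhds hz] with y hy using ih _ hy

theorem dirDeriv_congr (hO : IsOpen O) {F₁ F₂ : E → ℂ} (h : EqOn F₁ F₂ O) {a : ℕ}
    (v : Fin a → E) : EqOn (dirDeriv F₁ v) (dirDeriv F₂ v) O := by
  induction a with
  | zero => exact h
  | succ a ih =>
    intro z hz
    simp only [dirDeriv]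
    congr 1
    refine Filter.EventuallyEq.fderiv_eq ?_
    filter_upwards [hO.mem_nhds hz] with y hy using ih _ hy

theorem dirDeriv_add [FiniteDimensional ℂ E] (hO : IsOpen O) {F₁ F₂ : E → ℂ}
    (h₁ : DifferentiableOn ℂ F₁ O) (h₂ : DifferentiableOn ℂ F₂ O) {a : ℕ} (v : Fin a → E) :
    EqOn (dirDeriv (F₁ + F₂) v) (dirDeriv F₁ v + dirDeriv F₂ v) O := by
  induction a with
  | zero => exact fun _ _ => rfl
  | succ a ih =>
    intro z hz
    have hd₁ := (differentiableOn_dirDeriv hO h₁ (Fin.tail v)).differentiableAt (hO.mem_nhds hz)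
    have hd₂ := (differentiableOn_dirDeriv hO h₂ (Fin.tail v)).differentiableAt (hO.mem_nhds hz)
    have : fderiv ℂ (dirDeriv (F₁ + F₂) (Fin.tail v)) z =
        fderiv ℂ (dirDeriv F₁ (Fin.tail v) + dirDeriv F₂ (Fin.tail v)) z := by
      refine Filter.EventuallyEq.fderiv_eq ?_
      filter_upwards [hO.mem_nhds hz] with y hy using ih _ hy
    simp only [dirDeriv, this, Pi.add_apply]
    rw [fderiv_add hd₁ hd₂]
    rfl

/-- Used with `c` a function of the base and the `v l` phase directions; it gives linearity of the
`*`-product over functions of the base. -/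
theorem dirDeriv_mul [FiniteDimensional ℂ E] (hO : IsOpen O) {c : E → ℂ}
    (hc : DifferentiableOn ℂ c O) (hF : DifferentiableOn ℂ F O) {a : ℕ} (v : Fin a → E)
    (hv : ∀ z ∈ O, ∀ l, fderiv ℂ c z (v l) = 0) :
    EqOn (dirDeriv (c * F) v) (c * dirDeriv F v) O := by
  induction a with
  | zero => exact fun _ _ => rfl
  | succ a ih =>
    intro z hz
    have hd := (differentiableOn_dirDeriv hO hF (Fin.tail v)).differentiableAt (hO.mem_nhds hz)
    have : fderiv ℂ (dirDeriv (c * F) (Fin.tail v)) z =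
        fderiv ℂ (c * dirDeriv F (Fin.tail v)) z := by
      refine Filter.EventuallyEq.fderiv_eq ?_
      filter_upwards [hO.mem_nhds hz] with y hy using
        ih _ (fun z hz l => hv z hz l.succ) hy
    simp only [dirDeriv, this, Pi.mul_apply]
    rw [fderiv_mul (hc.differentiableAt (hO.mem_nhds hz)) hd]
    simp [hv z hz 0]

theorem fderiv_slice_left {E' : Type*} [NormedAddCommGroup E'] [NormedSpace ℂ E']
    {F : E × E' → ℂ} {z : E × E'} (hF : DifferentiableAt ℂ F z) (v : E) :
    fderiv ℂ F z (v, 0) = fderiv ℂ (fun y => F (y, z.2)) z.1 v := by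
  have h : HasFDerivAt (fun y : E => (y, z.2)) (ContinuousLinearMap.inl ℂ E E') z.1 :=
    hasFDerivAt_prodMk_left _ _
  have h2 : HasFDerivAt (fun y => F (y, z.2)) _ z.1 := HasFDerivAt.comp z.1 hF.hasFDerivAt h
  rw [h2.fderiv]
  rfl

theorem fderiv_slice_right {E' : Type*} [NormedAddCommGroup E'] [NormedSpace ℂ E']
    {F : E × E' → ℂ} {z : E × E'} (hF : DifferentiableAt ℂ F z) (v : E') :
    fderiv ℂ F z (0, v) = fderiv ℂ (fun p => F (z.1, p)) z.2 v := by
  have h : HasFDerivAt (fun p : E' => (z.1, p)) (ContinuousLinearMap.inr ℂ E E') z.2 :=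
    hasFDerivAt_prodMk_right _ _
  have h2 : HasFDerivAt (fun p => F (z.1, p)) _ z.2 := HasFDerivAt.comp z.2 hF.hasFDerivAt h
  rw [h2.fderiv]
  rfl

theorem dirDeriv_slice_left {E' : Type*} [NormedAddCommGroup E'] [NormedSpace ℂ E']
    [FiniteDimensional ℂ E] [FiniteDimensional ℂ E']
    {F : E × E' → ℂ} {O : Set (E × E')} (hO : IsOpen O) (hF : DifferentiableOn ℂ F O)
    {a : ℕ} (v : Fin a → E) {z : E × E'} (hz : z ∈ O) :
    dirDeriv F (fun l => (v l, 0)) z = dirDeriv (fun y => F (y, z.2)) v z.1 := by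
  induction a generalizing z with
  | zero => rfl
  | succ a ih =>
    simp only [dirDeriv]
    have hd := (differentiableOn_dirDeriv hO hF
      (Fin.tail fun l => ((v l, 0) : E × E'))).differentiableAt (hO.mem_nhds hz)
    rw [fderiv_slice_left hd]
    congr 1
    refine Filter.EventuallyEq.fderiv_eq ?_
    have hc : Continuous fun y : E => (y, z.2) := by fun_prop
    filter_upwards [hc.continuousAt.preimage_mem_nhds (hO.mem_nhds hz)] with y hy
    exact ih (Fin.tail v) hy

end SeveralVariables

end StarSDYM

namespace StarSDYM

/-! ### Holomorphic functions on (phase space) × (base) -/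

section Charts

variable (n : ℕ) {P : Type*} [TopologicalSpace P] [ChartedSpace (Phase n) P]

/-- `F` is jointly holomorphic over `W`. -/
abbrev Hol (F : P × Base → ℂ) (W : Set (P × Base)) : Prop :=
  MDifferentiableOn (𝓘(ℂ, Phase n).prod 𝓘(ℂ, Base)) 𝓘(ℂ, ℂ) F W

variable {n}

/-- `F` in the chart `φ` of the phase space. -/
def hat (φ : OpenPartialHomeomorph P (Phase n)) (F : P × Base → ℂ) : Phase n × Base → ℂ :=
  fun z => F (φ.symm z.1, z.2)

/-- The part of `W` over the chart `φ`. -/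
def hatDom (φ : OpenPartialHomeomorph P (Phase n)) (W : Set (P × Base)) : Set (Phase n × Base) :=
  {z | z.1 ∈ φ.target ∧ (φ.symm z.1, z.2) ∈ W}

theorem isOpen_hatDom (φ : OpenPartialHomeomorph P (Phase n)) {W : Set (P × Base)}
    (hW : IsOpen W) : IsOpen (hatDom φ W) := by
  have h := (φ.prod (OpenPartialHomeomorph.refl Base)).symm.isOpen_inter_preimage hW
  convert h using 1
  ext z
  simp [hatDom]

theorem mem_hatDom {φ : OpenPartialHomeomorph P (Phase n)} {W : Set (P × Base)} {q : P × Base}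
    (hq : q.1 ∈ φ.source) (hqW : q ∈ W) : (φ q.1, q.2) ∈ hatDom φ W :=
  ⟨φ.map_source hq, by simpa [φ.left_inv hq] using hqW⟩

theorem hat_apply {φ : OpenPartialHomeomorph P (Phase n)} (F : P × Base → ℂ) {q : P × Base}
    (hq : q.1 ∈ φ.source) : hat φ F (φ q.1, q.2) = F q := by
  simp [hat, φ.left_inv hq]

variable [IsManifold 𝓘(ℂ, Phase n) ω P]

theorem mem_maximalAtlas_one {φ : OpenPartialHomeomorph P (Phase n)}
    (hφ : φ ∈ IsManifold.maximalAtlas 𝓘(ℂ, Phase n) ω P) :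
    φ ∈ IsManifold.maximalAtlas 𝓘(ℂ, Phase n) 1 P :=
  IsManifold.maximalAtlas_subset_of_le (by simp) hφ

theorem chartAt_mem (x : P) :
    chartAt (Phase n) x ∈ IsManifold.maximalAtlas 𝓘(ℂ, Phase n) ω P :=
  IsManifold.chart_mem_maximalAtlas x

theorem mdifferentiableAt_iff_space {f : Phase n × Base → ℂ} {z : Phase n × Base} :
    MDifferentiableAt (𝓘(ℂ, Phase n).prod 𝓘(ℂ, Base)) 𝓘(ℂ, ℂ) f z ↔ DifferentiableAt ℂ f z := by
  rw [← mdifferentiableAt_iff_differentiableAt, modelWithCornersSelf_prod (E := Phase n) (F := Base),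
    ← chartedSpaceSelf_prod (H := Phase n) (H' := Base)]

theorem Hol.differentiableOn_hat {φ : OpenPartialHomeomorph P (Phase n)}
    (hφ : φ ∈ IsManifold.maximalAtlas 𝓘(ℂ, Phase n) ω P) {F : P × Base → ℂ}
    {W : Set (P × Base)} (hW : IsOpen W) (hF : Hol n F W) :
    DifferentiableOn ℂ (hat φ F) (hatDom φ W) := by
  rintro ⟨y, p⟩ hz
  refine DifferentiableAt.differentiableWithinAt ?_
  rw [← mdifferentiableAt_iff_space]
  have : IsManifold 𝓘(ℂ, Phase n) 1 P := IsManifold.of_le (n := ω) (by simp)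
  have h1 : MDifferentiableAt 𝓘(ℂ, Phase n) 𝓘(ℂ, Phase n) φ.symm y :=
    mdifferentiableAt_symm_of_mem_maximalAtlas (mem_maximalAtlas_one hφ) hz.1
  have h2 : MDifferentiableAt 𝓘(ℂ, Base) 𝓘(ℂ, Base) (id : Base → Base) p := mdifferentiableAt_id
  have h3 := (hF (φ.symm y, p) hz.2).mdifferentiableAt (hW.mem_nhds hz.2)
  exact MDifferentiableAt.comp (y, p) h3 (h1.prodMap h2)

theorem hol_of_hat {F : P × Base → ℂ} {W : Set (P × Base)}
    (h : ∀ q ∈ W, ∃ φ ∈ IsManifold.maximalAtlas 𝓘(ℂ, Phase n) ω P, q.1 ∈ φ.source ∧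
      DifferentiableAt ℂ (hat φ F) (φ q.1, q.2)) : Hol n F W := by
  rintro ⟨x, p⟩ hq
  obtain ⟨φ, hφ, hx, hd⟩ := h _ hq
  refine MDifferentiableAt.mdifferentiableWithinAt ?_
  have : IsManifold 𝓘(ℂ, Phase n) 1 P := IsManifold.of_le (n := ω) (by simp)
  have h1 : MDifferentiableAt 𝓘(ℂ, Phase n) 𝓘(ℂ, Phase n) φ x :=
    mdifferentiableAt_of_mem_maximalAtlas (mem_maximalAtlas_one hφ) hx
  have h2 : MDifferentiableAt 𝓘(ℂ, Base) 𝓘(ℂ, Base) (id : Base → Base) p := mdifferentiableAt_id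
  rw [← mdifferentiableAt_iff_space] at hd
  have h3 := MDifferentiableAt.comp (x, p) hd (h1.prodMap h2)
  refine h3.congr_of_eventuallyEq ?_
  have h4 : φ.source ×ˢ (univ : Set Base) ∈ 𝓝 (x, p) :=
    (φ.open_source.prod isOpen_univ).mem_nhds ⟨hx, mem_univ _⟩
  filter_upwards [h4] with q hq
  exact (hat_apply F hq.1).symm

theorem Hol.holAt {F : P × Base → ℂ} {W : Set (P × Base)} (hW : IsOpen W) (hF : Hol n F W)
    {q : P × Base} (hq : q ∈ W) : HolAt n (fun x => F (x, q.2)) q.1 := by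
  have hc : Continuous fun x : P => (x, q.2) := by fun_prop
  filter_upwards [hc.continuousAt.preimage_mem_nhds (hW.mem_nhds hq)] with x hx
  have h3 := (hF (x, q.2) hx).mdifferentiableAt (hW.mem_nhds hx)
  exact MDifferentiableAt.comp (f := fun x : P => (x, q.2)) x h3
    (mdifferentiableAt_id.prodMk mdifferentiableAt_const)

theorem coordDeriv_eq_dirDeriv {φ : OpenPartialHomeomorph P (Phase n)}
    (hφ : φ ∈ IsManifold.maximalAtlas 𝓘(ℂ, Phase n) ω P) {F : P × Base → ℂ}
    {W : Set (P × Base)} (hW : IsOpen W) (hF : Hol n F W) {q : P × Base} (hqφ : q.1 ∈ φ.source)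
    (hq : q ∈ W) {a : ℕ} (s : Fin a → Fin (2 * n)) :
    coordDeriv φ (fun x => F (x, q.2)) s q.1 =
      dirDeriv (hat φ F) (fun l => ((Pi.single (s l) 1 : Phase n), 0)) (φ q.1, q.2) := by
  have hd := hF.differentiableOn_hat hφ hW
  have ho := isOpen_hatDom φ hW
  have hz := mem_hatDom hqφ hq
  have hc : Continuous fun y : Phase n => (y, q.2) := by fun_prop
  rw [dirDeriv_slice_left (v := fun l => (Pi.single (s l) 1 : Phase n)) ho hd hz, coordDeriv,
    iteratedFDeriv_eq_dirDeriv (ho.preimage hc) ?_ _ (by exact hz)]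
  · rfl
  · exact DifferentiableOn.comp (f := fun y : Phase n => (y, q.2)) hd (by fun_prop) fun y hy => hy

/-- The partial derivative along the base of a function on (phase space) × (base). -/
def bd (i : Idx) (F : P × Base → ℂ) : P × Base → ℂ := fun q => pd i (fun p => F (q.1, p)) q.2

theorem bd_eq_hat {φ : OpenPartialHomeomorph P (Phase n)}
    (hφ : φ ∈ IsManifold.maximalAtlas 𝓘(ℂ, Phase n) ω P) {F : P × Base → ℂ}
    {W : Set (P × Base)} (hW : IsOpen W) (hF : Hol n F W) {z : Phase n × Base}
    (hz : z ∈ hatDom φ W) (i : Idx) :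
    hat φ (bd i F) z = fderiv ℂ (hat φ F) z (0, dirVec i) := by
  rw [fderiv_slice_right ((hF.differentiableOn_hat hφ hW).differentiableAt ((isOpen_hatDom φ hW).mem_nhds hz))]
  rfl

theorem Hol.bd_hol {F : P × Base → ℂ} {W : Set (P × Base)} (hW : IsOpen W) (hF : Hol n F W)
    (i : Idx) : Hol n (bd i F) W := by
  refine hol_of_hat fun q hq => ⟨chartAt _ q.1, chartAt_mem _, mem_chart_source _ _, ?_⟩
  have ho := isOpen_hatDom (chartAt (Phase n) q.1) hW
  have hn := ho.mem_nhds (mem_hatDom (mem_chart_source (Phase n) q.1) hq)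
  refine ((differentiableOn_fderiv_apply ho (hF.differentiableOn_hat (chartAt_mem q.1) hW)
    (0, dirVec i)).differentiableAt hn).congr_of_eventuallyEq ?_
  filter_upwards [hn] with z hz using bd_eq_hat (chartAt_mem q.1) hW hF hz i

/-- Functions agreeing in all charts over `W` agree over `W`. -/
theorem eqOn_of_hat {F H : P × Base → ℂ} {W : Set (P × Base)}
    (h : ∀ φ ∈ IsManifold.maximalAtlas 𝓘(ℂ, Phase n) ω P, EqOn (hat φ F) (hat φ H) (hatDom φ W)) :
    EqOn F H W := by
  intro q hq
  have := h _ (chartAt_mem q.1) (mem_hatDom (mem_chart_source (Phase n) q.1) hq)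
  rwa [hat_apply _ (mem_chart_source (Phase n) q.1), hat_apply _ (mem_chart_source (Phase n) q.1)]
    at this

theorem Hol.differentiableAt_base {F : P × Base → ℂ} {W : Set (P × Base)} (hW : IsOpen W)
    (hF : Hol n F W) {q : P × Base} (hq : q ∈ W) :
    DifferentiableAt ℂ (fun p => F (q.1, p)) q.2 := by
  have h3 := (hF q hq).mdifferentiableAt (hW.mem_nhds hq)
  have h4 : MDifferentiableAt 𝓘(ℂ, Base) (𝓘(ℂ, Phase n).prod 𝓘(ℂ, Base))
      (fun p : Base => (q.1, p)) q.2 := mdifferentiableAt_const.prodMk mdifferentiableAt_id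
  rw [← mdifferentiableAt_iff_differentiableAt]
  exact MDifferentiableAt.comp (f := fun p : Base => (q.1, p)) q.2 h3 h4

theorem bd_bd_comm {F : P × Base → ℂ} {W : Set (P × Base)} (hW : IsOpen W)
    (hF : Hol n F W) (i j : Idx) :
    EqOn (bd i (bd j F)) (bd j (bd i F)) W := by
  intro q hq
  have hc : Continuous fun p : Base => (q.1, p) := by fun_prop
  have hd : DifferentiableOn ℂ (fun p => F (q.1, p)) ((fun p : Base => (q.1, p)) ⁻¹' W) :=
    fun p hp => (hF.differentiableAt_base hW (q := (q.1, p)) hp).differentiableWithinAt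
  exact fderiv_fderiv_comm (hW.preimage hc) hd (z := q.2) (by exact hq) (dirVec j) (dirVec i)

end Charts

/-! ### The `*`-product of families -/

section Families

variable {n : ℕ} {P : Type*} [TopologicalSpace P] [ChartedSpace (Phase n) P]
  {Ω : SymplecticForm n P} (S : StarProduct Ω)

/-- `Δ_k` applied fibrewise over the base. -/
def deltaFam (k : ℕ) (F H : P × Base → ℂ) : P × Base → ℂ := fun q =>
  S.Δ k (fun x => F (x, q.2)) (fun x => H (x, q.2)) q.1

variable [IsManifold 𝓘(ℂ, Phase n) ω P]

/-- The coordinate vectors of the phase space in (phase space) × (base). -/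
abbrev phaseVec {a : ℕ} (s : Fin a → Fin (2 * n)) : Fin a → Phase n × Base :=
  fun l => ((Pi.single (s l) 1 : Phase n), 0)

/-- The coefficients are chosen once per chart, before `W`, `F` and `H`, and do not involve the base
point. Locality, bilinearity and the Leibniz rule along the base are all read off from this one
formula. -/
theorem exists_deltaFam_formula (k : ℕ) {φ : OpenPartialHomeomorph P (Phase n)}
    (hφ : φ ∈ IsManifold.maximalAtlas 𝓘(ℂ, Phase n) ω P) :
    ∃ C : ∀ a b : ℕ, (Fin a → Fin (2 * n)) → (Fin b → Fin (2 * n)) → Phase n → ℂ,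
      (∀ a b s s', DifferentiableOn ℂ (C a b s s') φ.target) ∧
      ∀ W : Set (P × Base), IsOpen W → ∀ F H : P × Base → ℂ, Hol n F W → Hol n H W →
        ∀ z ∈ hatDom φ W, hat φ (deltaFam S k F H) z =
          ∑ a ∈ Finset.range (k + 1), ∑ b ∈ Finset.range (k + 1),
            ∑ s : Fin a → Fin (2 * n), ∑ s' : Fin b → Fin (2 * n),
              C a b s s' z.1 * dirDeriv (hat φ F) (phaseVec s) z *
                dirDeriv (hat φ H) (phaseVec s') z := by
  obtain ⟨C, hC, h⟩ := S.bidifferential k φ hφ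
  refine ⟨C, hC, fun W hW F H hF hH z hz => ?_⟩
  have hs : φ.symm z.1 ∈ φ.source := φ.map_target hz.1
  rw [hat, deltaFam, h _ hs _ _ (hF.holAt hW hz.2) (hH.holAt hW hz.2)]
  refine Finset.sum_congr rfl fun a _ => Finset.sum_congr rfl fun b _ =>
    Finset.sum_congr rfl fun s _ => Finset.sum_congr rfl fun s' _ => ?_
  have h1 := coordDeriv_eq_dirDeriv hφ hW hF (q := (φ.symm z.1, z.2)) hs hz.2 s
  have h2 := coordDeriv_eq_dirDeriv hφ hW hH (q := (φ.symm z.1, z.2)) hs hz.2 s'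
  simp only [φ.right_inv hz.1] at h1 h2
  rw [h1, h2, φ.right_inv hz.1]

variable {S} {W : Set (P × Base)} {F H F₁ F₂ : P × Base → ℂ}

theorem Hol.delta (hW : IsOpen W) (k : ℕ) (hF : Hol n F W) (hH : Hol n H W) :
    Hol n (deltaFam S k F H) W := by
  refine hol_of_hat fun q hq => ⟨chartAt _ q.1, chartAt_mem _, mem_chart_source _ _, ?_⟩
  obtain ⟨C, hC, h⟩ := exists_deltaFam_formula S k (chartAt_mem q.1)
  have ho := isOpen_hatDom (chartAt (Phase n) q.1) hW
  have hn := ho.mem_nhds (mem_hatDom (mem_chart_source (Phase n) q.1) hq)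
  have hF' := hF.differentiableOn_hat (chartAt_mem q.1) hW
  have hH' := hH.differentiableOn_hat (chartAt_mem q.1) hW
  have key : DifferentiableOn ℂ (hat (chartAt (Phase n) q.1) (deltaFam S k F H))
      (hatDom (chartAt (Phase n) q.1) W) := by
    refine DifferentiableOn.congr ?_ (h W hW F H hF hH)
    refine DifferentiableOn.fun_sum fun a _ => DifferentiableOn.fun_sum fun b _ =>
      DifferentiableOn.fun_sum fun s _ => DifferentiableOn.fun_sum fun s' _ => ?_
    refine DifferentiableOn.mul (DifferentiableOn.mul ?_ ?_) ?_
    · exact (hC a b s s').comp differentiableOn_fst fun z hz => hz.1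
    · exact differentiableOn_dirDeriv ho hF' _
    · exact differentiableOn_dirDeriv ho hH' _
  exact key.differentiableAt hn

/-- Locality of differential operators. It has to be derived from the chart formula, because `Δ_k`
is a map on all functions and is constrained only where its arguments are holomorphic. -/
theorem deltaFam_congr (hW : IsOpen W) (k : ℕ) (hF : Hol n F₁ W) (hH : Hol n H W)
    (h : EqOn F₁ F₂ W) : EqOn (deltaFam S k F₁ H) (deltaFam S k F₂ H) W := by
  refine eqOn_of_hat (n := n) fun φ hφ z hz => ?_
  obtain ⟨C, hC, hf⟩ := exists_deltaFam_formula S k hφ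
  have hF₂ : Hol n F₂ W := hF.congr fun q hq => (h hq).symm
  rw [hf W hW _ _ hF hH z hz, hf W hW _ _ hF₂ hH z hz]
  have he : EqOn (hat φ F₁) (hat φ F₂) (hatDom φ W) := fun z hz => h hz.2
  simp only [dirDeriv_congr (isOpen_hatDom φ hW) he _ hz]

theorem deltaFam_congr_right (hW : IsOpen W) (k : ℕ) (hF : Hol n F₁ W) (hH : Hol n H W)
    (h : EqOn F₁ F₂ W) : EqOn (deltaFam S k H F₁) (deltaFam S k H F₂) W := by
  refine eqOn_of_hat (n := n) fun φ hφ z hz => ?_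
  obtain ⟨C, hC, hf⟩ := exists_deltaFam_formula S k hφ
  have hF₂ : Hol n F₂ W := hF.congr fun q hq => (h hq).symm
  rw [hf W hW _ _ hH hF z hz, hf W hW _ _ hH hF₂ z hz]
  have he : EqOn (hat φ F₁) (hat φ F₂) (hatDom φ W) := fun z hz => h hz.2
  simp only [dirDeriv_congr (isOpen_hatDom φ hW) he _ hz]

theorem deltaFam_add_left (hW : IsOpen W) (k : ℕ) (h₁ : Hol n F₁ W) (h₂ : Hol n F₂ W)
    (hH : Hol n H W) :
    EqOn (deltaFam S k (F₁ + F₂) H) (deltaFam S k F₁ H + deltaFam S k F₂ H) W := by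
  refine eqOn_of_hat (n := n) fun φ hφ z hz => ?_
  obtain ⟨C, hC, hf⟩ := exists_deltaFam_formula S k hφ
  change _ = hat φ (deltaFam S k F₁ H) z + hat φ (deltaFam S k F₂ H) z
  rw [hf W hW _ _ (h₁.add h₂) hH z hz, hf W hW _ _ h₁ hH z hz, hf W hW _ _ h₂ hH z hz]
  have ho := isOpen_hatDom φ hW
  have hs : ∀ {a : ℕ} (v : Fin a → Phase n × Base), dirDeriv (hat φ (F₁ + F₂)) v z =
      dirDeriv (hat φ F₁) v z + dirDeriv (hat φ F₂) v z := fun v =>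
    dirDeriv_add ho (h₁.differentiableOn_hat hφ hW) (h₂.differentiableOn_hat hφ hW) v hz
  simp only [hs, mul_add, add_mul, Finset.sum_add_distrib]

theorem deltaFam_add_right (hW : IsOpen W) (k : ℕ) (h₁ : Hol n F₁ W) (h₂ : Hol n F₂ W)
    (hH : Hol n H W) :
    EqOn (deltaFam S k H (F₁ + F₂)) (deltaFam S k H F₁ + deltaFam S k H F₂) W := by
  refine eqOn_of_hat (n := n) fun φ hφ z hz => ?_
  obtain ⟨C, hC, hf⟩ := exists_deltaFam_formula S k hφ
  change _ = hat φ (deltaFam S k H F₁) z + hat φ (deltaFam S k H F₂) z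
  rw [hf W hW _ _ hH (h₁.add h₂) z hz, hf W hW _ _ hH h₁ z hz, hf W hW _ _ hH h₂ z hz]
  have ho := isOpen_hatDom φ hW
  have hs : ∀ {a : ℕ} (v : Fin a → Phase n × Base), dirDeriv (hat φ (F₁ + F₂)) v z =
      dirDeriv (hat φ F₁) v z + dirDeriv (hat φ F₂) v z := fun v =>
    dirDeriv_add ho (h₁.differentiableOn_hat hφ hW) (h₂.differentiableOn_hat hφ hW) v hz
  simp only [hs, mul_add, Finset.sum_add_distrib]

theorem dirDeriv_hat_smul (hW : IsOpen W) {φ : OpenPartialHomeomorph P (Phase n)}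
    (hφ : φ ∈ IsManifold.maximalAtlas 𝓘(ℂ, Phase n) ω P) {c : Base → ℂ}
    (hc : Hol n (fun q : P × Base => c q.2) W) (hF : Hol n F W) {a : ℕ}
    (s : Fin a → Fin (2 * n)) {z : Phase n × Base} (hz : z ∈ hatDom φ W) :
    dirDeriv (hat φ fun q => c q.2 * F q) (phaseVec s) z =
      c z.2 * dirDeriv (hat φ F) (phaseVec s) z := by
  refine dirDeriv_mul (c := hat φ fun q => c q.2) (isOpen_hatDom φ hW) (hc.differentiableOn_hat hφ hW)
    (hF.differentiableOn_hat hφ hW) (phaseVec s) (fun z hz l => ?_) hz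
  have := fderiv_slice_left ((hc.differentiableOn_hat hφ hW).differentiableAt
    ((isOpen_hatDom φ hW).mem_nhds hz)) (Pi.single (s l) 1)
  rw [phaseVec, this]
  simp [hat]

theorem deltaFam_smul_left (hW : IsOpen W) (k : ℕ) {c : Base → ℂ}
    (hc : Hol n (fun q : P × Base => c q.2) W) (hF : Hol n F W) (hH : Hol n H W) :
    EqOn (deltaFam S k (fun q => c q.2 * F q) H) (fun q => c q.2 * deltaFam S k F H q) W := by
  refine eqOn_of_hat (n := n) fun φ hφ z hz => ?_
  obtain ⟨C, hC, hf⟩ := exists_deltaFam_formula S k hφ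
  change _ = c z.2 * hat φ (deltaFam S k F H) z
  rw [hf W hW (fun q => c q.2 * F q) _ (hc.mul hF) hH z hz, hf W hW _ _ hF hH z hz]
  simp only [dirDeriv_hat_smul hW hφ hc hF _ hz, Finset.mul_sum]
  refine Finset.sum_congr rfl fun a _ => Finset.sum_congr rfl fun b _ =>
    Finset.sum_congr rfl fun s _ => Finset.sum_congr rfl fun s' _ => ?_
  ring

theorem deltaFam_smul_right (hW : IsOpen W) (k : ℕ) {c : Base → ℂ}
    (hc : Hol n (fun q : P × Base => c q.2) W) (hF : Hol n F W) (hH : Hol n H W) :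
    EqOn (deltaFam S k H (fun q => c q.2 * F q)) (fun q => c q.2 * deltaFam S k H F q) W := by
  refine eqOn_of_hat (n := n) fun φ hφ z hz => ?_
  obtain ⟨C, hC, hf⟩ := exists_deltaFam_formula S k hφ
  change _ = c z.2 * hat φ (deltaFam S k H F) z
  rw [hf W hW _ (fun q => c q.2 * F q) hH (hc.mul hF) z hz, hf W hW _ _ hH hF z hz]
  simp only [dirDeriv_hat_smul hW hφ hc hF _ hz, Finset.mul_sum]
  refine Finset.sum_congr rfl fun a _ => Finset.sum_congr rfl fun b _ =>
    Finset.sum_congr rfl fun s _ => Finset.sum_congr rfl fun s' _ => ?_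
  ring

theorem dirDeriv_hat_bd (hW : IsOpen W) {φ : OpenPartialHomeomorph P (Phase n)}
    (hφ : φ ∈ IsManifold.maximalAtlas 𝓘(ℂ, Phase n) ω P) (hF : Hol n F W) (i : Idx) {a : ℕ}
    (v : Fin a → Phase n × Base) {z : Phase n × Base} (hz : z ∈ hatDom φ W) :
    dirDeriv (hat φ (bd i F)) v z = fderiv ℂ (dirDeriv (hat φ F) v) z (0, dirVec i) := by
  have ho := isOpen_hatDom φ hW
  rw [fderiv_dirDeriv_comm ho (hF.differentiableOn_hat hφ hW) _ _ hz]
  exact dirDeriv_congr ho (fun z hz => bd_eq_hat hφ hW hF hz i) v hz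

/-- In a chart the coefficients of `Δ_k` are constant along the base, and base derivatives commute
with phase derivatives, so only the two factors are differentiated. -/
theorem bd_deltaFam (hW : IsOpen W) (k : ℕ) (hF : Hol n F W) (hH : Hol n H W) (i : Idx) :
    EqOn (bd i (deltaFam S k F H)) (deltaFam S k (bd i F) H + deltaFam S k F (bd i H)) W := by
  refine eqOn_of_hat (n := n) fun φ hφ z hz => ?_
  obtain ⟨C, hC, hf⟩ := exists_deltaFam_formula S k hφ
  have ho := isOpen_hatDom φ hW
  change hat φ (bd i (deltaFam S k F H)) z =
    hat φ (deltaFam S k (bd i F) H) z + hat φ (deltaFam S k F (bd i H)) z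
  rw [hf W hW _ _ (hF.bd_hol hW i) hH z hz, hf W hW _ _ hF (hH.bd_hol hW i) z hz,
    bd_eq_hat hφ hW (hF.delta hW k hH) hz,
    Filter.EventuallyEq.fderiv_eq (f₁ := hat φ (deltaFam S k F H))
      (by filter_upwards [ho.mem_nhds hz] with y hy using hf W hW F H hF hH y hy)]
  have hdF : ∀ {a : ℕ} (v : Fin a → Phase n × Base), DifferentiableAt ℂ (dirDeriv (hat φ F) v) z :=
    fun v => (differentiableOn_dirDeriv ho (hF.differentiableOn_hat hφ hW) v).differentiableAt (ho.mem_nhds hz)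
  have hdH : ∀ {a : ℕ} (v : Fin a → Phase n × Base), DifferentiableAt ℂ (dirDeriv (hat φ H) v) z :=
    fun v => (differentiableOn_dirDeriv ho (hH.differentiableOn_hat hφ hW) v).differentiableAt (ho.mem_nhds hz)
  have hdC : ∀ a b s s', HasFDerivAt (fun z : Phase n × Base => C a b s s' z.1) _ z :=
    fun a b s s' => HasFDerivAt.comp z ((hC a b s s').differentiableAt
      (φ.open_target.mem_nhds hz.1)).hasFDerivAt hasFDerivAt_fst
  have hsum : HasFDerivAt (fun z => ∑ a ∈ Finset.range (k + 1), ∑ b ∈ Finset.range (k + 1),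
            ∑ s : Fin a → Fin (2 * n), ∑ s' : Fin b → Fin (2 * n),
              C a b s s' z.1 * dirDeriv (hat φ F) (phaseVec s) z *
                dirDeriv (hat φ H) (phaseVec s') z) _ z :=
    HasFDerivAt.fun_sum fun a _ => HasFDerivAt.fun_sum fun b _ => HasFDerivAt.fun_sum fun s _ =>
      HasFDerivAt.fun_sum fun s' _ =>
        ((hdC a b s s').mul (hdF (phaseVec s)).hasFDerivAt).mul (hdH (phaseVec s')).hasFDerivAt
  rw [hsum.fderiv]
  simp only [sum_apply, ← Finset.sum_add_distrib]
  refine Finset.sum_congr rfl fun a _ => Finset.sum_congr rfl fun b _ =>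
    Finset.sum_congr rfl fun s _ => Finset.sum_congr rfl fun s' _ => ?_
  have e1 := dirDeriv_hat_bd hW hφ hF i (phaseVec s) hz
  have e2 := dirDeriv_hat_bd hW hφ hH i (phaseVec s') hz
  rw [e1, e2]
  simp
  ring

end Families

end StarSDYM

namespace StarSDYM

/-! ### Formal deformations -/

open Finset.HasAntidiagonal in
/-- A formal deformation `f * h = ∑_k ħ^k Δ_k(f, h)` of a commutative product on a module. -/
structure Deformation (K X : Type*) [CommRing K] [AddCommGroup X] [Module K X] where
  Δ : ℕ → X →ₗ[K] X →ₗ[K] X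
  one : X
  one_left : ∀ k f, Δ k one f = if k = 0 then f else 0
  one_right : ∀ k f, Δ k f one = if k = 0 then f else 0
  comm : ∀ f h, Δ 0 f h = Δ 0 h f
  assoc : ∀ k f h l, ∑ ab ∈ antidiagonal k, Δ ab.1 (Δ ab.2 f h) l
    = ∑ ab ∈ antidiagonal k, Δ ab.1 f (Δ ab.2 h l)

namespace Deformation

open Finset.HasAntidiagonal

variable {K X : Type*} [CommRing K] [AddCommGroup X] [Module K X]

/-- Formal power series in `ħ` with coefficients in `X`. -/
def Quant (_ : Deformation K X) : Type _ := ℕ → X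

variable (D : Deformation K X)

instance : AddCommGroup D.Quant := inferInstanceAs (AddCommGroup (ℕ → X))
instance : Module K D.Quant := inferInstanceAs (Module K (ℕ → X))

instance : Mul D.Quant where
  mul f h := fun j => ∑ sr ∈ antidiagonal j, ∑ jj ∈ antidiagonal sr.2,
    D.Δ sr.1 (f jj.1) (h jj.2)

instance : One D.Quant where
  one := fun j => if j = 0 then D.one else 0

variable {D}

theorem Quant.mul_apply (f h : D.Quant) (j : ℕ) : (f * h) j =
    ∑ sr ∈ antidiagonal j, ∑ jj ∈ antidiagonal sr.2, D.Δ sr.1 (f jj.1) (h jj.2) := rfl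

theorem Quant.one_apply (j : ℕ) : (1 : D.Quant) j = if j = 0 then D.one else 0 := rfl

@[simp] theorem Quant.add_apply (f h : D.Quant) (j : ℕ) : (f + h) j = f j + h j := rfl
@[simp] theorem Quant.sub_apply (f h : D.Quant) (j : ℕ) : (f - h) j = f j - h j := rfl
@[simp] theorem Quant.neg_apply (f : D.Quant) (j : ℕ) : (-f) j = -f j := rfl
@[simp] theorem Quant.zero_apply (j : ℕ) : (0 : D.Quant) j = 0 := rfl
@[simp] theorem Quant.smul_apply (c : K) (f : D.Quant) (j : ℕ) : (c • f) j = c • f j := rfl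

theorem Quant.mul_assoc' (f h l : D.Quant) : f * h * l = f * (h * l) := by
  funext j
  -- Both triple products are regrouped with the total order `kr.1` of the two operators outermost
  -- and the `ħ`-degrees of `f`, `h`, `l` next. The innermost sums are then the two sides of
  -- `D.assoc`.
  have e1 : (f * h * l) j = ∑ kr ∈ antidiagonal j, ∑ jr ∈ antidiagonal kr.2,
      ∑ jj ∈ antidiagonal jr.2, ∑ ab ∈ antidiagonal kr.1,
        D.Δ ab.1 (D.Δ ab.2 (f jr.1) (h jj.1)) (l jj.2) := by
    simp only [Quant.mul_apply, map_sum, LinearMap.sum_apply, Finset.sum_sigma']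
    refine Finset.sum_nbij'
      (fun x => ⟨(x.1.1 + x.2.2.1.1, x.2.2.2.1 + (x.2.2.2.2 + x.2.1.2)),
        ⟨(x.2.2.2.1, x.2.2.2.2 + x.2.1.2), ⟨(x.2.2.2.2, x.2.1.2), (x.1.1, x.2.2.1.1)⟩⟩⟩)
      (fun x => ⟨(x.2.2.2.1, x.2.2.2.2 + (x.2.1.1 + x.2.2.1.1) + x.2.2.1.2),
        ⟨(x.2.2.2.2 + (x.2.1.1 + x.2.2.1.1), x.2.2.1.2),
          ⟨(x.2.2.2.2, x.2.1.1 + x.2.2.1.1), (x.2.1.1, x.2.2.1.1)⟩⟩⟩) ?_ ?_ ?_ ?_ ?_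
    · rintro ⟨⟨a1, a2⟩, ⟨⟨b1, b2⟩, ⟨⟨c1, c2⟩, ⟨d1, d2⟩⟩⟩⟩
      simp only [Finset.mem_sigma, Finset.HasAntidiagonal.mem_antidiagonal]
      rintro ⟨rfl, rfl, rfl, rfl⟩
      refine ⟨?_, ?_, ?_, ?_⟩ <;> lia
    · rintro ⟨⟨a1, a2⟩, ⟨⟨b1, b2⟩, ⟨⟨c1, c2⟩, ⟨d1, d2⟩⟩⟩⟩
      simp only [Finset.mem_sigma, Finset.HasAntidiagonal.mem_antidiagonal]
      rintro ⟨rfl, rfl, rfl, rfl⟩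
      refine ⟨?_, ?_, ?_, ?_⟩ <;> lia
    · rintro ⟨⟨a1, a2⟩, ⟨⟨b1, b2⟩, ⟨⟨c1, c2⟩, ⟨d1, d2⟩⟩⟩⟩
      simp only [Finset.mem_sigma, Finset.HasAntidiagonal.mem_antidiagonal]
      rintro ⟨rfl, rfl, rfl, rfl⟩
      simp [add_assoc]
    · rintro ⟨⟨a1, a2⟩, ⟨⟨b1, b2⟩, ⟨⟨c1, c2⟩, ⟨d1, d2⟩⟩⟩⟩
      simp only [Finset.mem_sigma, Finset.HasAntidiagonal.mem_antidiagonal]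
      rintro ⟨rfl, rfl, rfl, rfl⟩
      simp
    · rintro ⟨⟨a1, a2⟩, ⟨⟨b1, b2⟩, ⟨⟨c1, c2⟩, ⟨d1, d2⟩⟩⟩⟩ _
      rfl
  have e2 : (f * (h * l)) j = ∑ kr ∈ antidiagonal j, ∑ jr ∈ antidiagonal kr.2,
      ∑ jj ∈ antidiagonal jr.2, ∑ ab ∈ antidiagonal kr.1,
        D.Δ ab.1 (f jr.1) (D.Δ ab.2 (h jj.1) (l jj.2)) := by
    simp only [Quant.mul_apply, map_sum, Finset.sum_sigma']
    refine Finset.sum_nbij'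
      (fun x => ⟨(x.1.1 + x.2.2.1.1, x.2.1.1 + (x.2.2.2.1 + x.2.2.2.2)),
        ⟨(x.2.1.1, x.2.2.2.1 + x.2.2.2.2), ⟨(x.2.2.2.1, x.2.2.2.2), (x.1.1, x.2.2.1.1)⟩⟩⟩)
      (fun x => ⟨(x.2.2.2.1, x.2.1.1 + (x.2.2.2.2 + (x.2.2.1.1 + x.2.2.1.2))),
        ⟨(x.2.1.1, x.2.2.2.2 + (x.2.2.1.1 + x.2.2.1.2)),
          ⟨(x.2.2.2.2, x.2.2.1.1 + x.2.2.1.2), (x.2.2.1.1, x.2.2.1.2)⟩⟩⟩) ?_ ?_ ?_ ?_ ?_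
    · rintro ⟨⟨a1, a2⟩, ⟨⟨b1, b2⟩, ⟨⟨c1, c2⟩, ⟨d1, d2⟩⟩⟩⟩
      simp only [Finset.mem_sigma, Finset.HasAntidiagonal.mem_antidiagonal]
      rintro ⟨rfl, rfl, rfl, rfl⟩
      refine ⟨?_, ?_, ?_, ?_⟩ <;> lia
    · rintro ⟨⟨a1, a2⟩, ⟨⟨b1, b2⟩, ⟨⟨c1, c2⟩, ⟨d1, d2⟩⟩⟩⟩
      simp only [Finset.mem_sigma, Finset.HasAntidiagonal.mem_antidiagonal]
      rintro ⟨rfl, rfl, rfl, rfl⟩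
      refine ⟨?_, ?_, ?_, ?_⟩ <;> lia
    · rintro ⟨⟨a1, a2⟩, ⟨⟨b1, b2⟩, ⟨⟨c1, c2⟩, ⟨d1, d2⟩⟩⟩⟩
      simp only [Finset.mem_sigma, Finset.HasAntidiagonal.mem_antidiagonal]
      rintro ⟨rfl, rfl, rfl, rfl⟩
      simp
    · rintro ⟨⟨a1, a2⟩, ⟨⟨b1, b2⟩, ⟨⟨c1, c2⟩, ⟨d1, d2⟩⟩⟩⟩
      simp only [Finset.mem_sigma, Finset.HasAntidiagonal.mem_antidiagonal]
      rintro ⟨rfl, rfl, rfl, rfl⟩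
      simp
    · rintro ⟨⟨a1, a2⟩, ⟨⟨b1, b2⟩, ⟨⟨c1, c2⟩, ⟨d1, d2⟩⟩⟩⟩ _
      rfl
  rw [e1, e2]
  simp only [D.assoc]

theorem Quant.one_mul' (f : D.Quant) : 1 * f = f := by
  funext j
  rw [Quant.mul_apply, Finset.sum_eq_single (0, j)]
  · rw [Finset.sum_eq_single (0, j)]
    · simp [Quant.one_apply, D.one_left]
    · rintro ⟨a, b⟩ h1 h2
      have : a ≠ 0 := by
        rintro rfl; simp at h1 h2; exact h2 h1
      simp [Quant.one_apply, this]
    · simp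
  · rintro ⟨a, b⟩ h1 h2
    have : a ≠ 0 := by
      rintro rfl; simp at h1 h2; exact h2 h1
    refine Finset.sum_eq_zero fun p _ => ?_
    rw [Quant.one_apply]
    split_ifs <;> simp [D.one_left, this]
  · simp

theorem Quant.mul_one' (f : D.Quant) : f * 1 = f := by
  funext j
  rw [Quant.mul_apply, Finset.sum_eq_single (0, j)]
  · rw [Finset.sum_eq_single (j, 0)]
    · simp [Quant.one_apply, D.one_right]
    · rintro ⟨a, b⟩ h1 h2
      have : b ≠ 0 := by
        rintro rfl; simp at h1 h2; exact h2 h1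
      simp [Quant.one_apply, this]
    · simp
  · rintro ⟨a, b⟩ h1 h2
    have : a ≠ 0 := by
      rintro rfl; simp at h1 h2; exact h2 h1
    refine Finset.sum_eq_zero fun p _ => ?_
    rw [Quant.one_apply]
    split_ifs <;> simp [D.one_right, this]
  · simp

instance : Ring D.Quant where
  mul_assoc := Quant.mul_assoc'
  one_mul := Quant.one_mul'
  mul_one := Quant.mul_one'
  left_distrib f h l := by
    funext j
    simp only [Quant.mul_apply, Quant.add_apply, map_add, Finset.sum_add_distrib]
  right_distrib f h l := by
    funext j
    simp only [Quant.mul_apply, Quant.add_apply, map_add, LinearMap.add_apply,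
      Finset.sum_add_distrib]
  zero_mul f := by
    funext j
    simp [Quant.mul_apply]
  mul_zero f := by
    funext j
    simp [Quant.mul_apply]
  neg_add_cancel := neg_add_cancel
  zsmul := fun k f => k • f
  zsmul_zero' := SubNegMonoid.zsmul_zero'
  zsmul_succ' := SubNegMonoid.zsmul_succ'
  zsmul_neg' := SubNegMonoid.zsmul_neg'
  nsmul := fun k f => k • f
  nsmul_zero := AddMonoid.nsmul_zero
  nsmul_succ := AddMonoid.nsmul_succ
  sub_eq_add_neg := sub_eq_add_neg

instance : Algebra K D.Quant :=
  Algebra.ofModule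
    (fun c f h => by
      funext j
      simp [Quant.mul_apply, Finset.smul_sum])
    (fun c f h => by
      funext j
      simp [Quant.mul_apply, Finset.smul_sum])

variable (D)

/-- Formal series `∑ τ^m ħ^j a_{m,j}`, where `τ = t / ħ`. -/
abbrev Alg : Type _ := PowerSeries D.Quant

variable {D}

/-- The coefficient of `τ^m ħ^j`. -/
def cf (a : D.Alg) (m j : ℕ) : X := (PowerSeries.coeff m a) j

theorem ext_cf {a b : D.Alg} (h : ∀ m j, cf a m j = cf b m j) : a = b :=
  PowerSeries.ext fun m => funext fun j => h m j

/-- The series with given coefficients. -/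
def ofCf (x : ℕ → ℕ → X) : D.Alg := PowerSeries.mk fun m => (x m : D.Quant)

@[simp] theorem cf_ofCf (x : ℕ → ℕ → X) (m j : ℕ) : cf (ofCf x : D.Alg) m j = x m j := by
  exact congrFun (PowerSeries.coeff_mk (R := D.Quant) m x) j

@[simp] theorem cf_zero (m j : ℕ) : cf (0 : D.Alg) m j = 0 := by simp [cf]
@[simp] theorem cf_add (a b : D.Alg) (m j : ℕ) : cf (a + b) m j = cf a m j + cf b m j := by
  simp [cf]
@[simp] theorem cf_sub (a b : D.Alg) (m j : ℕ) : cf (a - b) m j = cf a m j - cf b m j := by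
  simp [cf]
@[simp] theorem cf_neg (a : D.Alg) (m j : ℕ) : cf (-a) m j = -cf a m j := by
  simp [cf]
@[simp] theorem cf_smul (c : K) (a : D.Alg) (m j : ℕ) : cf (c • a) m j = c • cf a m j := by
  simp [cf]
@[simp] theorem cf_sum {ι : Type*} (s : Finset ι) (a : ι → D.Alg) (m j : ℕ) :
    cf (∑ i ∈ s, a i) m j = ∑ i ∈ s, cf (a i) m j := by
  classical
  induction s using Finset.induction_on with
  | empty => simp
  | insert i s hi ih => simp [Finset.sum_insert hi, ih]

theorem cf_one (m j : ℕ) : cf (1 : D.Alg) m j = if m = 0 ∧ j = 0 then D.one else 0 := by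
  rw [cf, PowerSeries.coeff_one]
  by_cases hm : m = 0 <;> simp [hm, Quant.one_apply]

theorem cf_mul (a b : D.Alg) (m j : ℕ) : cf (a * b) m j =
    ∑ mm ∈ antidiagonal m, ∑ sr ∈ antidiagonal j, ∑ jj ∈ antidiagonal sr.2,
      D.Δ sr.1 (cf a mm.1 jj.1) (cf b mm.2 jj.2) := by
  have hs : ∀ (s : Finset (ℕ × ℕ)) (F : ℕ × ℕ → D.Quant), (∑ i ∈ s, F i) j = ∑ i ∈ s, F i j := by
    intro s F
    exact Finset.sum_apply (M := fun _ => X) j s F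
  rw [cf, PowerSeries.coeff_mul, hs]
  rfl

/-- A map acting on all the coefficients. -/
def mapX (T : X →+ X) : D.Alg →+ D.Alg where
  toFun a := ofCf fun m j => T (cf a m j)
  map_zero' := ext_cf fun m j => by simp
  map_add' a b := ext_cf fun m j => by simp

@[simp] theorem cf_mapX (T : X →+ X) (a : D.Alg) (m j : ℕ) :
    cf (mapX T a) m j = T (cf a m j) := by
  simp [mapX]

theorem mapX_mul {T : X →+ X} (hT : ∀ k f h, T (D.Δ k f h) = D.Δ k (T f) h + D.Δ k f (T h))
    (a b : D.Alg) : mapX T (a * b) = mapX T a * b + a * mapX T b := by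
  refine ext_cf fun m j => ?_
  simp only [cf_mapX, cf_add, cf_mul, map_sum, hT, Finset.sum_add_distrib]

/-! #### The parameter `iħ` and the bracket -/

/-- Multiplication by `ι ħ`. -/
def ih (ι : K) (a : D.Alg) : D.Alg :=
  ofCf fun m j => match j with
    | 0 => 0
    | j + 1 => ι • cf a m j

@[simp] theorem cf_ih_zero (ι : K) (a : D.Alg) (m : ℕ) : cf (ih ι a) m 0 = 0 := by simp [ih]
@[simp] theorem cf_ih_succ (ι : K) (a : D.Alg) (m j : ℕ) :
    cf (ih ι a) m (j + 1) = ι • cf a m j := by simp [ih]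

theorem ih_add (ι : K) (a b : D.Alg) : ih ι (a + b) = ih ι a + ih ι b :=
  ext_cf fun m j => by cases j <;> simp

theorem ih_zero (ι : K) : ih ι (0 : D.Alg) = 0 :=
  ext_cf fun m j => by cases j <;> simp

theorem ih_neg (ι : K) (a : D.Alg) : ih ι (-a) = -ih ι a :=
  ext_cf fun m j => by cases j <;> simp

theorem ih_sub (ι : K) (a b : D.Alg) : ih ι (a - b) = ih ι a - ih ι b := by
  rw [sub_eq_add_neg, ih_add, ih_neg, ← sub_eq_add_neg]

theorem ih_smul (ι c : K) (a : D.Alg) : ih ι (c • a) = c • ih ι a :=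
  ext_cf fun m j => by
    cases j with
    | zero => simp
    | succ j => simp only [cf_ih_succ, cf_smul, smul_comm c ι]

theorem ih_mapX (ι : K) {T : X →+ X} (hT : ∀ f, T (ι • f) = ι • T f) (a : D.Alg) :
    mapX T (ih ι a) = ih ι (mapX T a) :=
  ext_cf fun m j => by cases j <;> simp [hT]

variable (D) in
/-- The element `ι ħ`. -/
def hElem (ι : K) : D.Alg := ih ι 1

/-- Since `Δ_k` kills the unit for `k > 0`, multiplication by `ιħ` is multiplication by one element,
on the left here and on the right in `mul_hElem`. Centrality of `ħ` in products then follows from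
associativity. -/
theorem hElem_mul (ι : K) (a : D.Alg) : hElem D ι * a = ih ι a := by
  refine ext_cf fun m j => ?_
  rw [cf_mul, Finset.sum_eq_single (0, m)]
  · cases j with
    | zero => simp [hElem]
    | succ j =>
      rw [Finset.sum_eq_single (0, j + 1), Finset.sum_eq_single (1, j)]
      · simp [hElem, cf_one, D.one_left]
      · rintro ⟨a, b⟩ h1 h2
        match a, h1, h2 with
        | 0, _, _ => simp [hElem]
        | 1, h1, h2 => simp at h1 h2; omega
        | a + 2, _, _ => simp [hElem, cf_one]
      · simp; omega
      · rintro ⟨s, r⟩ h1 h2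
        have hs : s ≠ 0 := by
          rintro rfl; simp at h1 h2; exact h2 h1
        refine Finset.sum_eq_zero fun p _ => ?_
        obtain ⟨a, b⟩ := p
        match a with
        | 0 => simp [hElem]
        | 1 => simp [hElem, cf_one, D.one_left, hs]
        | a + 2 => simp [hElem, cf_one]
      · simp
  · rintro ⟨a, b⟩ h1 h2
    have hs : a ≠ 0 := by
      rintro rfl; simp at h1 h2; exact h2 h1
    refine Finset.sum_eq_zero fun p _ => Finset.sum_eq_zero fun p' _ => ?_
    obtain ⟨c, d⟩ := p'
    cases c <;> simp [hElem, cf_one, hs]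
  · simp

theorem mul_hElem (ι : K) (a : D.Alg) : a * hElem D ι = ih ι a := by
  refine ext_cf fun m j => ?_
  rw [cf_mul, Finset.sum_eq_single (m, 0)]
  · cases j with
    | zero => simp [hElem]
    | succ j =>
      rw [Finset.sum_eq_single (0, j + 1), Finset.sum_eq_single (j, 1)]
      · simp [hElem, cf_one, D.one_right]
      · rintro ⟨b, a⟩ h1 h2
        match a, h1, h2 with
        | 0, _, _ => simp [hElem]
        | 1, h1, h2 => simp at h1 h2; omega
        | a + 2, _, _ => simp [hElem, cf_one]
      · simp
      · rintro ⟨s, r⟩ h1 h2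
        have hs : s ≠ 0 := by
          rintro rfl; simp at h1 h2; exact h2 h1
        refine Finset.sum_eq_zero fun p _ => ?_
        obtain ⟨b, a⟩ := p
        match a with
        | 0 => simp [hElem]
        | 1 => simp [hElem, cf_one, D.one_right, hs]
        | a + 2 => simp [hElem, cf_one]
      · simp
  · rintro ⟨b, a⟩ h1 h2
    have hs : a ≠ 0 := by
      rintro rfl; simp at h1 h2; exact h2 h1
    refine Finset.sum_eq_zero fun p _ => Finset.sum_eq_zero fun p' _ => ?_
    obtain ⟨c, d⟩ := p'
    cases d <;> simp [hElem, cf_one, hs]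
  · simp

theorem ih_mul (ι : K) (a b : D.Alg) : ih ι a * b = ih ι (a * b) := by
  rw [← hElem_mul, ← hElem_mul, mul_assoc]

theorem mul_ih (ι : K) (a b : D.Alg) : a * ih ι b = ih ι (a * b) := by
  rw [← mul_hElem, ← mul_hElem, mul_assoc]

variable {ι : Kˣ}

/-- This is how division by `ħ` is avoided: identities for the bracket are checked after
multiplication by `ιħ`, where they become identities between commutators. -/
theorem ih_injective {a b : D.Alg} (h : ih (ι : K) a = ih (ι : K) b) : a = b := by
  refine ext_cf fun m j => ?_
  have := congrArg (fun x => cf x m (j + 1)) h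
  simp only [cf_ih_succ] at this
  simpa [smul_smul] using congrArg (fun x => ((ι⁻¹ : Kˣ) : K) • x) this

/-- The bracket `{a, b} = (a * b - b * a) / (ι ħ)`. -/
def br (ι : Kˣ) (a b : D.Alg) : D.Alg :=
  ofCf fun m j => ((ι⁻¹ : Kˣ) : K) • cf (a * b - b * a) m (j + 1)

/-- At order `ħ⁰` only the commutative `Δ_0` contributes, so every commutator is divisible by `ħ`.
-/
theorem cf_commutator_zero (a b : D.Alg) (m : ℕ) : cf (a * b - b * a) m 0 = 0 := by
  have h : ∀ x y : D.Alg, cf (x * y) m 0 =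
      ∑ mm ∈ antidiagonal m, D.Δ 0 (cf x mm.1 0) (cf y mm.2 0) := fun x y => by
    rw [cf_mul]
    simp
  rw [cf_sub, h, h, ← Finset.Nat.sum_antidiagonal_swap, sub_eq_zero]
  exact Finset.sum_congr rfl fun p _ => D.comm _ _

theorem ih_br (a b : D.Alg) : ih (ι : K) (br ι a b) = a * b - b * a := by
  refine ext_cf fun m j => ?_
  cases j with
  | zero => rw [cf_ih_zero, cf_commutator_zero]
  | succ j => rw [cf_ih_succ, br, cf_ofCf, smul_smul, Units.mul_inv, one_smul]

theorem br_eq_iff (a b c : D.Alg) : br ι a b = c ↔ a * b - b * a = ih (ι : K) c := by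
  rw [← ih_br (ι := ι)]
  exact ⟨fun h => by rw [h], fun h => ih_injective h⟩

theorem br_add_left (a b c : D.Alg) : br ι (a + b) c = br ι a c + br ι b c := by
  rw [br_eq_iff, ih_add, ih_br, ih_br]; noncomm_ring

theorem br_add_right (a b c : D.Alg) : br ι a (b + c) = br ι a b + br ι a c := by
  rw [br_eq_iff, ih_add, ih_br, ih_br]; noncomm_ring

theorem br_smul_left (r : K) (a b : D.Alg) : br ι (r • a) b = r • br ι a b := by
  rw [br_eq_iff, ih_smul, ih_br, smul_sub, smul_mul_assoc, mul_smul_comm]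

theorem br_smul_right (r : K) (a b : D.Alg) : br ι a (r • b) = r • br ι a b := by
  rw [br_eq_iff, ih_smul, ih_br, smul_sub, smul_mul_assoc, mul_smul_comm]

theorem br_swap (a b : D.Alg) : br ι b a = -br ι a b := by
  rw [br_eq_iff, ih_neg, ih_br]; abel

theorem br_self (a : D.Alg) : br ι a a = 0 := by
  rw [br_eq_iff, ih_zero, sub_self]

theorem br_zero_left (a : D.Alg) : br ι 0 a = 0 := by
  rw [br_eq_iff, ih_zero]; simp

/-- For connections of the form `ιħ a` the bracket is `ιħ` times a plain commutator; this is what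
makes the curvature the usual nonabelian one. -/
theorem br_ih (a b : D.Alg) :
    br ι (ih (ι : K) a) (ih (ι : K) b) = ih (ι : K) (a * b - b * a) := by
  rw [br_eq_iff, ih_mul, mul_ih, ih_mul, mul_ih, ih_sub, ih_sub]

end Deformation

end StarSDYM

namespace StarSDYM

open TopologicalSpace (Opens)

/-! ### The algebra of formal series over an open set -/

section HolFun

variable (n : ℕ) {P : Type*} [TopologicalSpace P] [ChartedSpace (Phase n) P]

/-- Functions holomorphic on `W`, extended by `0`. -/
def HolFun (W : Opens (P × Base)) : AddSubgroup (P × Base → ℂ) where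
  carrier := {F | Hol n F W ∧ ∀ q ∉ W, F q = 0}
  zero_mem' := ⟨mdifferentiableOn_const, fun _ _ => rfl⟩
  add_mem' := fun h₁ h₂ => ⟨h₁.1.add h₂.1, fun q hq => by simp [h₁.2 q hq, h₂.2 q hq]⟩
  neg_mem' := fun h₁ => ⟨h₁.1.neg, fun q hq => by simp [h₁.2 q hq]⟩

/-- Functions of the base point, holomorphic over `W`. -/
def BaseFun (W : Opens (P × Base)) : Subring (Base → ℂ) where
  carrier := {c | Hol n (fun q : P × Base => c q.2) W}
  zero_mem' := mdifferentiableOn_const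
  one_mem' := mdifferentiableOn_const
  add_mem' := fun h₁ h₂ => h₁.add h₂
  neg_mem' := fun h₁ => h₁.neg
  mul_mem' := fun h₁ h₂ => h₁.mul h₂

variable {n} {W : Opens (P × Base)}

instance : Module (BaseFun n W) (HolFun n W) where
  smul c F := ⟨fun q => c.1 q.2 * F.1 q, c.2.mul F.2.1, fun q hq => by simp [F.2.2 q hq]⟩
  one_smul F := Subtype.ext (funext fun q => one_mul _)
  mul_smul c d F := Subtype.ext (funext fun q => mul_assoc _ _ _)
  smul_zero c := Subtype.ext (funext fun q => mul_zero _)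
  smul_add c F H := Subtype.ext (funext fun q => mul_add _ _ _)
  add_smul c d F := Subtype.ext (funext fun q => add_mul _ _ _)
  zero_smul F := Subtype.ext (funext fun q => zero_mul _)

theorem HolFun.smul_apply (c : BaseFun n W) (F : HolFun n W) (q : P × Base) :
    (c • F).1 q = c.1 q.2 * F.1 q := rfl

theorem HolFun.add_apply (F H : HolFun n W) (q : P × Base) : (F + H).1 q = F.1 q + H.1 q := rfl

theorem HolFun.sub_apply (F H : HolFun n W) (q : P × Base) : (F - H).1 q = F.1 q - H.1 q := rfl

theorem HolFun.neg_apply (F : HolFun n W) (q : P × Base) : (-F).1 q = -F.1 q := rfl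

theorem HolFun.zero_apply (q : P × Base) : (0 : HolFun n W).1 q = 0 := rfl

theorem HolFun.sum_apply {κ : Type*} (s : Finset κ) (F : κ → HolFun n W) (q : P × Base) :
    (∑ i ∈ s, F i).1 q = ∑ i ∈ s, (F i).1 q := by
  rw [AddSubgroup.val_finsetSum, Finset.sum_apply]

theorem HolFun.ext_on {F H : HolFun n W} (h : ∀ q ∈ W, F.1 q = H.1 q) : F = H := by
  refine Subtype.ext (funext fun q => ?_)
  by_cases hq : q ∈ W
  · exact h q hq
  · rw [F.2.2 q hq, H.2.2 q hq]

/-- A constant, as a function on the base. -/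
def constB (W : Opens (P × Base)) (c : ℂ) : BaseFun n W := ⟨fun _ => c, mdifferentiableOn_const⟩

/-- The imaginary unit, as a function on the base. -/
def iB (W : Opens (P × Base)) : (BaseFun n W)ˣ where
  val := constB W Complex.I
  inv := constB W Complex.I⁻¹
  val_inv := Subtype.ext (funext fun _ => mul_inv_cancel₀ Complex.I_ne_zero)
  inv_val := Subtype.ext (funext fun _ => inv_mul_cancel₀ Complex.I_ne_zero)

open Classical in
variable (n) in
/-- Restriction to `W` (and `0` if the function is not holomorphic there). -/
def res (W : Opens (P × Base)) (F : P × Base → ℂ) : HolFun n W :=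
  if h : Hol n F W then
    ⟨indicator (W : Set (P × Base)) F, h.congr fun _ hq => indicator_of_mem hq _,
      fun _ hq => indicator_of_notMem hq _⟩
  else 0

theorem res_apply {F : P × Base → ℂ} (h : Hol n F W) {q : P × Base} (hq : q ∈ W) :
    (res n W F).1 q = F q := by
  rw [res, dif_pos h]
  exact indicator_of_mem hq _

theorem eqOn_res {F : P × Base → ℂ} (h : Hol n F W) : EqOn (res n W F).1 F W :=
  fun _ hq => res_apply h hq

theorem bd_congr {F H : P × Base → ℂ} (h : EqOn F H W) (i : Idx) : EqOn (bd i F) (bd i H) W := by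
  intro q hq
  have hc : Continuous fun p : Base => (q.1, p) := by fun_prop
  unfold bd pd
  congr 1
  refine Filter.EventuallyEq.fderiv_eq ?_
  filter_upwards [hc.continuousAt.preimage_mem_nhds (W.isOpen.mem_nhds hq)] with p hp using h hp

variable [IsManifold 𝓘(ℂ, Phase n) ω P]

/-- The partial derivatives along the base. -/
def der (W : Opens (P × Base)) (i : Idx) : HolFun n W →+ HolFun n W where
  toFun F := res n W (bd i F.1)
  map_zero' := HolFun.ext_on fun q hq => by
    rw [res_apply ((0 : HolFun n W).2.1.bd_hol W.isOpen i) hq]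
    simp [bd, pd, HolFun.zero_apply]
  map_add' F H := HolFun.ext_on fun q hq => by
    rw [HolFun.add_apply, res_apply ((F + H).2.1.bd_hol W.isOpen i) hq,
      res_apply (F.2.1.bd_hol W.isOpen i) hq, res_apply (H.2.1.bd_hol W.isOpen i) hq]
    simp only [bd, pd, HolFun.add_apply]
    rw [fderiv_fun_add (F.2.1.differentiableAt_base W.isOpen hq)
      (H.2.1.differentiableAt_base W.isOpen hq)]
    rfl

theorem der_apply (F : HolFun n W) (i : Idx) {q : P × Base} (hq : q ∈ W) :
    (der W i F).1 q = bd i F.1 q := res_apply (F.2.1.bd_hol W.isOpen i) hq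

theorem der_res {F : P × Base → ℂ} (h : Hol n F W) (i : Idx) :
    der W i (res n W F) = res n W (bd i F) := HolFun.ext_on fun q hq => by
  rw [der_apply _ _ hq, res_apply (h.bd_hol W.isOpen i) hq]
  exact bd_congr (eqOn_res h) i hq

theorem der_comm (F : HolFun n W) (i j : Idx) : der W i (der W j F) = der W j (der W i F) :=
  HolFun.ext_on fun q hq => by
    rw [der_apply _ _ hq, der_apply _ _ hq]
    have h1 : EqOn (der W j F).1 (bd j F.1) W := fun q hq => der_apply F j hq
    have h2 : EqOn (der W i F).1 (bd i F.1) W := fun q hq => der_apply F i hq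
    rw [bd_congr h1 i hq, bd_congr h2 j hq, bd_bd_comm W.isOpen F.2.1 i j hq]

/-- The Leibniz rule for multiplication by a function on the base. -/
theorem der_smul (c c' : BaseFun n W) (F : HolFun n W) (i : Idx)
    (hc : ∀ q ∈ W, c'.1 q.2 = pd i c.1 q.2) : der W i (c • F) = c' • F + c • der W i F :=
  HolFun.ext_on fun q hq => by
    rw [der_apply _ _ hq, HolFun.add_apply, HolFun.smul_apply, HolFun.smul_apply, der_apply _ _ hq,
      hc q hq]
    simp only [bd, pd, HolFun.smul_apply]
    rw [fderiv_fun_mul (Hol.differentiableAt_base W.isOpen c.2 hq)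
      (F.2.1.differentiableAt_base W.isOpen hq)]
    simp
    ring

theorem der_const_smul (c : ℂ) (F : HolFun n W) (i : Idx) :
    der W i (constB (n := n) W c • F) = constB (n := n) W c • der W i F := by
  have h := der_smul (constB (n := n) W c) 0 F i fun q _ => by simp [constB, pd]
  rwa [zero_smul, zero_add] at h

variable {Ω : SymplecticForm n P} (S : StarProduct Ω)

open Finset.HasAntidiagonal in
/-- The formal deformation of the algebra of holomorphic functions on `W` defined by a
`*`-product along the phase space. -/
def deform (W : Opens (P × Base)) : Deformation (BaseFun n W) (HolFun n W) where
  Δ k := LinearMap.mk₂ (BaseFun n W) (fun F H => res n W (deltaFam S k F.1 H.1))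
    (fun F₁ F₂ H => HolFun.ext_on fun q hq => by
      rw [HolFun.add_apply, res_apply ((F₁ + F₂).2.1.delta W.isOpen k H.2.1) hq,
        res_apply (F₁.2.1.delta W.isOpen k H.2.1) hq,
        res_apply (F₂.2.1.delta W.isOpen k H.2.1) hq]
      exact deltaFam_add_left W.isOpen k F₁.2.1 F₂.2.1 H.2.1 hq)
    (fun c F H => HolFun.ext_on fun q hq => by
      rw [HolFun.smul_apply, res_apply ((c • F).2.1.delta W.isOpen k H.2.1) hq,
        res_apply (F.2.1.delta W.isOpen k H.2.1) hq]
      exact deltaFam_smul_left W.isOpen k c.2 F.2.1 H.2.1 hq)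
    (fun H F₁ F₂ => HolFun.ext_on fun q hq => by
      rw [HolFun.add_apply, res_apply (H.2.1.delta W.isOpen k (F₁ + F₂).2.1) hq,
        res_apply (H.2.1.delta W.isOpen k F₁.2.1) hq,
        res_apply (H.2.1.delta W.isOpen k F₂.2.1) hq]
      exact deltaFam_add_right W.isOpen k F₁.2.1 F₂.2.1 H.2.1 hq)
    (fun c H F => HolFun.ext_on fun q hq => by
      rw [HolFun.smul_apply, res_apply (H.2.1.delta W.isOpen k (c • F).2.1) hq,
        res_apply (H.2.1.delta W.isOpen k F.2.1) hq]
      exact deltaFam_smul_right W.isOpen k c.2 F.2.1 H.2.1 hq)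
  one := res n W fun _ => 1
  one_left k F := HolFun.ext_on fun q hq => by
    have h1 : Hol n (fun _ : P × Base => (1 : ℂ)) W := mdifferentiableOn_const
    -- The unit of the algebra is the indicator of `W`, not the constant `1` of the axioms; locality
    -- replaces one by the other.
    rw [LinearMap.mk₂_apply, res_apply ((res n W _).2.1.delta W.isOpen k F.2.1) hq,
      deltaFam_congr W.isOpen k (res n W _).2.1 F.2.1 (eqOn_res h1) hq]
    split_ifs with hk
    · subst hk
      exact (S.zeroth _ _ _ (h1.holAt W.isOpen hq) (F.2.1.holAt W.isOpen hq)).trans (one_mul _)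
    · exact S.one_left k hk _ _ (F.2.1.holAt W.isOpen hq)
  one_right k F := HolFun.ext_on fun q hq => by
    have h1 : Hol n (fun _ : P × Base => (1 : ℂ)) W := mdifferentiableOn_const
    rw [LinearMap.mk₂_apply, res_apply (F.2.1.delta W.isOpen k (res n W _).2.1) hq,
      deltaFam_congr_right W.isOpen k (res n W _).2.1 F.2.1 (eqOn_res h1) hq]
    split_ifs with hk
    · subst hk
      exact (S.zeroth _ _ _ (F.2.1.holAt W.isOpen hq) (h1.holAt W.isOpen hq)).trans (mul_one _)
    · exact S.one_right k hk _ _ (F.2.1.holAt W.isOpen hq)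
  comm F H := HolFun.ext_on fun q hq => by
    rw [LinearMap.mk₂_apply, LinearMap.mk₂_apply, res_apply (F.2.1.delta W.isOpen 0 H.2.1) hq,
      res_apply (H.2.1.delta W.isOpen 0 F.2.1) hq]
    have hF := F.2.1.holAt W.isOpen hq
    have hH := H.2.1.holAt W.isOpen hq
    rw [deltaFam, deltaFam, S.zeroth _ _ _ hF hH, S.zeroth _ _ _ hH hF, mul_comm]
  assoc k F H L := HolFun.ext_on fun q hq => by
    simp only [LinearMap.mk₂_apply, HolFun.sum_apply]
    refine Eq.trans (Finset.sum_congr rfl fun ab _ => ?_) ((S.assoc k q.1 _ _ _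
      (F.2.1.holAt W.isOpen hq) (H.2.1.holAt W.isOpen hq) (L.2.1.holAt W.isOpen hq)).trans
      (Finset.sum_congr rfl fun ab _ => ?_))
    · rw [res_apply ((res n W _).2.1.delta W.isOpen _ L.2.1) hq,
        deltaFam_congr W.isOpen _ (res n W _).2.1 L.2.1
          (eqOn_res (F.2.1.delta W.isOpen _ H.2.1)) hq]
      rfl
    · rw [res_apply (F.2.1.delta W.isOpen _ (res n W _).2.1) hq,
        deltaFam_congr_right W.isOpen _ (res n W _).2.1 F.2.1
          (eqOn_res (H.2.1.delta W.isOpen _ L.2.1)) hq]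
      rfl

variable {S}

theorem deform_apply (k : ℕ) (F H : HolFun n W) {q : P × Base} (hq : q ∈ W) :
    ((deform S W).Δ k F H).1 q =
      S.Δ k (fun x => F.1 (x, q.2)) (fun x => H.1 (x, q.2)) q.1 :=
  res_apply (F.2.1.delta W.isOpen k H.2.1) hq

theorem der_deform (i : Idx) (k : ℕ) (F H : HolFun n W) :
    der W i ((deform S W).Δ k F H) =
      (deform S W).Δ k (der W i F) H + (deform S W).Δ k F (der W i H) :=
  HolFun.ext_on fun q hq => by
    have hd : ∀ F : HolFun n W, EqOn (der W i F).1 (bd i F.1) W := fun F q hq => der_apply F i hq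
    have h1 : EqOn ((deform S W).Δ k F H).1 (deltaFam S k F.1 H.1) W :=
      fun q hq => deform_apply k F H hq
    rw [der_apply _ _ hq, bd_congr h1 i hq, bd_deltaFam W.isOpen k F.2.1 H.2.1 i hq,
      HolFun.add_apply, deform_apply _ _ _ hq, deform_apply _ _ _ hq]
    refine congrArg₂ (fun a b : ℂ => a + b) ?_ ?_
    · exact (deltaFam_congr W.isOpen k (der W i F).2.1 H.2.1 (hd F) hq).symm
    · exact (deltaFam_congr_right W.isOpen k (der W i H).2.1 F.2.1 (hd H) hq).symm

theorem deform_one_apply {q : P × Base} (hq : q ∈ W) : (deform S W).one.1 q = 1 :=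
  res_apply mdifferentiableOn_const hq

theorem der_one (i : Idx) : der W i (deform S W).one = 0 := HolFun.ext_on fun q hq => by
  have h1 : EqOn (deform S W).one.1 (fun _ => 1) W := fun q hq => deform_one_apply hq
  rw [der_apply _ _ hq, bd_congr h1 i hq]
  simp [bd, pd, HolFun.zero_apply]

variable (S) in
/-- The algebra of formal series over `W`. -/
abbrev SAlg (W : Opens (P × Base)) : Type _ := (deform S W).Alg

/-- The partial derivatives of formal series. -/
def sder (i : Idx) : SAlg S W →+ SAlg S W := Deformation.mapX (der W i)

theorem cf_sder (i : Idx) (a : SAlg S W) (m j : ℕ) :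
    Deformation.cf (sder i a) m j = der W i (Deformation.cf a m j) := Deformation.cf_mapX _ _ _ _

theorem sder_mul (i : Idx) (a b : SAlg S W) : sder i (a * b) = sder i a * b + a * sder i b :=
  Deformation.mapX_mul (der_deform i) a b

theorem sder_comm (i j : Idx) (a : SAlg S W) : sder i (sder j a) = sder j (sder i a) :=
  Deformation.ext_cf fun m k => by simp [cf_sder, der_comm _ i j]

theorem sder_one (i : Idx) : sder i (1 : SAlg S W) = 0 :=
  Deformation.ext_cf fun m k => by
    rw [cf_sder, Deformation.cf_one, Deformation.cf_zero]
    split_ifs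
    · exact der_one i
    · exact map_zero _

theorem sder_smul (c c' : BaseFun n W) (a : SAlg S W) (i : Idx)
    (hc : ∀ q ∈ W, c'.1 q.2 = pd i c.1 q.2) : sder i (c • a) = c' • a + c • sder i a :=
  Deformation.ext_cf fun m k => by
    simp only [cf_sder, Deformation.cf_add, Deformation.cf_smul, der_smul c c' _ i hc]

theorem smul_eq_smul {c c' : BaseFun n W} (a : SAlg S W) (h : ∀ q ∈ W, c.1 q.2 = c'.1 q.2) :
    c • a = c' • a :=
  Deformation.ext_cf fun m k => HolFun.ext_on fun q hq => by
    simp only [Deformation.cf_smul, HolFun.smul_apply, h q hq]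

/-- Multiplication by `iħ`. -/
abbrev sih (a : SAlg S W) : SAlg S W := Deformation.ih ((iB W : (BaseFun n W)ˣ) : BaseFun n W) a

/-- The bracket `{a, b} = (1/iħ) (a * b - b * a)`. -/
abbrev sbr (a b : SAlg S W) : SAlg S W := Deformation.br (iB W) a b

theorem sder_sih (i : Idx) (a : SAlg S W) : sder i (sih a) = sih (sder i a) :=
  Deformation.ih_mapX _ (fun F => der_const_smul _ F i) a

theorem sder_sbr (i : Idx) (a b : SAlg S W) :
    sder i (sbr a b) = sbr (sder i a) b + sbr a (sder i b) := by
  refine Deformation.ih_injective (ι := iB W) ?_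
  have h := sder_sih i (sbr a b)
  rw [sih, Deformation.ih_br, map_sub, sder_mul, sder_mul] at h
  refine h.symm.trans ?_
  rw [Deformation.ih_add, Deformation.ih_br, Deformation.ih_br]
  abel

end HolFun

end StarSDYM

namespace StarSDYM

open TopologicalSpace (Opens)
open FSeries

/-! ### Formal series as elements of the algebra -/

section Translation

variable {n : ℕ} {P : Type*} [TopologicalSpace P] [ChartedSpace (Phase n) P]
  [IsManifold 𝓘(ℂ, Phase n) ω P] {Ω : SymplecticForm n P} {S : StarProduct Ω}
  {W : Opens (P × Base)} {A B : FSeries P}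

variable (S W) in
/-- The element of the algebra over `W` defined by a formal series. -/
def toAlg (A : FSeries P) : SAlg S W :=
  -- With `τ = t/ħ`, the coefficient of `τ^m ħ^j` is that of `t^m ħ^{j-m}`; the support condition on
  -- `𝒜` is exactly `j ≥ 0`.
  Deformation.ofCf fun m j => res n W (A m ((j : ℤ) - m))

/-- The formal series defined by an element of the algebra over `W`. -/
def ofAlg (a : SAlg S W) : FSeries P := fun m k q =>
  if k + m < 0 then 0 else (Deformation.cf a m (k + m).toNat).1 q

theorem cf_toAlg (hA : IsA n W A) (m j : ℕ) {q : P × Base} (hq : q ∈ W) :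
    (Deformation.cf (toAlg S W A) m j).1 q = A m ((j : ℤ) - m) q := by
  rw [toAlg, Deformation.cf_ofCf, res_apply (hA.holomorphic _ _) hq]

theorem apply_eq_cf (hA : IsA n W A) (m : ℕ) (k : ℤ) (hk : 0 ≤ k + m) {q : P × Base}
    (hq : q ∈ W) : A m k q = (Deformation.cf (toAlg S W A) m (k + m).toNat).1 q := by
  rw [cf_toAlg hA m _ hq, Int.toNat_of_nonneg hk]
  congr 1
  ring

theorem apply_eq_zero (hA : IsA n W A) (m : ℕ) (k : ℤ) (hk : k + m < 0) {q : P × Base}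
    (hq : q ∈ W) : A m k q = 0 := hA.support m k (by omega) q hq

/-- The dictionary used throughout: an equation between series over `W` is an equation in the ring.
-/
theorem toAlg_eq_iff (hA : IsA n W A) (hB : IsA n W B) :
    toAlg S W A = toAlg S W B ↔ EqOver W A B := by
  constructor
  · intro h m k q hq
    rcases lt_or_ge (k + m) 0 with hk | hk
    · rw [apply_eq_zero hA m k hk hq, apply_eq_zero hB m k hk hq]
    · rw [apply_eq_cf (S := S) hA m k hk hq, apply_eq_cf (S := S) hB m k hk hq, h]
  · intro h
    refine Deformation.ext_cf fun m j => HolFun.ext_on fun q hq => ?_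
    rw [cf_toAlg hA m j hq, cf_toAlg hB m j hq]
    exact h _ _ q hq

theorem isA_ofAlg (a : SAlg S W) : IsA n W (ofAlg a) where
  holomorphic m k := by
    unfold ofAlg
    split_ifs
    · exact mdifferentiableOn_const
    · exact (Deformation.cf a m _).2.1
  support m k hk q _ := if_pos (by omega)

@[simp] theorem toAlg_ofAlg (a : SAlg S W) : toAlg S W (ofAlg a) = a := by
  refine Deformation.ext_cf fun m j => HolFun.ext_on fun q hq => ?_
  rw [cf_toAlg (isA_ofAlg a) m j hq, ofAlg, if_neg (by omega)]
  simp

theorem FSeries.EqOver.isA (h : EqOver W A B) (hA : IsA n W A) : IsA n W B where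
  holomorphic m k := (hA.holomorphic m k).congr fun q hq => (h m k q hq).symm
  support m k hk q hq := by rw [← h m k q hq]; exact hA.support m k hk q hq

theorem isA_zero : IsA n W (0 : FSeries P) where
  holomorphic _ _ := mdifferentiableOn_const
  support _ _ _ _ _ := rfl

theorem toAlg_zero : toAlg S W (0 : FSeries P) = 0 :=
  Deformation.ext_cf fun m j => HolFun.ext_on fun q hq => by
    rw [cf_toAlg isA_zero m j hq, Deformation.cf_zero]; rfl

theorem isA_unit : IsA n W (FSeries.unit : FSeries P) where
  holomorphic _ _ := mdifferentiableOn_const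
  support m k hk q _ := if_neg (by omega)

theorem toAlg_unit : toAlg S W (FSeries.unit : FSeries P) = 1 :=
  Deformation.ext_cf fun m j => HolFun.ext_on fun q hq => by
    rw [cf_toAlg isA_unit m j hq, Deformation.cf_one]
    simp only [FSeries.unit]
    by_cases h : m = 0 ∧ j = 0
    · rw [if_pos h, if_pos (by omega), deform_one_apply hq]
    · rw [if_neg h, if_neg (by omega)]; rfl

theorem isA_add (hA : IsA n W A) (hB : IsA n W B) : IsA n W (A + B) where
  holomorphic m k := (hA.holomorphic m k).add (hB.holomorphic m k)
  support m k hk q hq := by simp [hA.support m k hk q hq, hB.support m k hk q hq]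

theorem toAlg_add (hA : IsA n W A) (hB : IsA n W B) :
    toAlg S W (A + B) = toAlg S W A + toAlg S W B :=
  Deformation.ext_cf fun m j => HolFun.ext_on fun q hq => by
    rw [cf_toAlg (isA_add hA hB) m j hq, Deformation.cf_add, HolFun.add_apply, cf_toAlg hA m j hq,
      cf_toAlg hB m j hq]
    rfl

theorem isA_sub (hA : IsA n W A) (hB : IsA n W B) : IsA n W (A - B) where
  holomorphic m k := (hA.holomorphic m k).sub (hB.holomorphic m k)
  support m k hk q hq := by simp [hA.support m k hk q hq, hB.support m k hk q hq]

theorem toAlg_sub (hA : IsA n W A) (hB : IsA n W B) :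
    toAlg S W (A - B) = toAlg S W A - toAlg S W B :=
  Deformation.ext_cf fun m j => HolFun.ext_on fun q hq => by
    rw [cf_toAlg (isA_sub hA hB) m j hq, Deformation.cf_sub, HolFun.sub_apply, cf_toAlg hA m j hq,
      cf_toAlg hB m j hq]
    rfl

/-- Multiplication of a formal series by a function on the base. -/
def bmul (c : Base → ℂ) (A : FSeries P) : FSeries P := fun m k q => c q.2 * A m k q

theorem isA_bmul (c : BaseFun n W) (hA : IsA n W A) : IsA n W (bmul c.1 A) where
  holomorphic m k := c.2.mul (hA.holomorphic m k)
  support m k hk q hq := by simp [bmul, hA.support m k hk q hq]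

theorem toAlg_bmul (c : BaseFun n W) (hA : IsA n W A) :
    toAlg S W (bmul c.1 A) = c • toAlg S W A :=
  Deformation.ext_cf fun m j => HolFun.ext_on fun q hq => by
    rw [cf_toAlg (isA_bmul c hA) m j hq, Deformation.cf_smul, HolFun.smul_apply,
      cf_toAlg hA m j hq]
    rfl

theorem isA_d (hA : IsA n W A) (i : Idx) : IsA n W (A.d i) where
  holomorphic m k := Hol.bd_hol W.isOpen (hA.holomorphic m k) i
  support m k hk q hq := by
    have h : EqOn (A m k) (fun _ => 0) W := fun q hq => hA.support m k hk q hq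
    have h1 := bd_congr h i hq
    simpa [bd, pd, FSeries.d] using h1

theorem toAlg_d (hA : IsA n W A) (i : Idx) : toAlg S W (A.d i) = sder i (toAlg S W A) :=
  Deformation.ext_cf fun m j => by
    rw [cf_sder, toAlg, toAlg, Deformation.cf_ofCf, Deformation.cf_ofCf,
      der_res (hA.holomorphic _ _)]
    rfl

theorem isA_mulIħ (hA : IsA n W A) : IsA n W (mulIħ A) where
  holomorphic m k := mdifferentiableOn_const.mul (hA.holomorphic m (k - 1))
  support m k hk q hq := by simp [mulIħ, hA.support m (k - 1) (by omega) q hq]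

theorem toAlg_mulIħ (hA : IsA n W A) : toAlg S W (mulIħ A) = sih (toAlg S W A) :=
  Deformation.ext_cf fun m j => HolFun.ext_on fun q hq => by
    rw [cf_toAlg (isA_mulIħ hA) m j hq, mulIħ]
    cases j with
    | zero => rw [Deformation.cf_ih_zero, hA.support m _ (by simp) q hq, mul_zero]; rfl
    | succ j =>
      rw [Deformation.cf_ih_succ, HolFun.smul_apply, cf_toAlg hA m j hq]
      change _ = Complex.I * _
      congr 2
      push_cast
      ring

theorem mulIħ_divIħ (A : FSeries P) : mulIħ (divIħ A) = A := by
  funext m k q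
  simp only [mulIħ, divIħ, sub_add_cancel]
  rw [← mul_assoc, mul_inv_cancel₀ Complex.I_ne_zero, one_mul]

theorem divIħ_mulIħ (A : FSeries P) : divIħ (mulIħ A) = A := by
  funext m k q
  simp only [mulIħ, divIħ, add_sub_cancel_right]
  rw [← mul_assoc, inv_mul_cancel₀ Complex.I_ne_zero, one_mul]

theorem star_eq_cf (hA : IsA n W A) (hB : IsA n W B) (m : ℕ) (k : ℤ) {q : P × Base}
    (hq : q ∈ W) : FSeries.star S A B m k q = ofAlg (toAlg S W A * toAlg S W B) m k q := by
  rw [FSeries.star, ofAlg]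
  split_ifs
  · rfl
  rw [Deformation.cf_mul]
  simp only [HolFun.sum_apply]
  refine Finset.sum_congr rfl fun mm _ => Finset.sum_congr rfl fun sr _ =>
    Finset.sum_congr rfl fun jj _ => ?_
  rw [toAlg, toAlg, Deformation.cf_ofCf, Deformation.cf_ofCf, deform_apply _ _ _ hq]
  have h1 := deltaFam_congr (S := S) W.isOpen sr.1 (hA.holomorphic mm.1 ((jj.1 : ℤ) - mm.1))
    (hB.holomorphic mm.2 ((jj.2 : ℤ) - mm.2)) (eqOn_res (hA.holomorphic _ _)).symm hq
  have h2 := deltaFam_congr_right (S := S) W.isOpen sr.1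
    (hB.holomorphic mm.2 ((jj.2 : ℤ) - mm.2)) (res n W (A mm.1 ((jj.1 : ℤ) - mm.1))).2.1
    (eqOn_res (hB.holomorphic _ _)).symm hq
  exact h1.trans h2

theorem isA_star (hA : IsA n W A) (hB : IsA n W B) : IsA n W (FSeries.star S A B) :=
  FSeries.EqOver.isA (A := ofAlg (toAlg S W A * toAlg S W B))
    (fun m k _ hq => (star_eq_cf hA hB m k hq).symm) (isA_ofAlg _)

theorem toAlg_star (hA : IsA n W A) (hB : IsA n W B) :
    toAlg S W (FSeries.star S A B) = toAlg S W A * toAlg S W B := by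
  rw [← toAlg_ofAlg (toAlg S W A * toAlg S W B), toAlg_eq_iff (isA_star hA hB) (isA_ofAlg _)]
  exact fun m k _ hq => star_eq_cf hA hB m k hq

theorem isA_bracket (hA : IsA n W A) (hB : IsA n W B) : IsA n W (bracket S A B) where
  holomorphic m k := mdifferentiableOn_const.mul
    ((isA_sub (isA_star hA hB) (isA_star hB hA)).holomorphic m (k + 1))
  support m k hk q hq := by
    have h := isA_sub (isA_star (S := S) hA hB) (isA_star (S := S) hB hA)
    rcases lt_or_ge (k + 1 + m) 0 with hk' | hk'
    · simp only [bracket, divIħ, h.support m (k + 1) (by omega) q hq, mul_zero]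
    -- Dividing by `ħ` lowers the support bound by one. The only order at risk is `k = -m - 1`,
    -- which is the `ħ⁰` term of the commutator and vanishes.
    · have h0 : (k + 1 + m).toNat = 0 := by omega
      have h1 := apply_eq_cf (S := S) h m (k + 1) hk' hq
      rw [toAlg_sub (isA_star hA hB) (isA_star hB hA), toAlg_star hA hB, toAlg_star hB hA, h0,
        Deformation.cf_commutator_zero] at h1
      simp only [bracket, divIħ, h1]
      exact mul_zero _

theorem toAlg_bracket (hA : IsA n W A) (hB : IsA n W B) :
    toAlg S W (bracket S A B) = sbr (toAlg S W A) (toAlg S W B) := by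
  symm
  rw [Deformation.br_eq_iff]
  change _ = sih _
  rw [← toAlg_mulIħ (isA_bracket hA hB), bracket, mulIħ_divIħ,
    toAlg_sub (isA_star hA hB) (isA_star hB hA), toAlg_star hA hB, toAlg_star hB hA]

/-! #### Series with prescribed free element -/

/-- The elements without free term. -/
def IsQAlg (a : SAlg S W) : Prop := ∀ j, Deformation.cf a 0 j = 0

theorem isQAlg_toAlg (hA : IsQ n W A) : IsQAlg (toAlg S W A) := fun j =>
  HolFun.ext_on fun q hq => by rw [cf_toAlg hA.toIsA 0 j hq, hA.free _ q hq]; rfl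

theorem isQ_ofAlg {a : SAlg S W} (ha : IsQAlg a) : IsQ n W (ofAlg a) where
  toIsA := isA_ofAlg a
  free k q _ := by
    rw [ofAlg]
    split_ifs
    · rfl
    · rw [ha]; rfl

theorem isQ_of_toAlg (hA : IsA n W A) (h : IsQAlg (toAlg S W A)) : IsQ n W A where
  toIsA := hA
  free k q hq := by
    rcases lt_or_ge (k + (0 : ℕ)) 0 with hk | hk
    · exact apply_eq_zero hA 0 k hk hq
    · rw [apply_eq_cf (S := S) hA 0 k hk hq, h]; rfl

theorem isQAlg_mul_left {a : SAlg S W} (ha : IsQAlg a) (b : SAlg S W) : IsQAlg (b * a) :=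
  fun j => by
    rw [Deformation.cf_mul]
    simp [ha _]

theorem isQAlg_sder {a : SAlg S W} (ha : IsQAlg a) (i : Idx) : IsQAlg (sder i a) :=
  fun j => by rw [cf_sder, ha, map_zero]

theorem isQAlg_add {a b : SAlg S W} (ha : IsQAlg a) (hb : IsQAlg b) : IsQAlg (a + b) :=
  fun j => by rw [Deformation.cf_add, ha, hb, add_zero]

theorem isQAlg_sub {a b : SAlg S W} (ha : IsQAlg a) (hb : IsQAlg b) : IsQAlg (a - b) :=
  fun j => by rw [Deformation.cf_sub, ha, hb, sub_zero]

theorem isQAlg_smul {a : SAlg S W} (c : BaseFun n W) (ha : IsQAlg a) : IsQAlg (c • a) :=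
  fun j => by rw [Deformation.cf_smul, ha, smul_zero]

theorem isExpQ_iff_sub_one : IsExpQ n W A ↔ IsA n W A ∧ IsQAlg (toAlg S W A - 1) := by
  constructor
  · intro h
    refine ⟨h.toIsA, fun j => HolFun.ext_on fun q hq => ?_⟩
    rw [Deformation.cf_sub, HolFun.sub_apply, cf_toAlg h.toIsA 0 j hq, h.free _ q hq,
      Deformation.cf_one]
    by_cases hj : j = 0
    · rw [if_pos (by omega), if_pos (by omega), deform_one_apply hq]
      simp [HolFun.zero_apply]
    · rw [if_neg (by omega), if_neg (by omega)]
      simp [HolFun.zero_apply]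
  · rintro ⟨hA, h⟩
    refine ⟨hA, fun k q hq => ?_⟩
    rcases lt_or_ge (k + (0 : ℕ)) 0 with hk | hk
    · rw [apply_eq_zero hA 0 k hk hq, if_neg (by omega)]
    · rw [apply_eq_cf (S := S) hA 0 k hk hq]
      have h2 := h (k + (0 : ℕ)).toNat
      rw [Deformation.cf_sub, sub_eq_zero, Deformation.cf_one] at h2
      rw [h2]
      by_cases hk0 : k = 0
      · rw [if_pos (by omega), if_pos hk0, deform_one_apply hq]
      · rw [if_neg (by omega), if_neg hk0]; rfl

theorem isExpQ_ofAlg {a : SAlg S W} (ha : IsQAlg (a - 1)) : IsExpQ n W (ofAlg a) :=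
  (isExpQ_iff_sub_one (S := S)).2 ⟨isA_ofAlg a, by rwa [toAlg_ofAlg]⟩

/-- An element without free term is divisible by `τ`, so its `l`-th power is divisible by `τ^l`, and
the geometric series is a finite sum in each degree. -/
theorem cf_pow_eq_zero {a : SAlg S W} (ha : IsQAlg a) (l m : ℕ) (hm : m < l) (j : ℕ) :
    Deformation.cf (a ^ l) m j = 0 := by
  induction l generalizing m j with
  | zero => omega
  | succ l ih =>
    rw [pow_succ', Deformation.cf_mul]
    refine Finset.sum_eq_zero fun mm hmm => Finset.sum_eq_zero fun sr _ =>
      Finset.sum_eq_zero fun jj _ => ?_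
    rw [Finset.HasAntidiagonal.mem_antidiagonal] at hmm
    rcases Nat.eq_zero_or_pos mm.1 with h0 | h0
    · rw [h0, ha]; simp
    · rw [ih mm.2 (by omega)]; simp

theorem cf_mul_congr_left {a a' : SAlg S W} (b : SAlg S W) {m : ℕ}
    (h : ∀ m' ≤ m, ∀ j, Deformation.cf a m' j = Deformation.cf a' m' j) (j : ℕ) :
    Deformation.cf (a * b) m j = Deformation.cf (a' * b) m j := by
  rw [Deformation.cf_mul, Deformation.cf_mul]
  refine Finset.sum_congr rfl fun mm hmm => Finset.sum_congr rfl fun sr _ =>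
      Finset.sum_congr rfl fun jj _ => ?_
  rw [Finset.HasAntidiagonal.mem_antidiagonal] at hmm
  rw [h _ (by omega)]

theorem cf_mul_congr_right {a a' : SAlg S W} (b : SAlg S W) {m : ℕ}
    (h : ∀ m' ≤ m, ∀ j, Deformation.cf a m' j = Deformation.cf a' m' j) (j : ℕ) :
    Deformation.cf (b * a) m j = Deformation.cf (b * a') m j := by
  rw [Deformation.cf_mul, Deformation.cf_mul]
  refine Finset.sum_congr rfl fun mm hmm => Finset.sum_congr rfl fun sr _ =>
      Finset.sum_congr rfl fun jj _ => ?_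
  rw [Finset.HasAntidiagonal.mem_antidiagonal] at hmm
  rw [h _ (by omega)]

/-- The geometric series `∑_l (-1)^l u^l` of an element without free term. -/
def geom (u : SAlg S W) : SAlg S W :=
  Deformation.ofCf fun m j => Deformation.cf (∑ l ∈ Finset.range (m + 1), (-u) ^ l) m j

theorem cf_geom {u : SAlg S W} (hu : IsQAlg u) {m N : ℕ} (h : m < N) (j : ℕ) :
    Deformation.cf (geom u) m j = Deformation.cf (∑ l ∈ Finset.range N, (-u) ^ l) m j := by
  have hu' : IsQAlg (-u) := fun j => by rw [Deformation.cf_neg, hu, neg_zero]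
  rw [geom, Deformation.cf_ofCf, Deformation.cf_sum, Deformation.cf_sum]
  refine Finset.sum_subset (Finset.range_mono (by omega)) fun l _ hl => ?_
  exact cf_pow_eq_zero hu' l m (by simpa using hl) j

theorem geom_mul {u : SAlg S W} (hu : IsQAlg u) : geom u * (1 + u) = 1 :=
  Deformation.ext_cf fun m j => by
    have hu' : IsQAlg (-u) := fun j => by rw [Deformation.cf_neg, hu, neg_zero]
    rw [cf_mul_congr_left (a' := ∑ l ∈ Finset.range (m + 1), (-u) ^ l) (1 + u)
      fun m' hm' j => cf_geom hu (by omega) j]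
    have h : (∑ l ∈ Finset.range (m + 1), (-u) ^ l) * (1 + u) = 1 - (-u) ^ (m + 1) := by
      have := geom_sum_mul_neg (-u) (m + 1)
      rwa [sub_neg_eq_add] at this
    rw [h, Deformation.cf_sub, cf_pow_eq_zero hu' _ _ (Nat.lt_succ_self m), sub_zero]

theorem mul_geom {u : SAlg S W} (hu : IsQAlg u) : (1 + u) * geom u = 1 :=
  Deformation.ext_cf fun m j => by
    have hu' : IsQAlg (-u) := fun j => by rw [Deformation.cf_neg, hu, neg_zero]
    rw [cf_mul_congr_right (a' := ∑ l ∈ Finset.range (m + 1), (-u) ^ l) (1 + u)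
      fun m' hm' j => cf_geom hu (by omega) j]
    have h : (1 + u) * (∑ l ∈ Finset.range (m + 1), (-u) ^ l) = 1 - (-u) ^ (m + 1) := by
      have := mul_neg_geom_sum (-u) (m + 1)
      rwa [sub_neg_eq_add] at this
    rw [h, Deformation.cf_sub, cf_pow_eq_zero hu' _ _ (Nat.lt_succ_self m), sub_zero]

theorem isA_starPow (hA : IsA n W A) (l : ℕ) : IsA n W (starPow S A l) := by
  induction l with
  | zero => exact isA_unit
  | succ l ih => exact isA_star hA ih

theorem toAlg_starPow (hA : IsA n W A) (l : ℕ) :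
    toAlg S W (starPow S A l) = toAlg S W A ^ l := by
  induction l with
  | zero => rw [pow_zero]; exact toAlg_unit
  | succ l ih => rw [pow_succ', ← ih]; exact toAlg_star hA (isA_starPow hA l)

theorem starInv_eq (hA : IsExpQ n W A) (m : ℕ) (k : ℤ) {q : P × Base} (hq : q ∈ W) :
    starInv S A m k q = ofAlg (geom (toAlg S W A - 1)) m k q := by
  have hu : IsA n W (A - FSeries.unit) := isA_sub hA.toIsA isA_unit
  rw [starInv, ofAlg]
  split_ifs with hk
  · refine Finset.sum_eq_zero fun l _ => ?_
    rw [apply_eq_zero (isA_starPow hu l) m k hk hq, mul_zero]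
  · rw [geom, Deformation.cf_ofCf, Deformation.cf_sum, HolFun.sum_apply]
    refine Finset.sum_congr rfl fun l _ => ?_
    rw [apply_eq_cf (S := S) (isA_starPow hu l) m k (by omega) hq, toAlg_starPow hu,
      toAlg_sub hA.toIsA isA_unit, toAlg_unit]
    rcases Nat.even_or_odd l with hl | hl
    · rw [hl.neg_one_pow, hl.neg_pow, one_mul]
    · rw [hl.neg_one_pow, hl.neg_pow, Deformation.cf_neg, HolFun.neg_apply]; ring

theorem isA_starInv (hA : IsExpQ n W A) : IsA n W (starInv S A) :=
  FSeries.EqOver.isA (A := ofAlg (geom (toAlg S W A - 1)))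
    (fun m k _ hq => (starInv_eq hA m k hq).symm) (isA_ofAlg _)

theorem toAlg_starInv (hA : IsExpQ n W A) :
    toAlg S W (starInv S A) = geom (toAlg S W A - 1) := by
  rw [← toAlg_ofAlg (geom (toAlg S W A - 1)), toAlg_eq_iff (isA_starInv hA) (isA_ofAlg _)]
  exact fun m k _ hq => starInv_eq hA m k hq

theorem toAlg_starInv_mul (hA : IsExpQ n W A) :
    toAlg S W (starInv S A) * toAlg S W A = 1 := by
  rw [toAlg_starInv hA]
  simpa using geom_mul ((isExpQ_iff_sub_one (S := S)).1 hA).2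

theorem toAlg_mul_starInv (hA : IsExpQ n W A) :
    toAlg S W A * toAlg S W (starInv S A) = 1 := by
  rw [toAlg_starInv hA]
  simpa using mul_geom ((isExpQ_iff_sub_one (S := S)).1 hA).2

end Translation

end StarSDYM

namespace StarSDYM

open TopologicalSpace (Opens)
open FSeries

/-! ### The Poincaré lemma with parameters -/

/-- A pair of coordinate directions, and a retraction along these directions. -/
structure Retraction (V : Set Base) where
  dir : Fin 2 → Idx
  coord : Fin 2 → Base →L[ℂ] ℂ
  center : Base
  proj : Base →L[ℂ] Base
  proj_eq : ∀ v, proj v = ∑ α, coord α v • dirVec (dir α)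
  coord_dir : ∀ α β, coord α (dirVec (dir β)) = if α = β then 1 else 0
  -- At `s = 1` this is `p`. At `s = 0` the two chosen coordinates have been moved to those of the
  -- centre and the other two are unchanged.
  segment : ∀ p ∈ V, ∀ s ∈ Icc (0 : ℝ) 1, p + ((s : ℂ) - 1) • proj (p - center) ∈ V

namespace Retraction

variable {V : Set Base} (ρ : Retraction V)

theorem proj_dir (β : Fin 2) : ρ.proj (dirVec (ρ.dir β)) = dirVec (ρ.dir β) := by
  rw [ρ.proj_eq]
  simp [ρ.coord_dir]

variable {n : ℕ} {P : Type*} [TopologicalSpace P] [ChartedSpace (Phase n) P]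
  [IsManifold 𝓘(ℂ, Phase n) ω P] {W : Opens (P × Base)}

/-- The path from the retracted point to a given point. -/
def path (s : ℝ) (z : Phase n × Base) : Phase n × Base :=
  (z.1, z.2 + ((s : ℂ) - 1) • ρ.proj (z.2 - ρ.center))

/-- The derivative of `path`. -/
def pathDeriv (s : ℝ) : Phase n × Base →L[ℂ] Phase n × Base :=
  ContinuousLinearMap.id ℂ _ + ((s : ℂ) - 1) •
    (ContinuousLinearMap.inr ℂ (Phase n) Base).comp (ρ.proj.comp (ContinuousLinearMap.snd ℂ _ _))

theorem hasFDerivAt_path (s : ℝ) (z : Phase n × Base) :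
    HasFDerivAt (ρ.path s) (ρ.pathDeriv s) z := by
  have h1 : ρ.path (n := n) s = fun z => ρ.pathDeriv s z - ((s : ℂ) - 1) •
      ((0 : Phase n), ρ.proj ρ.center) := by
    funext z
    refine Prod.ext ?_ ?_
    · simp [path, pathDeriv]
    · simp only [path, pathDeriv, map_sub]
      simp [smul_sub, add_sub_assoc]
  rw [h1]
  exact (ρ.pathDeriv s).hasFDerivAt.sub_const _

theorem hasDerivAt_path (s : ℝ) (z : Phase n × Base) :
    HasDerivAt (fun s => ρ.path s z) (0, ρ.proj (z.2 - ρ.center)) s := by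
  have h1 : HasDerivAt (fun s : ℝ => ((s : ℂ) - 1)) 1 s :=
    (Complex.ofRealCLM.hasDerivAt (x := s)).sub_const 1
  have h2 := (h1.smul_const (ρ.proj (z.2 - ρ.center))).const_add z.2
  rw [one_smul] at h2
  exact (hasDerivAt_const s z.1).prodMk h2

theorem continuous_path : Continuous fun w : (Phase n × Base) × ℝ => ρ.path w.2 w.1 := by
  unfold path
  fun_prop

theorem continuous_pathDeriv : Continuous fun s : ℝ => ρ.pathDeriv (n := n) s := by
  unfold pathDeriv
  fun_prop

theorem path_one (z : Phase n × Base) : ρ.path 1 z = z := by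
  simp [path]

theorem path_mem (hW : ∀ q : P × Base, q ∈ W ↔ q.2 ∈ V)
    {φ : OpenPartialHomeomorph P (Phase n)} {z : Phase n × Base} (hz : z ∈ hatDom φ W) {s : ℝ}
    (hs : s ∈ Icc (0 : ℝ) 1) : ρ.path s z ∈ hatDom φ W :=
  ⟨hz.1, (hW _).2 (ρ.segment _ ((hW _).1 hz.2) s hs)⟩

/-- The integrand of the primitive of the 1-form with components `r`. -/
def integrand (r : Fin 2 → Phase n × Base → ℂ) (z : Phase n × Base) (s : ℝ) : ℂ :=
  ∑ α, ρ.coord α (z.2 - ρ.center) * r α (ρ.path s z)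

/-- The derivative of `integrand`. -/
def integrandDeriv (r : Fin 2 → Phase n × Base → ℂ) (z : Phase n × Base) (s : ℝ) :
    Phase n × Base →L[ℂ] ℂ :=
  ∑ α, (ρ.coord α (z.2 - ρ.center) • (fderiv ℂ (r α) (ρ.path s z)).comp (ρ.pathDeriv s) +
    r α (ρ.path s z) • (ρ.coord α).comp (ContinuousLinearMap.snd ℂ _ _))

section

variable {O : Set (Phase n × Base)} (hO : IsOpen O) {r : Fin 2 → Phase n × Base → ℂ}
  (hr : ∀ α, DifferentiableOn ℂ (r α) O)
  (hpath : ∀ z ∈ O, ∀ s ∈ Icc (0 : ℝ) 1, ρ.path s z ∈ O)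

include hO hr hpath

theorem hasFDerivAt_integrand {z : Phase n × Base} (hz : z ∈ O) {s : ℝ}
    (hs : s ∈ Icc (0 : ℝ) 1) :
    HasFDerivAt (fun z => ρ.integrand r z s) (ρ.integrandDeriv r z s) z := by
  refine HasFDerivAt.fun_sum fun α _ => ?_
  have h1 : HasFDerivAt (fun z : Phase n × Base => ρ.coord α (z.2 - ρ.center))
      ((ρ.coord α).comp (ContinuousLinearMap.snd ℂ _ _)) z :=
    (ρ.coord α).hasFDerivAt.comp z (hasFDerivAt_snd.sub_const _)
  have h2 : HasFDerivAt (fun z => r α (ρ.path s z)) _ z :=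
    (((hr α).differentiableAt (hO.mem_nhds (hpath z hz s hs))).hasFDerivAt).comp z
      (ρ.hasFDerivAt_path s z)
  exact h1.mul h2

theorem continuousOn_integrandDeriv :
    ContinuousOn (Function.uncurry (ρ.integrandDeriv r)) (O ×ˢ Icc 0 1) := by
  unfold Function.uncurry integrandDeriv
  have hp := (ρ.continuous_path (n := n)).continuousOn (s := O ×ˢ Icc 0 1)
  have hm : MapsTo (fun w : (Phase n × Base) × ℝ => ρ.path w.2 w.1) (O ×ˢ Icc 0 1) O :=
    fun w hw => hpath _ hw.1 _ hw.2
  refine continuousOn_finsetSum _ fun α _ => ContinuousOn.add ?_ ?_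
  · refine ContinuousOn.smul (f := fun w : (Phase n × Base) × ℝ =>
      ρ.coord α (w.1.2 - ρ.center)) (Continuous.continuousOn (by fun_prop)) ?_
    refine ContinuousOn.clm_comp ?_ (ρ.continuous_pathDeriv.comp continuous_snd).continuousOn
    exact (continuousOn_fderiv_of_differentiableOn hO (hr α)).comp hp hm
  · exact ((hr α).continuousOn.comp hp hm).smul continuousOn_const

theorem hasFDerivAt_primitive {z : Phase n × Base} (hz : z ∈ O) :
    HasFDerivAt (fun z => ∫ s in (0 : ℝ)..1, ρ.integrand r z s)
      (∫ s in (0 : ℝ)..1, ρ.integrandDeriv r z s) z := by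
  refine hasFDerivAt_intervalIntegral hO zero_le_one ?_
    (ρ.continuousOn_integrandDeriv hO hr hpath)
    (fun z hz s hs => ρ.hasFDerivAt_integrand hO hr hpath hz hs) hz
  intro z hz
  unfold integrand
  refine continuousOn_finsetSum _ fun α _ => continuousOn_const.mul ?_
  refine (hr α).continuousOn.comp ?_ fun s hs => hpath z hz s hs
  exact ((ρ.continuous_path (n := n)).comp (by fun_prop : Continuous fun s : ℝ => (z, s))).continuousOn

/-- Closedness turns the `β`-derivative of the integrand into `d/ds (s · r_β(path s))`; integrating
from `0` to `1` leaves `r_β` at the end point. -/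
theorem integral_integrandDeriv
    (hclosed : ∀ z ∈ O, ∀ α β, fderiv ℂ (r α) z (0, dirVec (ρ.dir β)) =
      fderiv ℂ (r β) z (0, dirVec (ρ.dir α))) {z : Phase n × Base} (hz : z ∈ O) (β : Fin 2) :
    (∫ s in (0 : ℝ)..1, ρ.integrandDeriv r z s) (0, dirVec (ρ.dir β)) = r β z := by
  have hc : ContinuousOn (ρ.integrandDeriv r z) (Icc 0 1) :=
    (ρ.continuousOn_integrandDeriv hO hr hpath).comp (f := fun s => (z, s)) (by fun_prop)
      fun s hs => ⟨hz, hs⟩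
  have hint : IntervalIntegrable (ρ.integrandDeriv r z) MeasureTheory.volume 0 1 :=
    hc.intervalIntegrable_of_Icc zero_le_one
  rw [ContinuousLinearMap.intervalIntegral_apply hint]
  have key : ∀ s ∈ Icc (0 : ℝ) 1, HasDerivAt (fun s : ℝ => (s : ℂ) * r β (ρ.path s z))
      (ρ.integrandDeriv r z s (0, dirVec (ρ.dir β))) s := by
    intro s hs
    have hm := hpath z hz s hs
    have h1 : HasDerivAt (fun s : ℝ => (s : ℂ)) 1 s := Complex.ofRealCLM.hasDerivAt (x := s)
    have h2 : HasDerivAt (fun s : ℝ => r β (ρ.path s z)) _ s :=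
      ((((hr β).differentiableAt (hO.mem_nhds hm)).hasFDerivAt).restrictScalars ℝ).comp_hasDerivAt
        s (ρ.hasDerivAt_path s z)
    refine (h1.mul h2).congr_deriv ?_
    have h3 : ρ.pathDeriv (n := n) s (0, dirVec (ρ.dir β)) = (s : ℂ) • (0, dirVec (ρ.dir β)) := by
      simp [pathDeriv, ρ.proj_dir, sub_smul]
    have h4 : ((0 : Phase n), ρ.proj (z.2 - ρ.center)) =
        ∑ α, ρ.coord α (z.2 - ρ.center) • ((0 : Phase n), dirVec (ρ.dir α)) := by
      rw [ρ.proj_eq]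
      simp
    rw [h4]
    simp only [integrandDeriv, ContinuousLinearMap.coe_restrictScalars', map_sum, map_smul,
      sum_apply, add_apply, smul_apply,
      ContinuousLinearMap.comp_apply, h3, ContinuousLinearMap.coe_snd', ρ.coord_dir, smul_eq_mul,
      hclosed _ hm _ β]
    rw [Finset.sum_add_distrib, Finset.mul_sum]
    simp only [mul_ite, mul_one, mul_zero, Finset.sum_ite_eq', Finset.mem_univ, if_true, one_mul]
    rw [add_comm]
    congr 1
    exact Finset.sum_congr rfl fun α _ => by ring
  have h5 := intervalIntegral.integral_eq_sub_of_hasDerivAt (a := 0) (b := 1)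
    (fun s hs => key s (by rwa [uIcc_of_le zero_le_one] at hs))
    ((hc.clm_apply continuousOn_const).intervalIntegrable_of_Icc zero_le_one)
  rw [h5]
  simp [ρ.path_one]

end

/-- The line integral moves only the base point, so it is defined on all of `W` without charts and
needs no gluing; charts enter only in checking holomorphy and the derivatives. -/
theorem exists_primitive (hW : ∀ q : P × Base, q ∈ W ↔ q.2 ∈ V) (r : Fin 2 → HolFun n W)
    (hclosed : ∀ α β, der W (ρ.dir β) (r α) = der W (ρ.dir α) (r β)) :
    ∃ f : HolFun n W, ∀ β, der W (ρ.dir β) f = r β := by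
  let f : P × Base → ℂ := fun q => ∫ s in (0 : ℝ)..1, ∑ α, ρ.coord α (q.2 - ρ.center) *
    (r α).1 (q.1, q.2 + ((s : ℂ) - 1) • ρ.proj (q.2 - ρ.center))
  have hhat : ∀ φ : OpenPartialHomeomorph P (Phase n),
      hat φ f = fun z => ∫ s in (0 : ℝ)..1, ρ.integrand (fun α => hat φ (r α).1) z s :=
    fun φ => rfl
  have hd : ∀ φ ∈ IsManifold.maximalAtlas 𝓘(ℂ, Phase n) ω P, ∀ z ∈ hatDom φ W,
      HasFDerivAt (hat φ f) (∫ s in (0 : ℝ)..1,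
        ρ.integrandDeriv (fun α => hat φ (r α).1) z s) z := by
    intro φ hφ z hz
    rw [hhat]
    exact ρ.hasFDerivAt_primitive (isOpen_hatDom φ W.isOpen)
      (fun α => (r α).2.1.differentiableOn_hat hφ W.isOpen)
      (fun z hz s hs => ρ.path_mem hW hz hs) hz
  have hf : Hol n f W := hol_of_hat fun q hq => ⟨chartAt _ q.1, chartAt_mem _,
    mem_chart_source _ _, (hd _ (chartAt_mem _) _
      (mem_hatDom (mem_chart_source (Phase n) q.1) hq)).differentiableAt⟩
  refine ⟨res n W f, fun β => ?_⟩
  rw [der_res hf]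
  refine HolFun.ext_on fun q hq => ?_
  rw [res_apply (hf.bd_hol W.isOpen _) hq]
  refine eqOn_of_hat (n := n) (W := W) (fun φ hφ z hz => ?_) hq
  rw [bd_eq_hat hφ W.isOpen hf hz, (hd φ hφ z hz).fderiv]
  refine ρ.integral_integrandDeriv (isOpen_hatDom φ W.isOpen)
      (fun α => (r α).2.1.differentiableOn_hat hφ W.isOpen)
      (fun z hz s hs => ρ.path_mem hW hz hs) (fun y hy α β => ?_) hz β
  have h1 := bd_eq_hat hφ W.isOpen (r α).2.1 hy (ρ.dir β)
  have h2 := bd_eq_hat hφ W.isOpen (r β).2.1 hy (ρ.dir α)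
  rw [← h1, ← h2]
  change bd _ (r α).1 (φ.symm y.1, y.2) = bd _ (r β).1 (φ.symm y.1, y.2)
  rw [← der_apply _ _ hy.2, ← der_apply _ _ hy.2, hclosed α β]

/-! #### Flat connections -/

variable {Ω : SymplecticForm n P} {S : StarProduct Ω}

/-- A single choice of primitives, normalised so that `0` has primitive `0`. Applied to each
coefficient it keeps vanishing coefficients zero, so `𝒬` is preserved. -/
theorem exists_primitive_zero (hW : ∀ q : P × Base, q ∈ W ↔ q.2 ∈ V) :
    ∃ T : (Fin 2 → HolFun n W) → HolFun n W, T 0 = 0 ∧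
      ∀ r, (∀ α β, der W (ρ.dir β) (r α) = der W (ρ.dir α) (r β)) →
        ∀ β, der W (ρ.dir β) (T r) = r β := by
  classical
  choose T hT using fun (r : Fin 2 → HolFun n W)
    (h : ∀ α β, der W (ρ.dir β) (r α) = der W (ρ.dir α) (r β)) => ρ.exists_primitive hW r h
  refine ⟨fun r => if r = 0 then 0 else
    if h : ∀ α β, der W (ρ.dir β) (r α) = der W (ρ.dir α) (r β) then T r h else 0, by simp, ?_⟩
  intro r h β
  dsimp only
  split_ifs with h0
  · simp [h0]
  · exact hT r h β

/-- A closed 1-form along a retraction has a primitive in the algebra of formal series. -/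
theorem exists_primitive_alg (hW : ∀ q : P × Base, q ∈ W ↔ q.2 ∈ V) (r : Fin 2 → SAlg S W)
    (hclosed : ∀ α β, sder (ρ.dir β) (r α) = sder (ρ.dir α) (r β)) :
    ∃ f : SAlg S W, (∀ β, sder (ρ.dir β) f = r β) ∧ ((∀ α, IsQAlg (r α)) → IsQAlg f) := by
  obtain ⟨T, hT0, hT⟩ := ρ.exists_primitive_zero hW (n := n)
  refine ⟨Deformation.ofCf fun m j => T fun α => Deformation.cf (r α) m j, fun β => ?_,
    fun hr j => ?_⟩
  · refine Deformation.ext_cf fun m j => ?_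
    rw [cf_sder, Deformation.cf_ofCf, hT]
    intro α β
    rw [← cf_sder, ← cf_sder, hclosed]
  · rw [Deformation.cf_ofCf, ← hT0]
    congr 1
    funext α
    exact hr α j

open Finset.HasAntidiagonal in
/-- A flat connection along a retraction is a pure gauge. -/
theorem exists_gauge (hW : ∀ q : P × Base, q ∈ W ↔ q.2 ∈ V) (a : Fin 2 → SAlg S W)
    (ha : ∀ α, IsQAlg (a α))
    (hflat : ∀ α β, sder (ρ.dir β) (a α) - sder (ρ.dir α) (a β) + (a β * a α - a α * a β) = 0) :
    ∃ c : SAlg S W, IsQAlg (c - 1) ∧ ∀ α, sder (ρ.dir α) c = c * a α := by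
  obtain ⟨T, hT0, hT⟩ := ρ.exists_primitive_zero hW (n := n)
  -- Picard iteration for `∂c = c * a`, written as the fixed point equation `c = 1 + T(c * a)`. As
  -- `a` has no `τ⁰` term, the coefficients of `step c` at `τ^m` depend only on those of `c` below
  -- `m`.
  let step : SAlg S W → SAlg S W := fun c =>
    1 + Deformation.ofCf fun m j => T fun α => Deformation.cf (c * a α) m j
  have hmul : ∀ (x y : SAlg S W) α m, (∀ m' < m, ∀ j, Deformation.cf x m' j = Deformation.cf y m' j) →
      ∀ j, Deformation.cf (x * a α) m j = Deformation.cf (y * a α) m j := by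
    intro x y α m h j
    rw [Deformation.cf_mul, Deformation.cf_mul]
    refine Finset.sum_congr rfl fun mm hmm => Finset.sum_congr rfl fun sr _ =>
      Finset.sum_congr rfl fun jj _ => ?_
    rw [Finset.HasAntidiagonal.mem_antidiagonal] at hmm
    rcases Nat.eq_zero_or_pos mm.2 with h0 | h0
    · rw [h0, ha]; simp
    · rw [h mm.1 (by omega)]
  have hstep : ∀ (x y : SAlg S W) m, (∀ m' < m, ∀ j, Deformation.cf x m' j = Deformation.cf y m' j) →
      ∀ j, Deformation.cf (step x) m j = Deformation.cf (step y) m j := by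
    intro x y m h j
    simp only [step, Deformation.cf_add, Deformation.cf_ofCf]
    congr 2
    funext α
    exact hmul x y α m h j
  have hiter : ∀ N, ∀ m < N, ∀ j, Deformation.cf (step^[N] 1) m j =
      Deformation.cf (step^[N + 1] 1) m j := by
    intro N
    induction N with
    | zero => intro m hm; omega
    | succ N ih =>
      intro m hm j
      rw [Function.iterate_succ_apply', Function.iterate_succ_apply']
      exact hstep _ _ m (fun m' hm' => ih m' (by omega)) j
  have hiter2 : ∀ N m, m < N → ∀ j, Deformation.cf (step^[N] 1) m j =
      Deformation.cf (step^[m + 1] 1) m j := by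
    intro N m hN
    induction N, hN using Nat.le_induction with
    | base => exact fun j => rfl
    | succ N hN ih => exact fun j => (hiter N m hN j).symm.trans (ih j)
  -- The coefficients at `τ^m` no longer change after `m + 1` iterations.
  let c : SAlg S W := Deformation.ofCf fun m j => Deformation.cf (step^[m + 1] 1) m j
  have hc : step c = c := by
    refine Deformation.ext_cf fun m j => ?_
    simp only [c, Deformation.cf_ofCf]
    rw [Function.iterate_succ_apply']
    refine hstep _ _ m (fun m' hm' j => ?_) j
    rw [Deformation.cf_ofCf, hiter2 m m' hm']
  refine ⟨c, fun j => ?_, fun α => ?_⟩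
  · rw [← hc]
    simp only [step, add_sub_cancel_left, Deformation.cf_ofCf]
    rw [← hT0]
    congr 1
    funext α
    exact isQAlg_mul_left (ha α) c j
  -- `T` inverts the derivative only on closed forms, and `c * a` is not yet known to be closed. By
  -- flatness its failure to be closed is expressed through the defect `d`, always multiplied by
  -- `a`. So if `d` vanishes below `τ^m`, then `c * a` is closed at `τ^m`, and `d` vanishes there
  -- too.
  let d : Fin 2 → SAlg S W := fun α => sder (ρ.dir α) c - c * a α
  have hd : ∀ α β, sder (ρ.dir β) (c * a α) - sder (ρ.dir α) (c * a β) =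
      d β * a α - d α * a β := by
    intro α β
    rw [sder_mul, sder_mul]
    have h := congrArg (c * ·) (hflat α β)
    simp only [mul_zero, mul_add, mul_sub] at h
    simp only [d, sub_mul, mul_assoc]
    rw [← sub_eq_zero, ← h]
    abel
  have hd0 : ∀ m, ∀ α j, Deformation.cf (d α) m j = 0 := by
    intro m
    induction m using Nat.strong_induction_on with
    | _ m ih =>
      intro α j
      have hz : ∀ α β j, Deformation.cf (d β * a α) m j = 0 := by
        intro α β j
        rw [hmul (d β) 0 α m (fun m' hm' j => by rw [ih m' hm', Deformation.cf_zero]) j, zero_mul,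
          Deformation.cf_zero]
      have hcl : ∀ α β, der W (ρ.dir β) (Deformation.cf (c * a α) m j) =
          der W (ρ.dir α) (Deformation.cf (c * a β) m j) := by
        intro α β
        rw [← cf_sder, ← cf_sder, ← sub_eq_zero, ← Deformation.cf_sub, hd, Deformation.cf_sub,
          hz, hz, sub_zero]
      have h1 := hT _ hcl α
      have h2 : Deformation.cf (sder (ρ.dir α) c) m j = Deformation.cf (c * a α) m j := by
        rw [← h1]
        conv_lhs => rw [← hc]
        simp only [step, map_add, sder_one, zero_add, cf_sder, Deformation.cf_ofCf]
      simp only [d, Deformation.cf_sub, h2, sub_self]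
  exact sub_eq_zero.1 (Deformation.ext_cf fun m j => (hd0 m α j).trans (Deformation.cf_zero m j).symm)

end Retraction

end StarSDYM

namespace StarSDYM

open TopologicalSpace (Opens)
open FSeries

/-! ### Kähler and heavenly metrics -/

section Metric

theorem wedge_mul_epsTilde (c : ℂ) (F : Idx → Idx → ℂ) :
    wedge (fun i j => c * epsTilde i j) F = c * F (.inl 0) (.inl 1) := by
  simp only [wedge, epsTilde, twoForm, typeTT, eps]
  norm_num

theorem wedge_epsTilde (F : Idx → Idx → ℂ) : wedge epsTilde F = F (.inl 0) (.inl 1) := by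
  simpa using wedge_mul_epsTilde 1 F

theorem wedge_dwdz (F : Idx → Idx → ℂ) : wedge dwdz F = F (.inr 0) (.inr 1) := by
  simp only [wedge, dwdz, twoForm, typeHH, eps]
  norm_num

theorem wedge_kahlerForm (g : Metric) (p : Base) (F : Idx → Idx → ℂ) :
    wedge (g.kahlerForm p) F = -(g 0 0 p * F (.inl 1) (.inr 1)) + g 0 1 p * F (.inl 1) (.inr 0)
      + g 1 0 p * F (.inl 0) (.inr 1) - g 1 1 p * F (.inl 0) (.inr 0) := by
  simp [wedge, Metric.kahlerForm, twoForm, typeHT]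

theorem Metric.isSelfDual_iff (g : Metric) (p : Base) (F : Idx → Idx → ℂ) :
    g.IsSelfDual p F ↔ F (.inl 0) (.inl 1) = 0 ∧
      -(g 0 0 p * F (.inl 1) (.inr 1)) + g 0 1 p * F (.inl 1) (.inr 0)
        + g 1 0 p * F (.inl 0) (.inr 1) - g 1 1 p * F (.inl 0) (.inr 0) = 0 ∧
      F (.inr 0) (.inr 1) = 0 := by
  rw [Metric.IsSelfDual, wedge_kahlerForm, wedge_epsTilde, wedge_dwdz]

theorem Metric.det_mat (g : Metric) (p : Base) :
    (g.mat p).det = g 0 0 p * g 1 1 p - g 0 1 p * g 1 0 p := by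
  simp [Metric.mat, Matrix.det_fin_two]

theorem Metric.inv_apply (g : Metric) (p : Base) :
    g.inv 0 0 p = ((g.mat p).det)⁻¹ * g 1 1 p ∧ g.inv 0 1 p = -(((g.mat p).det)⁻¹ * g 0 1 p) ∧
    g.inv 1 0 p = -(((g.mat p).det)⁻¹ * g 1 0 p) ∧ g.inv 1 1 p = ((g.mat p).det)⁻¹ * g 0 0 p := by
  simp [Metric.inv, Matrix.inv_def, Matrix.adjugate_fin_two, Metric.mat]

theorem differentiableOn_pd {f : Base → ℂ} {U : Set Base} (hU : IsOpen U)
    (hf : DifferentiableOn ℂ f U) (i : Idx) : DifferentiableOn ℂ (pd i f) U :=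
  differentiableOn_fderiv_apply hU hf _

theorem pd_comm {f : Base → ℂ} {U : Set Base} (hU : IsOpen U) (hf : DifferentiableOn ℂ f U)
    {p : Base} (hp : p ∈ U) (i j : Idx) : pd i (pd j f) p = pd j (pd i f) p :=
  fderiv_fderiv_comm hU hf hp _ _

theorem pd_congr {f h : Base → ℂ} {U : Set Base} (hU : IsOpen U) (hfh : EqOn f h U) {p : Base}
    (hp : p ∈ U) (i : Idx) : pd i f p = pd i h p := by
  unfold pd
  congr 1
  refine Filter.EventuallyEq.fderiv_eq ?_
  filter_upwards [hU.mem_nhds hp] with y hy using hfh hy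

theorem pd_mul {f h : Base → ℂ} {p : Base} (hf : DifferentiableAt ℂ f p)
    (hh : DifferentiableAt ℂ h p) (i : Idx) :
    pd i (fun p => f p * h p) p = pd i f p * h p + f p * pd i h p := by
  unfold pd
  rw [fderiv_fun_mul hf hh]
  simp
  ring

theorem pd_add {f h : Base → ℂ} {p : Base} (hf : DifferentiableAt ℂ f p)
    (hh : DifferentiableAt ℂ h p) (i : Idx) :
    pd i (fun p => f p + h p) p = pd i f p + pd i h p := by
  unfold pd
  rw [fderiv_fun_add hf hh]
  simp

theorem pd_sub {f h : Base → ℂ} {p : Base} (hf : DifferentiableAt ℂ f p)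
    (hh : DifferentiableAt ℂ h p) (i : Idx) :
    pd i (fun p => f p - h p) p = pd i f p - pd i h p := by
  unfold pd
  rw [fderiv_fun_sub hf hh]
  simp

variable {g : Metric} {U : Set Base}

namespace Metric.IsKahler

variable (hK : g.IsKahler U) (hU : IsOpen U)

include hK

theorem differentiableOn_det : DifferentiableOn ℂ (fun p => (g.mat p).det) U := by
  simp only [Metric.det_mat]
  exact ((hK.holomorphic 0 0).mul (hK.holomorphic 1 1)).sub
    ((hK.holomorphic 0 1).mul (hK.holomorphic 1 0))

theorem differentiableOn_inv (α β : Fin 2) : DifferentiableOn ℂ (g.inv α β) U := by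
  have hd := hK.differentiableOn_det.inv hK.nondegenerate
  have h00 : DifferentiableOn ℂ (g.inv 0 0) U :=
    (hd.mul (hK.holomorphic 1 1)).congr fun p _ => (g.inv_apply p).1
  have h01 : DifferentiableOn ℂ (g.inv 0 1) U :=
    (hd.mul (hK.holomorphic 0 1)).neg.congr fun p _ => (g.inv_apply p).2.1
  have h10 : DifferentiableOn ℂ (g.inv 1 0) U :=
    (hd.mul (hK.holomorphic 1 0)).neg.congr fun p _ => (g.inv_apply p).2.2.1
  have h11 : DifferentiableOn ℂ (g.inv 1 1) U :=
    (hd.mul (hK.holomorphic 0 0)).congr fun p _ => (g.inv_apply p).2.2.2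
  fin_cases α <;> fin_cases β <;> assumption

include hU

theorem differentiableAt {p : Base} (hp : p ∈ U) (α β : Fin 2) : DifferentiableAt ℂ (g α β) p :=
  (hK.holomorphic α β).differentiableAt (hU.mem_nhds hp)

theorem pd_det {p : Base} (hp : p ∈ U) (i : Idx) : pd i (fun p => (g.mat p).det) p =
    pd i (g 0 0) p * g 1 1 p + g 0 0 p * pd i (g 1 1) p
      - (pd i (g 0 1) p * g 1 0 p + g 0 1 p * pd i (g 1 0) p) := by
  have hd := hK.differentiableAt hU hp
  simp only [Metric.det_mat]
  rw [pd_sub ((hd 0 0).fun_mul (hd 1 1)) ((hd 0 1).fun_mul (hd 1 0)), pd_mul (hd 0 0) (hd 1 1),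
    pd_mul (hd 0 1) (hd 1 0)]

theorem differentiableOn_christoffel (σ β γ : Fin 2) :
    DifferentiableOn ℂ (g.christoffel σ β γ) U := by
  unfold Metric.christoffel
  exact DifferentiableOn.fun_sum fun τ _ =>
    (hK.differentiableOn_inv τ σ).mul (differentiableOn_pd hU (hK.holomorphic β τ) _)

theorem contract_christoffel {p : Base} (hp : p ∈ U) (α β γ : Fin 2) :
    g 0 α p * g.christoffel 0 β γ p + g 1 α p * g.christoffel 1 β γ p =
      pd (.inl γ) (g β α) p := by
  have hd := hK.nondegenerate p hp
  obtain ⟨h00, h01, h10, h11⟩ := g.inv_apply p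
  simp only [Metric.christoffel, Fin.sum_univ_two, h00, h01, h10, h11]
  have hD := g.det_mat p
  set D := (g.mat p).det
  fin_cases α
  · simp only [Fin.zero_eta]
    field_simp
    rw [hD]
    ring
  · simp only [Fin.mk_one]
    field_simp
    rw [hD]
    ring

/-- The Kähler condition exchanges the index of differentiation with `β`; what remains is the
formula for the derivative of a determinant. -/
theorem trace_christoffel {p : Base} (hp : p ∈ U) (β : Fin 2) :
    g.christoffel 0 β 0 p + g.christoffel 1 β 1 p =
      ((g.mat p).det)⁻¹ * pd (.inl β) (fun p => (g.mat p).det) p := by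
  obtain ⟨h00, h01, h10, h11⟩ := g.inv_apply p
  simp only [Metric.christoffel, Fin.sum_univ_two, h00, h01, h10, h11]
  rw [hK.pd_det hU hp, hK.closed_left p hp β 0 0, hK.closed_left p hp β 0 1,
    hK.closed_left p hp β 1 0, hK.closed_left p hp β 1 1]
  ring

theorem curvature_eq {p : Base} (hp : p ∈ U) (α β γ δ : Fin 2) :
    g.curvature α β γ δ p = pd (.inr δ) (g 0 α) p * g.christoffel 0 β γ p
      + pd (.inr δ) (g 1 α) p * g.christoffel 1 β γ p
      - pd (.inr δ) (pd (.inl γ) (g β α)) p := by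
  have hd := hK.differentiableAt hU hp
  have hc : ∀ σ, DifferentiableAt ℂ (g.christoffel σ β γ) p := fun σ =>
    (hK.differentiableOn_christoffel hU σ β γ).differentiableAt (hU.mem_nhds hp)
  have h := pd_congr hU (fun p hp => hK.contract_christoffel hU hp α β γ) hp (.inr δ)
  rw [pd_add ((hd 0 α).fun_mul (hc 0)) ((hd 1 α).fun_mul (hc 1)), pd_mul (hd 0 α) (hc 0),
    pd_mul (hd 1 α) (hc 1)] at h
  have he : pd (.inr δ) (fun p => pd (.inl γ) (g β α) p) p =
    pd (.inr δ) (pd (.inl γ) (g β α)) p := rfl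
  rw [← he, ← h, Metric.curvature, Fin.sum_univ_two]
  ring

/-- Expanding the curvature through first and second derivatives of the metric (`curvature_eq`)
makes the symmetry in the two tilded indices a consequence of `dΩ = 0`. -/
theorem curvature_swap {p : Base} (hp : p ∈ U) (α β γ δ : Fin 2) :
    g.curvature α β γ δ p = g.curvature δ β γ α p := by
  rw [hK.curvature_eq hU hp, hK.curvature_eq hU hp, hK.closed_right p hp 0 α δ,
    hK.closed_right p hp 1 α δ, pd_comm hU (hK.holomorphic β α) hp,
    pd_comm hU (hK.holomorphic β δ) hp]
  congr 1
  exact pd_congr hU (fun p hp => hK.closed_right p hp β α δ) hp _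

/-- Take the wedge with `Ω`. After the exchange of tilded indices, the factor `g_{σδ̃}` in the
curvature meets the `g` of the Kähler form, and the 2×2 contraction collapses to `det(g)` times
`∂_α̃` of the trace of `Γ`. -/
theorem ricci_flat (hH : g.IsHeavenly U) {p : Base} (hp : p ∈ U) (α β : Fin 2) :
    pd (.inr α) (g.christoffel 0 β 0) p + pd (.inr α) (g.christoffel 1 β 1) p = 0 := by
  have h := ((g.isSelfDual_iff p _).1 (hH p hp α β)).2.1
  simp only [twoForm, typeHT, sub_zero] at h
  rw [hK.curvature_swap hU hp α β 0 0, hK.curvature_swap hU hp α β 0 1,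
    hK.curvature_swap hU hp α β 1 0, hK.curvature_swap hU hp α β 1 1] at h
  simp only [Metric.curvature, Fin.sum_univ_two] at h
  have hd := hK.nondegenerate p hp
  have h2 : (g.mat p).det * (pd (.inr α) (g.christoffel 0 β 0) p
      + pd (.inr α) (g.christoffel 1 β 1) p) = 0 := by
    rw [g.det_mat, ← h]
    ring
  exact (mul_eq_zero.1 h2).resolve_left hd

theorem pd_log_det (hH : g.IsHeavenly U) {p : Base} (hp : p ∈ U) (α β : Fin 2) :
    pd (.inr α) (fun p => ((g.mat p).det)⁻¹ * pd (.inl β) (fun p => (g.mat p).det) p) p = 0 := by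
  rw [← pd_congr hU (fun p hp => hK.trace_christoffel hU hp β) hp]
  have hc : ∀ σ, DifferentiableAt ℂ (g.christoffel σ β σ) p := fun σ =>
    (hK.differentiableOn_christoffel hU σ β σ).differentiableAt (hU.mem_nhds hp)
  rw [pd_add (hc 0) (hc 1), hK.ricci_flat hU hH hp]

end Metric.IsKahler

theorem fderiv_eq_zero_of_single {f : (Fin 2 → ℂ) → ℂ} {w : Fin 2 → ℂ}
    (h : ∀ α, fderiv ℂ f w (Pi.single α 1) = 0) : fderiv ℂ f w = 0 := by
  ext v
  have hv : v = ∑ α, v α • (Pi.single α 1 : Fin 2 → ℂ) := by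
    ext β; simp [Finset.sum_apply, Pi.single_apply]
  rw [hv, map_sum]
  simp [h]

theorem eq_of_fderiv_single {f : (Fin 2 → ℂ) → ℂ} {B : Set (Fin 2 → ℂ)} (hB : IsOpen B)
    (hc : Convex ℝ B) (hf : DifferentiableOn ℂ f B)
    (h : ∀ w ∈ B, ∀ α, fderiv ℂ f w (Pi.single α 1) = 0) {w w' : Fin 2 → ℂ} (hw : w ∈ B)
    (hw' : w' ∈ B) : f w = f w' :=
  hc.is_const_of_fderivWithin_eq_zero (𝕜 := ℂ) hf
    (fun y hy => by
      rw [fderivWithin_of_isOpen hB hy]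
      exact fderiv_eq_zero_of_single (h y hy)) hw hw'

/-- Write `D` for the determinant and fix `(b, bt)` in the patch. Since `∂̃(D⁻¹ ∂D) = 0`, the
logarithmic derivative of `w ↦ D(w, v)` does not depend on `v`, so `D(w, v) / D(w, bt)` does not
depend on `w`. Working with `D⁻¹ ∂D` instead of `log D` avoids choosing a branch. -/
theorem Metric.IsHeavenly.exists_factors (hU : IsOpen U) (hK : g.IsKahler U)
    (hH : g.IsHeavenly U) {B Bt : Set (Fin 2 → ℂ)} (hB : IsOpen B) (hBt : IsOpen Bt)
    (hBc : Convex ℝ B) (hBtc : Convex ℝ Bt) (hsub : B ×ˢ Bt ⊆ U) :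
    ∃ G Gt : (Fin 2 → ℂ) → ℂ, DifferentiableOn ℂ G B ∧ DifferentiableOn ℂ Gt Bt ∧
      g.Factors (B ×ˢ Bt) G Gt := by
  rcases (B ×ˢ Bt).eq_empty_or_nonempty with he | ⟨⟨b, bt⟩, hb, hbt⟩
  · refine ⟨0, 0, differentiableOn_const _, differentiableOn_const _, ?_⟩
    rw [he]
    exact fun p hp => hp.elim
  set D : Base → ℂ := fun p => (g.mat p).det with hD
  have hDd := hK.differentiableOn_det
  have hDn : ∀ w ∈ B, ∀ v ∈ Bt, D (w, v) ≠ 0 := fun w hw v hv =>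
    hK.nondegenerate _ (hsub ⟨hw, hv⟩)
  have hl : ∀ v ∈ Bt, DifferentiableOn ℂ (fun w => D (w, v)) B := fun v hv =>
    DifferentiableOn.comp (f := fun w => ((w, v) : Base)) hDd (by fun_prop) fun w hw =>
      hsub ⟨hw, hv⟩
  have hr : ∀ w ∈ B, DifferentiableOn ℂ (fun v => D (w, v)) Bt := fun w hw =>
    DifferentiableOn.comp (f := fun v => ((w, v) : Base)) hDd (by fun_prop) fun v hv =>
      hsub ⟨hw, hv⟩
  refine ⟨fun w => D (w, bt), fun v => D (b, v) / D (b, bt), hl bt hbt,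
    by simpa only [div_eq_mul_inv] using (hr b hb).mul_const (D (b, bt))⁻¹, ?_⟩
  rintro ⟨w, v⟩ ⟨hw, hv⟩
  have hlog : ∀ w ∈ B, ∀ v ∈ Bt, ∀ β, (D (w, v))⁻¹ * pd (.inl β) D (w, v) =
      (D (w, bt))⁻¹ * pd (.inl β) D (w, bt) := by
    intro w hw v hv β
    have hdd : DifferentiableOn ℂ (fun p => (D p)⁻¹ * pd (.inl β) D p) U :=
      (hDd.inv hK.nondegenerate).mul (differentiableOn_pd hU hDd _)
    refine eq_of_fderiv_single (f := fun v => (D (w, v))⁻¹ * pd (.inl β) D (w, v)) hBt hBtc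
      (DifferentiableOn.comp (f := fun v => ((w, v) : Base)) hdd (by fun_prop) fun v hv =>
        hsub ⟨hw, hv⟩) (fun y hy α => ?_) hv hbt
    have hm : ((w, y) : Base) ∈ U := hsub ⟨hw, hy⟩
    have h1 := fderiv_slice_right (hdd.differentiableAt (hU.mem_nhds hm)) (Pi.single α 1)
    exact h1.symm.trans (hK.pd_log_det hU hH hm α β)
  have hquot : D (w, v) / D (w, bt) = D (b, v) / D (b, bt) := by
    simp only [div_eq_mul_inv]
    refine eq_of_fderiv_single (f := fun w => D (w, v) * (D (w, bt))⁻¹) hB hBc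
      ((hl v hv).mul ((hl bt hbt).inv fun w hw => hDn w hw bt hbt)) (fun y hy α => ?_) hw hb
    have h1 := (hl v hv).differentiableAt (hB.mem_nhds hy)
    have h2 := (hl bt hbt).differentiableAt (hB.mem_nhds hy)
    have hn1 := hDn y hy v hv
    have hn2 := hDn y hy bt hbt
    have hm : ∀ v ∈ Bt, ((y, v) : Base) ∈ U := fun v hv => hsub ⟨hy, hv⟩
    have e1 : fderiv ℂ (fun w => D (w, v)) y (Pi.single α 1) = pd (.inl α) D (y, v) :=
      (fderiv_slice_left (hDd.differentiableAt (hU.mem_nhds (hm v hv))) (Pi.single α 1)).symm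
    have e2 : fderiv ℂ (fun w => D (w, bt)) y (Pi.single α 1) = pd (.inl α) D (y, bt) :=
      (fderiv_slice_left (hDd.differentiableAt (hU.mem_nhds (hm bt hbt))) (Pi.single α 1)).symm
    have h3 := hlog y hy v hv α
    have h4 := h1.hasFDerivAt.fun_mul ((hasDerivAt_inv hn2).comp_hasFDerivAt y h2.hasFDerivAt)
    have h5 := DFunLike.congr_fun h4.fderiv (Pi.single α 1)
    refine h5.trans ?_
    simp only [_root_.add_apply, _root_.smul_apply, e1, e2, smul_eq_mul, Function.comp]
    rw [inv_mul_eq_div, inv_mul_eq_div, div_eq_div_iff hn1 hn2] at h3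
    field_simp
    linear_combination h3
  have := hDn w hw bt hbt
  change D (w, v) = D (w, bt) * (D (b, v) / D (b, bt))
  rw [← hquot]
  field_simp

end Metric

end StarSDYM

namespace StarSDYM

open TopologicalSpace (Opens)
open FSeries

/-! ### The self-dual Yang-Mills equations -/

/-- The retraction of a product of convex sets along the untilded directions. -/
def retractionLeft {B Bt : Set (Fin 2 → ℂ)} (hB : Convex ℝ B) (b : Fin 2 → ℂ)
    (hb : B.Nonempty → b ∈ B) : Retraction (B ×ˢ Bt) where
  dir := Sum.inl
  coord α := (ContinuousLinearMap.proj α).comp (ContinuousLinearMap.fst ℂ _ _)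
  center := (b, 0)
  proj := (ContinuousLinearMap.inl ℂ _ _).comp (ContinuousLinearMap.fst ℂ _ _)
  proj_eq v := by
    refine Prod.ext (funext fun γ => ?_) (by simp [dirVec, Fin.sum_univ_two])
    fin_cases γ <;> simp [dirVec, Fin.sum_univ_two]
  coord_dir α β := by simp [dirVec, Pi.single_apply]
  segment p hp s hs := by
    refine ⟨?_, by simpa using hp.2⟩
    have h := hB hp.1 (hb ⟨_, hp.1⟩) hs.1 (sub_nonneg.2 hs.2) (by ring)
    convert h using 1
    funext γ
    simp
    ring

/-- The retraction of a product of convex sets along the tilded directions. -/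
def retractionRight {B Bt : Set (Fin 2 → ℂ)} (hBt : Convex ℝ Bt) (b : Fin 2 → ℂ)
    (hb : Bt.Nonempty → b ∈ Bt) : Retraction (B ×ˢ Bt) where
  dir := Sum.inr
  coord α := (ContinuousLinearMap.proj α).comp (ContinuousLinearMap.snd ℂ _ _)
  center := (0, b)
  proj := (ContinuousLinearMap.inr ℂ _ _).comp (ContinuousLinearMap.snd ℂ _ _)
  proj_eq v := by
    refine Prod.ext (by simp [dirVec, Fin.sum_univ_two]) (funext fun γ => ?_)
    fin_cases γ <;> simp [dirVec, Fin.sum_univ_two]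
  coord_dir α β := by simp [dirVec, Pi.single_apply]
  segment p hp s hs := by
    refine ⟨by simpa using hp.1, ?_⟩
    have h := hBt hp.2 (hb ⟨_, hp.2⟩) hs.1 (sub_nonneg.2 hs.2) (by ring)
    convert h using 1
    funext γ
    simp
    ring

/-- Patches may be empty, hence the conditional membership. -/
theorem exists_center (B : Set (Fin 2 → ℂ)) : ∃ b, B.Nonempty → b ∈ B := by
  rcases B.eq_empty_or_nonempty with rfl | ⟨b, hb⟩
  · exact ⟨0, fun h => (not_nonempty_empty h).elim⟩
  · exact ⟨b, fun _ => hb⟩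

section SDYM

variable {n : ℕ} {P : Type*} [TopologicalSpace P] [ChartedSpace (Phase n) P]
  [IsManifold 𝓘(ℂ, Phase n) ω P] {Ω : SymplecticForm n P} {S : StarProduct Ω}
  {W : Opens (P × Base)} {g : Metric} {U : Set Base}

/-- The curvature of a connection with components in the algebra. -/
def scurv (a : Idx → SAlg S W) (i j : Idx) : SAlg S W :=
  sder i (a j) - sder j (a i) + sbr (a i) (a j)

theorem isA_curvatureForm {A : Idx → FSeries P} (hA : ∀ i, IsA n W (A i)) (i j : Idx) :
    IsA n W (curvatureForm S A i j) :=
  isA_add (isA_sub (isA_d (hA j) i) (isA_d (hA i) j)) (isA_bracket (hA i) (hA j))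

theorem toAlg_curvatureForm {A : Idx → FSeries P} (hA : ∀ i, IsA n W (A i)) (i j : Idx) :
    toAlg S W (curvatureForm S A i j) = scurv (fun i => toAlg S W (A i)) i j := by
  rw [curvatureForm, toAlg_add (isA_sub (isA_d (hA j) i) (isA_d (hA i) j))
    (isA_bracket (hA i) (hA j)), toAlg_sub (isA_d (hA j) i) (isA_d (hA i) j),
    toAlg_bracket (hA i) (hA j), toAlg_d (hA j), toAlg_d (hA i)]
  rfl

/-- By `br_ih`, the curvature of `iħ a` is `iħ (da + a ∧ a)`, so the vanishing of a component is
ordinary flatness of `a`. -/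
theorem scurv_sih (a : Idx → SAlg S W) (i j : Idx) : scurv (fun i => sih (a i)) i j =
    sih (sder i (a j) - sder j (a i) + (a i * a j - a j * a i)) := by
  rw [scurv, sder_sih, sder_sih, sbr, Deformation.br_ih]
  simp only [sih, Deformation.ih_add, Deformation.ih_sub]

/-- A function holomorphic on an open subset of the base, as a function holomorphic over `W`. -/
def baseFun (hU : IsOpen U) (hW : ∀ q ∈ W, q.2 ∈ U) (c : Base → ℂ) (hc : DifferentiableOn ℂ c U) :
    BaseFun n W :=
  ⟨c, fun q hq => by
    have h1 : DifferentiableAt ℂ c q.2 := hc.differentiableAt (hU.mem_nhds (hW q hq))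
    have h2 := h1.mdifferentiableAt.comp q
      (mdifferentiableAt_snd (I := 𝓘(ℂ, Phase n)) (I' := 𝓘(ℂ, Base)))
    exact h2.mdifferentiableWithinAt⟩

/-- The contraction of a matrix of series with the Kähler form. -/
def kahlerTrace (g : Metric) (X : Fin 2 → Fin 2 → FSeries P) : FSeries P := fun m k q =>
  -(g 0 0 q.2 * X 1 1 m k q) + g 0 1 q.2 * X 1 0 m k q + g 1 0 q.2 * X 0 1 m k q
    - g 1 1 q.2 * X 0 0 m k q

/-- A 2×2 inverse is the adjugate over the determinant, so contraction with the inverse metric and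
wedge with the Kähler form differ by the nonvanishing factor `-1/det(g)`. -/
theorem sum_inv_mul (p : Base) (x : Fin 2 → Fin 2 → ℂ) :
    ∑ β, ∑ α, g.inv β α p * x α β = -((g.mat p).det)⁻¹ *
      (-(g 0 0 p * x 1 1) + g 0 1 p * x 1 0 + g 1 0 p * x 0 1 - g 1 1 p * x 0 0) := by
  obtain ⟨h00, h01, h10, h11⟩ := g.inv_apply p
  simp only [Fin.sum_univ_two, h00, h01, h10, h11]
  ring

theorem isYang_iff (hW : ∀ q ∈ W, q.2 ∈ U) (hK : g.IsKahler U) (J : FSeries P) :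
    IsYang S g W J ↔ EqOver W (kahlerTrace g fun α β =>
      (FSeries.star S (starInv S J) (J.d (.inr β))).d (.inl α)) 0 := by
  refine forall_congr' fun m => forall_congr' fun k => forall₂_congr fun q hq => ?_
  rw [sum_inv_mul q.2 fun α β =>
    (FSeries.star S (starInv S J) (J.d (.inr β))).d (.inl α) m k q, mul_eq_zero,
    or_iff_right (neg_ne_zero.2 (inv_ne_zero (hK.nondegenerate _ (hW q hq))))]
  rfl

theorem isSDYM_iff (A : Idx → FSeries P) : IsSDYM S g W A ↔
    EqOver W (curvatureForm S A (.inl 0) (.inl 1)) 0 ∧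
    EqOver W (kahlerTrace g fun α β => curvatureForm S A (.inl α) (.inr β)) 0 ∧
    EqOver W (curvatureForm S A (.inr 0) (.inr 1)) 0 := by
  simp only [IsSDYM, Metric.isSelfDual_iff, EqOver]
  exact ⟨fun h => ⟨fun m k q hq => (h m k q hq).1, fun m k q hq => (h m k q hq).2.1,
    fun m k q hq => (h m k q hq).2.2⟩, fun h m k q hq => ⟨h.1 m k q hq, h.2.1 m k q hq,
    h.2.2 m k q hq⟩⟩

theorem eqOver_zero_iff {A : FSeries P} (hA : IsA n W A) :
    EqOver W A 0 ↔ toAlg S W A = 0 := by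
  rw [← toAlg_eq_iff (S := S) hA isA_zero, toAlg_zero]

theorem FSeries.EqOver.curvatureForm {A A' : Idx → FSeries P} (hA : ∀ i, IsA n W (A i))
    (h : ∀ i, EqOver W (A i) (A' i)) (i j : Idx) :
    EqOver W (StarSDYM.curvatureForm S A i j) (StarSDYM.curvatureForm S A' i j) := by
  have hA' : ∀ i, IsA n W (A' i) := fun i => (h i).isA (hA i)
  rw [← toAlg_eq_iff (S := S) (isA_curvatureForm hA i j) (isA_curvatureForm hA' i j),
    toAlg_curvatureForm hA, toAlg_curvatureForm hA']
  congr 1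
  funext i
  exact (toAlg_eq_iff (hA i) (hA' i)).2 (h i)

theorem IsSDYM.congr {A A' : Idx → FSeries P} (hA : ∀ i, IsA n W (A i))
    (h : ∀ i, EqOver W (A i) (A' i)) (hs : IsSDYM S g W A) : IsSDYM S g W A' := by
  intro m k q hq
  have he : (fun i j => StarSDYM.curvatureForm S A' i j m k q) =
      fun i j => StarSDYM.curvatureForm S A i j m k q := by
    funext i j
    exact (EqOver.curvatureForm hA h i j m k q hq).symm
  rw [he]
  exact hs m k q hq

/-! ### Self-duality in the algebra, and Yang's equation -/

section Gauge

variable (hU : IsOpen U) (hW : ∀ q ∈ W, q.2 ∈ U) (hK : g.IsKahler U)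

/-- The components of the metric, as holomorphic functions over `W`. -/
def metricB (α β : Fin 2) : BaseFun n W := baseFun hU hW (g α β) (hK.holomorphic α β)

theorem kahlerTrace_eq (X : Fin 2 → Fin 2 → FSeries P) : kahlerTrace g X =
    bmul (metricB (n := n) hU hW hK 0 1).1 (X 1 0) + bmul (metricB (n := n) hU hW hK 1 0).1 (X 0 1)
    - bmul (metricB (n := n) hU hW hK 0 0).1 (X 1 1)
    - bmul (metricB (n := n) hU hW hK 1 1).1 (X 0 0) := by
  funext m k q
  simp only [kahlerTrace, metricB, baseFun, bmul, Pi.add_apply, Pi.sub_apply]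
  ring

include hU hW hK in
theorem isA_kahlerTrace {X : Fin 2 → Fin 2 → FSeries P} (hX : ∀ α β, IsA n W (X α β)) :
    IsA n W (kahlerTrace g X) := by
  rw [kahlerTrace_eq (n := n) hU hW hK]
  exact isA_sub (isA_sub (isA_add (isA_bmul _ (hX _ _)) (isA_bmul _ (hX _ _)))
    (isA_bmul _ (hX _ _))) (isA_bmul _ (hX _ _))

/-- The contraction of a matrix with the Kähler form. -/
def strace (x : Fin 2 → Fin 2 → SAlg S W) : SAlg S W :=
  metricB (n := n) hU hW hK 0 1 • x 1 0 + metricB (n := n) hU hW hK 1 0 • x 0 1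
    - metricB (n := n) hU hW hK 0 0 • x 1 1 - metricB (n := n) hU hW hK 1 1 • x 0 0

theorem toAlg_kahlerTrace {X : Fin 2 → Fin 2 → FSeries P} (hX : ∀ α β, IsA n W (X α β)) :
    toAlg S W (kahlerTrace g X) = strace hU hW hK fun α β => toAlg S W (X α β) := by
  have h := fun (c : BaseFun n W) α β => isA_bmul c (hX α β)
  rw [kahlerTrace_eq (n := n) hU hW hK, toAlg_sub (isA_sub (isA_add (h _ _ _) (h _ _ _)) (h _ _ _))
    (h _ _ _), toAlg_sub (isA_add (h _ _ _) (h _ _ _)) (h _ _ _), toAlg_add (h _ _ _) (h _ _ _),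
    toAlg_bmul _ (hX _ _), toAlg_bmul _ (hX _ _), toAlg_bmul _ (hX _ _), toAlg_bmul _ (hX _ _)]
  rfl

theorem isSDYM_iff_alg {A : Idx → FSeries P} (hA : ∀ i, IsA n W (A i)) : IsSDYM S g W A ↔
    scurv (fun i => toAlg S W (A i)) (.inl 0) (.inl 1) = 0 ∧
    strace hU hW hK (fun α β => scurv (fun i => toAlg S W (A i)) (.inl α) (.inr β)) = 0 ∧
    scurv (fun i => toAlg S W (A i)) (.inr 0) (.inr 1) = 0 := by
  have hc := fun i j => isA_curvatureForm (S := S) hA i j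
  rw [isSDYM_iff, eqOver_zero_iff (S := S) (hc _ _), eqOver_zero_iff (S := S) (hc _ _),
    eqOver_zero_iff (S := S) (isA_kahlerTrace hU hW hK fun _ _ => hc _ _),
    toAlg_kahlerTrace hU hW hK fun _ _ => hc _ _]
  simp only [toAlg_curvatureForm hA]

theorem strace_sih (x : Fin 2 → Fin 2 → SAlg S W) :
    strace hU hW hK (fun α β => sih (x α β)) = sih (strace hU hW hK x) := by
  simp only [strace, sih, Deformation.ih_add, Deformation.ih_sub, Deformation.ih_smul]

variable {J : FSeries P}

theorem isA_logDeriv (hJ : IsExpQ n W J) (i : Idx) :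
    IsA n W (FSeries.star S (starInv S J) (J.d i)) :=
  isA_star (isA_starInv hJ) (isA_d hJ.toIsA i)

theorem toAlg_logDeriv (hJ : IsExpQ n W J) (i : Idx) :
    toAlg S W (FSeries.star S (starInv S J) (J.d i)) =
      toAlg S W (starInv S J) * sder i (toAlg S W J) := by
  rw [toAlg_star (isA_starInv hJ) (isA_d hJ.toIsA i), toAlg_d hJ.toIsA]

theorem isQ_logDeriv (hJ : IsExpQ n W J) (i : Idx) :
    IsQ n W (FSeries.star S (starInv S J) (J.d i)) := by
  refine isQ_of_toAlg (S := S) (isA_logDeriv hJ i) ?_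
  rw [toAlg_logDeriv hJ]
  refine isQAlg_mul_left ?_ _
  have h := isQAlg_sder ((isExpQ_iff_sub_one (S := S)).1 hJ).2 i
  rwa [map_sub, sder_one, sub_zero] at h

theorem isA_connOfJ (hJ : IsExpQ n W J) (i : Idx) : IsA n W (connOfJ S J i) := by
  cases i with
  | inl α => exact isA_zero
  | inr α => exact isA_mulIħ (isA_logDeriv hJ _)

theorem isQ_divIħ_connOfJ (hJ : IsExpQ n W J) (i : Idx) : IsQ n W (connOfJ S J i).divIħ := by
  cases i with
  | inl α =>
    refine ⟨⟨fun m k => ?_, fun m k _ q _ => mul_zero _⟩, fun k q _ => mul_zero _⟩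
    exact mdifferentiableOn_const.mul mdifferentiableOn_const
  | inr α =>
    rw [connOfJ, divIħ_mulIħ]
    exact isQ_logDeriv hJ _

theorem sder_inv {a b : SAlg S W} (hba : b * a = 1) (hab : a * b = 1) (i : Idx) :
    sder i b = -(b * sder i a * b) := by
  have h1 : sder i b * a + b * sder i a = 0 := by rw [← sder_mul, hba, sder_one]
  calc sder i b = sder i b * (a * b) := by rw [hab, mul_one]
    _ = (sder i b * a) * b := by rw [mul_assoc]
    _ = -(b * sder i a * b) := by rw [eq_neg_of_add_eq_zero_left h1, neg_mul]

/-- The curvature of a pure gauge vanishes. -/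
theorem pureGauge_flat {a b : SAlg S W} (hba : b * a = 1) (hab : a * b = 1) (i j : Idx) :
    sder i (b * sder j a) - sder j (b * sder i a)
      + (b * sder i a * (b * sder j a) - b * sder j a * (b * sder i a)) = 0 := by
  rw [sder_mul, sder_mul, sder_inv hba hab, sder_inv hba hab, sder_comm i j]
  noncomm_ring

/-- The connection of `J`, in the algebra. -/
theorem toAlg_connOfJ (hJ : IsExpQ n W J) : (fun i => toAlg S W (connOfJ S J i)) =
    fun i => sih (Sum.elim (fun _ => 0)
      (fun α => toAlg S W (starInv S J) * sder (.inr α) (toAlg S W J)) i) := by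
  funext i
  cases i with
  | inl α =>
    change toAlg S W 0 = sih 0
    rw [toAlg_zero, sih, Deformation.ih_zero]
  | inr α =>
    change toAlg S W (mulIħ _) = sih _
    rw [toAlg_mulIħ (isA_logDeriv hJ _), toAlg_logDeriv hJ]
    rfl

-- Of the three self-duality equations two are automatic: the untilded components of the connection
-- are zero, and the tilded ones form a pure gauge. Because `A_α = 0`, the mixed curvature is `iħ
-- ∂_α(J⁻¹ * ∂_β̃ J)`, and its trace is Yang's expression up to an injective factor.
include hU hW hK in
theorem isSDYM_connOfJ_iff (hJ : IsExpQ n W J) :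
    IsSDYM S g W (connOfJ S J) ↔ IsYang S g W J := by
  rw [isSDYM_iff_alg hU hW hK (isA_connOfJ hJ), isYang_iff hW hK,
    eqOver_zero_iff (S := S) (isA_kahlerTrace hU hW hK fun _ _ => isA_d (isA_logDeriv hJ _) _),
    toAlg_kahlerTrace hU hW hK fun _ _ => isA_d (isA_logDeriv hJ _) _, toAlg_connOfJ hJ]
  simp only [scurv_sih, strace_sih, Sum.elim_inl, Sum.elim_inr, toAlg_d (isA_logDeriv hJ _),
    toAlg_logDeriv hJ]
  rw [pureGauge_flat (toAlg_starInv_mul hJ) (toAlg_mul_starInv hJ)]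
  simp only [map_zero, mul_zero, zero_mul, sub_zero, add_zero, sih, Deformation.ih_zero, true_and,
    and_true]
  refine ⟨fun h => Deformation.ih_injective (ι := iB W) ?_, fun h => ?_⟩
  · rw [h, Deformation.ih_zero]
  · rw [h, Deformation.ih_zero]

end Gauge

theorem IsQAlg.sub_one_inv {c c' : SAlg S W} (h : IsQAlg (c - 1)) (hc : c' * c = 1) :
    IsQAlg (c' - 1) := by
  have : c' - 1 = -c' * (c - 1) := by rw [neg_mul, mul_sub, hc]; noncomm_ring
  rw [this]
  exact isQAlg_mul_left h _

/-- `F_{wz} = 0` gives `c` with `∂c = c * a`, and transforming by `c` removes the untilded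
components. `F_{w̃z̃} = 0` gives `h` with `a = h⁻¹ * ∂̃h` in the tilded directions; transforming
this pure gauge by `c` replaces `h` by `J = h * c⁻¹`. -/
theorem exists_gauge_to_connOfJ {B Bt : Set (Fin 2 → ℂ)} (hBc : Convex ℝ B) (hBtc : Convex ℝ Bt)
    (hU : IsOpen U) (hK : g.IsKahler U) (hsub : B ×ˢ Bt ⊆ U)
    (hWV : ∀ q : P × Base, q ∈ W ↔ q.2 ∈ B ×ˢ Bt) {A : Idx → FSeries P}
    (hA : ∀ i, IsQ n W (A i).divIħ) (hs : IsSDYM S g W A) :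
    ∃ c J : FSeries P, IsExpQ n W c ∧ IsExpQ n W J ∧
      ∀ i, EqOver W (gaugeTransform S c A i) (connOfJ S J i) := by
  have hAA : ∀ i, IsA n W (A i) := fun i => by
    rw [← mulIħ_divIħ (A i)]; exact isA_mulIħ (hA i).toIsA
  set a : Idx → SAlg S W := fun i => toAlg S W (A i).divIħ with ha
  have hAa : (fun i => toAlg S W (A i)) = fun i => sih (a i) := by
    funext i
    rw [ha, ← toAlg_mulIħ (hA i).toIsA, mulIħ_divIħ]
  have haQ : ∀ i, IsQAlg (a i) := fun i => isQAlg_toAlg (hA i)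
  rw [isSDYM_iff_alg hU (fun q hq => hsub ((hWV q).1 hq)) hK hAA, hAa, scurv_sih, scurv_sih] at hs
  have hflat : ∀ d : Fin 2 → Idx,
      sih (sder (d 0) (a (d 1)) - sder (d 1) (a (d 0))
        + (a (d 0) * a (d 1) - a (d 1) * a (d 0))) = 0 →
      ∀ α β, sder (d β) (a (d α)) - sder (d α) (a (d β))
        + (a (d β) * a (d α) - a (d α) * a (d β)) = 0 := by
    intro d hd
    have h0 : sder (d 0) (a (d 1)) - sder (d 1) (a (d 0))
        + (a (d 0) * a (d 1) - a (d 1) * a (d 0)) = 0 :=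
      Deformation.ih_injective (ι := iB W) (hd.trans (Deformation.ih_zero _).symm)
    intro α β
    fin_cases α <;> fin_cases β
    · simp
    · rw [← neg_eq_zero, ← h0]; simp only [Fin.zero_eta, Fin.mk_one]; abel
    · exact h0
    · simp
  obtain ⟨b, hb⟩ := exists_center B
  obtain ⟨bt, hbt⟩ := exists_center Bt
  obtain ⟨c, hcQ, hc⟩ := (retractionLeft (Bt := Bt) hBc b hb).exists_gauge hWV
    (fun α => a (.inl α)) (fun α => haQ _) (hflat Sum.inl hs.1)
  obtain ⟨h, hhQ, hh⟩ := (retractionRight (B := B) hBtc bt hbt).exists_gauge hWV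
    (fun α => a (.inr α)) (fun α => haQ _) (hflat Sum.inr hs.2.2)
  have hC := isExpQ_ofAlg hcQ
  have hH := isExpQ_ofAlg hhQ
  have hc1 := toAlg_starInv_mul (S := S) hC
  have hc2 := toAlg_mul_starInv (S := S) hC
  have hh1 := toAlg_starInv_mul (S := S) hH
  rw [toAlg_ofAlg] at hc1 hc2 hh1
  set ci := toAlg S W (starInv S (ofAlg c)) with hci
  set hi := toAlg S W (starInv S (ofAlg h)) with hhi
  have hJQ : IsQAlg (h * ci - 1) := by
    have : h * ci - 1 = h * (ci - 1) + (h - 1) := by noncomm_ring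
    rw [this]
    exact isQAlg_add (isQAlg_mul_left (hcQ.sub_one_inv hc1) _) hhQ
  have hJ := isExpQ_ofAlg hJQ
  refine ⟨ofAlg c, ofAlg (h * ci), hC, hJ, fun i => ?_⟩
  have hi1 := isA_star (S := S) (isA_star (S := S) hC.toIsA (hAA i)) (isA_starInv (S := S) hC)
  have hi2 := isA_star (S := S) hC.toIsA (isA_d (isA_starInv (S := S) hC) i)
  have hgA : IsA n W (gaugeTransform S (ofAlg c) A i) := isA_add hi1 (isA_mulIħ hi2)
  have hgT : toAlg S W (gaugeTransform S (ofAlg c) A i) =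
      sih (c * a i * ci + c * sder i ci) := by
    rw [gaugeTransform, toAlg_add hi1 (isA_mulIħ hi2), toAlg_mulIħ hi2,
      toAlg_star (isA_star hC.toIsA (hAA i)) (isA_starInv hC), toAlg_star hC.toIsA (hAA i),
      toAlg_star hC.toIsA (isA_d (isA_starInv hC) i), toAlg_d (isA_starInv hC), toAlg_ofAlg,
      congrFun hAa i, ← hci]
    simp only [sih]
    rw [Deformation.mul_ih, Deformation.ih_mul, ← Deformation.ih_add]
  rw [← toAlg_eq_iff (S := S) hgA (isA_connOfJ hJ i), congrFun (toAlg_connOfJ hJ) i, hgT]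
  congr 1
  have hJinv : toAlg S W (starInv S (ofAlg (h * ci))) = c * hi := by
    have h1 := toAlg_starInv_mul (S := S) hJ
    rw [toAlg_ofAlg] at h1
    refine left_inv_eq_right_inv h1 ?_
    have hh2 := toAlg_mul_starInv (S := S) hH
    rw [toAlg_ofAlg] at hh2
    rw [mul_assoc, ← mul_assoc ci, hc1, one_mul, hh2]
  cases i with
  | inl α =>
    have h1 : sder (.inl α) c = c * a (.inl α) := hc α
    -- Here `c * ∂(c⁻¹) = -(∂c) * c⁻¹ = -c * a * c⁻¹`, which cancels the conjugated connection.
    rw [Sum.elim_inl, sder_inv hc1 hc2, h1]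
    calc _ = c * a (.inl α) * ci - (c * ci) * (c * a (.inl α)) * ci := by noncomm_ring
      _ = 0 := by rw [hc2, one_mul, sub_self]
  | inr α =>
    have h1 : sder (.inr α) h = h * a (.inr α) := hh α
    rw [Sum.elim_inr, hJinv, toAlg_ofAlg, sder_mul, h1]
    -- The two units mark where `h⁻¹ * h` is inserted to produce `(c * h⁻¹) * ∂̃(h * c⁻¹)`.
    calc _ = c * (1 * a (.inr α)) * ci + c * 1 * sder (.inr α) ci := by noncomm_ring
      _ = _ := by rw [← hh1]; noncomm_ring

end SDYM

end StarSDYM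

namespace StarSDYM

open TopologicalSpace (Opens)
open FSeries

/-! ### The master equation -/

theorem pd_comp_fst {f : (Fin 2 → ℂ) → ℂ} (p : Base) (α : Fin 2)
    (hf : DifferentiableAt ℂ (fun p : Base => f p.1) p) :
    pd (.inr α) (fun p => f p.1) p = 0 := by
  have h := fderiv_slice_right (F := fun p : Base => f p.1) hf (Pi.single α 1)
  simpa [pd, dirVec] using h

theorem pd_comp_snd {f : (Fin 2 → ℂ) → ℂ} (p : Base) (α : Fin 2)
    (hf : DifferentiableAt ℂ (fun p : Base => f p.2) p) :
    pd (.inl α) (fun p => f p.2) p = 0 := by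
  have h := fderiv_slice_left (F := fun p : Base => f p.2) hf (Pi.single α 1)
  simpa [pd, dirVec] using h

/-! ### Linear identities for `A[Θ]` when the determinant factors -/

section Factors

variable {g : Metric} {U : Set Base} {G Gt : (Fin 2 → ℂ) → ℂ}

theorem Metric.Factors.ne_zero (hF : g.Factors U G Gt) (hK : g.IsKahler U) {p : Base}
    (hp : p ∈ U) : G p.1 ≠ 0 ∧ Gt p.2 ≠ 0 := by
  have h := hK.nondegenerate p hp
  rw [hF p hp] at h
  exact mul_ne_zero_iff.1 h

/-- A factorization carries no regularity of its factors. Freezing the tilded coordinates at those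
of `p` gives, near `p`, `G = det(g) / G̃(p.2)`, which is holomorphic. -/
theorem Metric.Factors.differentiableOn_left (hF : g.Factors U G Gt) (hU : IsOpen U)
    (hK : g.IsKahler U) : DifferentiableOn ℂ (fun p : Base => G p.1) U := by
  intro p hp
  have hd : DifferentiableAt ℂ (fun p' : Base => (g.mat (p'.1, p.2)).det) p :=
    DifferentiableAt.comp (f := fun p' : Base => ((p'.1, p.2) : Base))
      (g := fun p => (g.mat p).det) p
      (hK.differentiableOn_det.differentiableAt (hU.mem_nhds hp)) (by fun_prop)
  have hc : Continuous fun p' : Base => ((p'.1, p.2) : Base) := by fun_prop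
  refine (DifferentiableAt.congr_of_eventuallyEq (hd.mul_const (Gt p.2)⁻¹)
    ?_).differentiableWithinAt
  filter_upwards [hc.continuousAt.preimage_mem_nhds (hU.mem_nhds hp)] with p' hp'
  rw [hF _ hp', mul_inv_cancel_right₀ (hF.ne_zero hK hp).2]

theorem Metric.Factors.differentiableOn_right (hF : g.Factors U G Gt) (hU : IsOpen U)
    (hK : g.IsKahler U) : DifferentiableOn ℂ (fun p : Base => Gt p.2) U := by
  intro p hp
  have hd : DifferentiableAt ℂ (fun p' : Base => (g.mat (p.1, p'.2)).det) p :=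
    DifferentiableAt.comp (f := fun p' : Base => ((p.1, p'.2) : Base))
      (g := fun p => (g.mat p).det) p
      (hK.differentiableOn_det.differentiableAt (hU.mem_nhds hp)) (by fun_prop)
  have hc : Continuous fun p' : Base => ((p.1, p'.2) : Base) := by fun_prop
  refine (DifferentiableAt.congr_of_eventuallyEq (hd.const_mul (G p.1)⁻¹)
    ?_).differentiableWithinAt
  filter_upwards [hc.continuousAt.preimage_mem_nhds (hU.mem_nhds hp)] with p' hp'
  rw [hF _ hp', inv_mul_cancel_left₀ (hF.ne_zero hK hp).1]

theorem Metric.Factors.differentiableOn_left_inv (hF : g.Factors U G Gt) (hU : IsOpen U)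
    (hK : g.IsKahler U) : DifferentiableOn ℂ (fun p : Base => (G p.1)⁻¹) U :=
  (hF.differentiableOn_left hU hK).inv fun _ hp => (hF.ne_zero hK hp).1

theorem Metric.Factors.differentiableOn_right_inv (hF : g.Factors U G Gt) (hU : IsOpen U)
    (hK : g.IsKahler U) : DifferentiableOn ℂ (fun p : Base => (Gt p.2)⁻¹) U :=
  (hF.differentiableOn_right hU hK).inv fun _ hp => (hF.ne_zero hK hp).2

/-- `(1/G) ε^{βγ} g_{γα̃} X_β`. -/
def lowered (g : Metric) (G : (Fin 2 → ℂ) → ℂ) (α : Fin 2) (X : Fin 2 → Base → ℂ) (p : Base) : ℂ :=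
  (G p.1)⁻¹ * (g 1 α p * X 0 p - g 0 α p * X 1 p)

variable (hU : IsOpen U) (hK : g.IsKahler U) (hF : g.Factors U G Gt) {V : Set Base}
  (hV : IsOpen V) (hVU : V ⊆ U) {θ : Base → ℂ} (hθ : DifferentiableOn ℂ θ V)

include hU hK hF hV hVU

theorem pd_lowered {X : Fin 2 → Base → ℂ} (hX : ∀ β, DifferentiableOn ℂ (X β) V) (i : Idx)
    (α : Fin 2) {p : Base} (hp : p ∈ V) :
    pd i (lowered g G α X) p = pd i (fun p => (G p.1)⁻¹) p * (g 1 α p * X 0 p - g 0 α p * X 1 p)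
      + (G p.1)⁻¹ * (pd i (g 1 α) p * X 0 p + g 1 α p * pd i (X 0) p
        - (pd i (g 0 α) p * X 1 p + g 0 α p * pd i (X 1) p)) := by
  have hg := fun β => hK.differentiableAt hU (hVU hp) β α
  have hx := fun β => (hX β).differentiableAt (hV.mem_nhds hp)
  have hG := (hF.differentiableOn_left_inv hU hK).differentiableAt (hU.mem_nhds (hVU hp))
  unfold lowered
  rw [pd_mul hG (((hg 1).fun_mul (hx 0)).fun_sub ((hg 0).fun_mul (hx 1))),
    pd_sub ((hg 1).fun_mul (hx 0)) ((hg 0).fun_mul (hx 1)), pd_mul (hg 1) (hx 0),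
    pd_mul (hg 0) (hx 1)]

include hθ

/-- The linear part of the curvature of `A[Θ]` is trace free. -/
theorem trace_lowered {p : Base} (hp : p ∈ V) :
    -(g 0 0 p * pd (.inl 1) (lowered g G 1 fun β => pd (.inl β) θ) p)
      + g 0 1 p * pd (.inl 1) (lowered g G 0 fun β => pd (.inl β) θ) p
      + g 1 0 p * pd (.inl 0) (lowered g G 1 fun β => pd (.inl β) θ) p
      - g 1 1 p * pd (.inl 0) (lowered g G 0 fun β => pd (.inl β) θ) p = 0 := by
  have hX : ∀ β : Fin 2, DifferentiableOn ℂ (pd (.inl β) θ) V := fun β =>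
    differentiableOn_pd hV hθ _
  have hUp := hU.mem_nhds (hVU hp)
  have hGi := (hF.differentiableOn_left_inv hU hK).differentiableAt hUp
  -- `det(g)/G` equals `G̃`, which does not depend on `(w, z)`. This relation cancels the
  -- derivatives of `1/G` against those of the metric in the trace.
  have hdet : ∀ α : Fin 2, pd (.inl α) (fun p => (G p.1)⁻¹) p * (g.mat p).det
      + (G p.1)⁻¹ * pd (.inl α) (fun p => (g.mat p).det) p = 0 := by
    intro α
    rw [← pd_mul hGi (hK.differentiableOn_det.differentiableAt hUp)]
    rw [pd_congr hU (f := fun p => (G p.1)⁻¹ * (g.mat p).det) (h := fun p => Gt p.2)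
      (fun p hp => by
        change _ * _ = _
        rw [hF p hp, inv_mul_cancel_left₀ (hF.ne_zero hK hp).1]) (hVU hp)]
    exact pd_comp_snd p α ((hF.differentiableOn_right hU hK).differentiableAt hUp)
  have h0 := hdet 0
  have h1 := hdet 1
  rw [hK.pd_det hU (hVU hp), g.det_mat] at h0 h1
  simp only [pd_lowered hU hK hF hV hVU hX _ _ hp]
  rw [pd_comm hV hθ hp (.inl 1) (.inl 0)]
  rw [hK.closed_left p (hVU hp) 0 1 0, hK.closed_left p (hVU hp) 0 1 1] at h1 ⊢
  linear_combination pd (.inl 1) θ p * h0 - pd (.inl 0) θ p * h1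

/-- The linear part of the curvature of `A[Θ]`. -/
theorem curl_lowered {p : Base} (hp : p ∈ V) :
    pd (.inr 0) (lowered g G 1 fun β => pd (.inl β) θ) p
      - pd (.inr 1) (lowered g G 0 fun β => pd (.inl β) θ) p =
    Gt p.2 * ∑ β, ∑ α, g.inv β α p * pd (.inr β) (pd (.inl α) θ) p := by
  have hX : ∀ β : Fin 2, DifferentiableOn ℂ (pd (.inl β) θ) V := fun β =>
    differentiableOn_pd hV hθ _
  have hUp := hU.mem_nhds (hVU hp)
  have hGi := (hF.differentiableOn_left_inv hU hK).differentiableAt hUp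
  simp only [pd_lowered hU hK hF hV hVU hX _ _ hp]
  -- Tilded derivatives do not see `G`, and the Kähler condition cancels the derivatives of the
  -- metric. Only second derivatives of `θ` remain, with adjugate coefficients over `G`, and `det(g)
  -- = G G̃` turns these into `G̃` times the inverse metric.
  rw [pd_comp_fst (f := fun w => (G w)⁻¹) p 0 hGi, pd_comp_fst (f := fun w => (G w)⁻¹) p 1 hGi,
    hK.closed_right p (hVU hp) 0 1 0, hK.closed_right p (hVU hp) 1 1 0]
  obtain ⟨h00, h01, h10, h11⟩ := g.inv_apply p
  obtain ⟨hG0, hGt0⟩ := hF.ne_zero hK (hVU hp)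
  simp only [Fin.sum_univ_two, h00, h01, h10, h11, hF p (hVU hp)]
  field_simp
  ring

end Factors

/-! ### The curvature of `A[Θ]` and the master equation -/

section Master

variable {n : ℕ} {P : Type*} [TopologicalSpace P] [ChartedSpace (Phase n) P]
  [IsManifold 𝓘(ℂ, Phase n) ω P] {Ω : SymplecticForm n P} {S : StarProduct Ω}
  {W : Opens (P × Base)} {g : Metric} {U : Set Base} {G Gt : (Fin 2 → ℂ) → ℂ}
  (hU : IsOpen U) (hW : ∀ q ∈ W, q.2 ∈ U) (hK : g.IsKahler U) (hF : g.Factors U G Gt)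
  {Θ : FSeries P}

/-- The slice of an open set over a point of the phase space. -/
def slice (W : Opens (P × Base)) (x : P) : Set Base := {p | (x, p) ∈ W}

theorem isOpen_slice (W : Opens (P × Base)) (x : P) : IsOpen (slice W x) :=
  W.isOpen.preimage (by fun_prop : Continuous fun p : Base => (x, p))

theorem differentiableOn_slice {F : P × Base → ℂ} (hF : Hol n F W) (x : P) :
    DifferentiableOn ℂ (fun p => F (x, p)) (slice W x) := fun _ hp =>
  (Hol.differentiableAt_base W.isOpen hF hp).differentiableWithinAt

theorem connOfTheta_inr (α : Fin 2) (m : ℕ) (k : ℤ) (q : P × Base) :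
    connOfTheta g G Θ (.inr α) m k q =
      lowered g G α (fun β => pd (.inl β) fun p => Θ m k (q.1, p)) q.2 := by
  refine congrArg (fun z => (G q.2.1)⁻¹ * z) ?_
  simp only [eps, Fin.sum_univ_two, FSeries.d]
  simp
  ring

include hU hK hF in
theorem differentiableOn_coeff (β α : Fin 2) :
    DifferentiableOn ℂ (fun p : Base => (G p.1)⁻¹ * g β α p) U :=
  (hF.differentiableOn_left_inv hU hK).mul (hK.holomorphic β α)

/-- The coefficients `g_{βα̃}/G`. -/
def coeffB (β α : Fin 2) : BaseFun n W := baseFun hU hW _ (differentiableOn_coeff hU hK hF β α)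

theorem connOfTheta_inr_eq (α : Fin 2) : connOfTheta g G Θ (.inr α) =
    bmul (coeffB (n := n) hU hW hK hF 1 α).1 (Θ.d (.inl 0))
      - bmul (coeffB (n := n) hU hW hK hF 0 α).1 (Θ.d (.inl 1)) := by
  funext m k q
  rw [connOfTheta_inr]
  simp only [lowered, bmul, coeffB, baseFun, Pi.sub_apply, FSeries.d]
  ring

include hU hW hK hF in
theorem isA_connOfTheta (hΘ : IsA n W Θ) (i : Idx) : IsA n W (connOfTheta g G Θ i) := by
  cases i with
  | inl α => exact isA_zero
  | inr α =>
    rw [connOfTheta_inr_eq (n := n) hU hW hK hF]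
    exact isA_sub (isA_bmul _ (isA_d hΘ _)) (isA_bmul _ (isA_d hΘ _))

theorem toAlg_connOfTheta (hΘ : IsA n W Θ) (α : Fin 2) :
    toAlg S W (connOfTheta g G Θ (.inr α)) =
      coeffB (n := n) hU hW hK hF 1 α • sder (.inl 0) (toAlg S W Θ)
        - coeffB (n := n) hU hW hK hF 0 α • sder (.inl 1) (toAlg S W Θ) := by
  rw [connOfTheta_inr_eq (n := n) hU hW hK hF, toAlg_sub (isA_bmul _ (isA_d hΘ _))
    (isA_bmul _ (isA_d hΘ _)), toAlg_bmul _ (isA_d hΘ _), toAlg_bmul _ (isA_d hΘ _),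
    toAlg_d hΘ, toAlg_d hΘ]

theorem d_connOfTheta (i : Idx) (α : Fin 2) (m : ℕ) (k : ℤ) (q : P × Base) :
    (connOfTheta g G Θ (.inr α)).d i m k q =
      pd i (lowered g G α (fun β => pd (.inl β) fun p => Θ m k (q.1, p))) q.2 := by
  rw [FSeries.d]
  congr 1
  funext p
  exact connOfTheta_inr α m k (q.1, p)

theorem bracket_self (A : FSeries P) : bracket S A A = 0 := by
  rw [bracket, sub_self]
  funext m k q
  exact mul_zero _

theorem bracket_swap (A B : FSeries P) : bracket S B A = -bracket S A B := by
  funext m k q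
  simp only [bracket, divIħ, Pi.neg_apply, Pi.sub_apply]
  ring

-- Both components are combinations of `∂_wΘ` and `∂_zΘ` with coefficients from the base.
-- Bilinearity over the base and antisymmetry leave the determinant of the coefficients, which is
-- `det(g)/G² = G̃/G`.
include hU hW hK hF in
theorem bracket_connOfTheta (hΘ : IsA n W Θ) (m : ℕ) (k : ℤ) {q : P × Base} (hq : q ∈ W) :
    bracket S (connOfTheta g G Θ (.inr 0)) (connOfTheta g G Θ (.inr 1)) m k q =
      Gt q.2.2 * ((G q.2.1)⁻¹ * bracket S (Θ.d (.inl 0)) (Θ.d (.inl 1)) m k q) := by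
  set c : Fin 2 → Fin 2 → BaseFun n W := fun β α => coeffB hU hW hK hF β α with hc
  have hA := fun i => isA_connOfTheta (n := n) (W := W) hU hW hK hF hΘ i
  have hb := isA_bracket (S := S) (isA_d hΘ (.inl 0)) (isA_d hΘ (.inl 1))
  have h : EqOver W (bracket S (connOfTheta g G Θ (.inr 0)) (connOfTheta g G Θ (.inr 1)))
      (bmul (c 0 0 * c 1 1 - c 1 0 * c 0 1).1 (bracket S (Θ.d (.inl 0)) (Θ.d (.inl 1)))) := by
    rw [← toAlg_eq_iff (S := S) (isA_bracket (hA _) (hA _)) (isA_bmul _ hb),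
      toAlg_bracket (hA _) (hA _), toAlg_connOfTheta hU hW hK hF hΘ,
      toAlg_connOfTheta hU hW hK hF hΘ, toAlg_bmul _ hb, toAlg_bracket (isA_d hΘ _) (isA_d hΘ _),
      toAlg_d hΘ, toAlg_d hΘ]
    set x := sder (.inl 0) (toAlg S W Θ)
    set y := sder (.inl 1) (toAlg S W Θ)
    rw [sub_eq_add_neg, sub_eq_add_neg, ← neg_smul, ← neg_smul]
    simp only [sbr, Deformation.br_add_left, Deformation.br_add_right, Deformation.br_smul_left,
      Deformation.br_smul_right, Deformation.br_self, Deformation.br_swap x y]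
    module
  rw [h m k q hq]
  have hd := hF q.2 (hW q hq)
  obtain ⟨hG0, -⟩ := hF.ne_zero hK (hW q hq)
  rw [g.det_mat] at hd
  change ((G q.2.1)⁻¹ * g 0 0 q.2 * ((G q.2.1)⁻¹ * g 1 1 q.2)
    - (G q.2.1)⁻¹ * g 1 0 q.2 * ((G q.2.1)⁻¹ * g 0 1 q.2)) * _ = _
  field_simp
  linear_combination bracket S (Θ.d (.inl 0)) (Θ.d (.inl 1)) m k q * hd

theorem masterExpr_apply (m : ℕ) (k : ℤ) (q : P × Base) :
    masterExpr S g G Θ m k q =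
      (∑ β, ∑ α, g.inv β α q.2 * pd (.inr β) (pd (.inl α) fun p => Θ m k (q.1, p)) q.2)
        + (G q.2.1)⁻¹ * bracket S (Θ.d (.inl 0)) (Θ.d (.inl 1)) m k q := by
  rw [masterExpr]
  congr 1
  simp only [Fin.sum_univ_two, eps, bracket_self, bracket_swap (Θ.d (.inl 0)) (Θ.d (.inl 1)),
    Pi.neg_apply]
  simp
  ring

include hU hW hK hF in
/-- The curvature of `A[Θ]`. -/
theorem curvatureForm_connOfTheta (hΘ : IsA n W Θ) (m : ℕ) (k : ℤ) {q : P × Base} (hq : q ∈ W) :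
    curvatureForm S (connOfTheta g G Θ) (.inr 0) (.inr 1) m k q =
      Gt q.2.2 * masterExpr S g G Θ m k q := by
  rw [masterExpr_apply, mul_add, ← bracket_connOfTheta (n := n) hU hW hK hF hΘ m k hq]
  have hVU : slice W q.1 ∩ U ⊆ U := inter_subset_right
  rw [← curl_lowered (V := slice W q.1 ∩ U) hU hK hF ((isOpen_slice W q.1).inter hU) hVU
    ((differentiableOn_slice (hΘ.holomorphic m k) q.1).mono inter_subset_left)
    ⟨hq, hW q hq⟩, ← d_connOfTheta, ← d_connOfTheta]
  rfl

-- With `A_α = 0` the untilded curvature vanishes and the mixed curvature is the linear expression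
-- `∂_α A_β̃`, whose trace is zero by `trace_lowered`. What remains is `F_{w̃z̃}`, equal to the
-- master expression times the nonvanishing `G̃`.
include hU hW hK hF in
theorem isSDYM_connOfTheta_iff (hΘ : IsA n W Θ) :
    IsSDYM S g W (connOfTheta g G Θ) ↔ IsMaster S g G W Θ := by
  have hA := fun i => isA_connOfTheta (n := n) (W := W) hU hW hK hF hΘ i
  have h0 : ∀ m k, ∀ q ∈ W,
      curvatureForm S (connOfTheta g G Θ) (.inl 0) (.inl 1) m k q = 0 := by
    refine (eqOver_zero_iff (S := S) (isA_curvatureForm hA _ _)).2 ?_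
    rw [toAlg_curvatureForm hA, scurv]
    change sder _ (toAlg S W 0) - sder _ (toAlg S W 0) + sbr (toAlg S W 0) (toAlg S W 0) = 0
    rw [toAlg_zero, sbr, Deformation.br_zero_left, map_zero, map_zero, sub_zero, add_zero]
  have h1 : ∀ α β m k, ∀ q ∈ W, curvatureForm S (connOfTheta g G Θ) (.inl α) (.inr β) m k q =
      (connOfTheta g G Θ (.inr β)).d (.inl α) m k q := by
    intro α β
    refine (toAlg_eq_iff (S := S) (isA_curvatureForm hA _ _) (isA_d (hA _) _)).1 ?_
    rw [toAlg_curvatureForm hA, scurv, toAlg_d (hA _)]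
    change _ - sder _ (toAlg S W 0) + sbr (toAlg S W 0) _ = _
    rw [toAlg_zero, sbr, Deformation.br_zero_left, map_zero, sub_zero, add_zero]
  rw [isSDYM_iff]
  constructor
  · intro h m k q hq
    have h2 := h.2.2 m k q hq
    rw [curvatureForm_connOfTheta (n := n) hU hW hK hF hΘ m k hq] at h2
    exact (mul_eq_zero.1 h2).resolve_left (hF.ne_zero hK (hW q hq)).2
  · intro h
    refine ⟨h0, fun m k q hq => ?_, fun m k q hq => ?_⟩
    · simp only [kahlerTrace, h1 _ _ m k q hq, d_connOfTheta]
      exact trace_lowered (V := slice W q.1 ∩ U) hU hK hF ((isOpen_slice W q.1).inter hU)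
        inter_subset_right ((differentiableOn_slice (hΘ.holomorphic m k) q.1).mono
          inter_subset_left) ⟨hq, hW q hq⟩
    · rw [curvatureForm_connOfTheta (n := n) hU hW hK hF hΘ m k hq, h m k q hq]
      exact mul_zero _

include hU hW hK hF in
theorem connOfTheta_mulIħ (hΘ : IsA n W Θ) (α : Fin 2) :
    toAlg S W (connOfTheta g G (mulIħ Θ) (.inr α)) =
      sih (toAlg S W (connOfTheta g G Θ (.inr α))) := by
  rw [toAlg_connOfTheta hU hW hK hF hΘ, toAlg_connOfTheta hU hW hK hF (isA_mulIħ hΘ),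
    toAlg_mulIħ hΘ, sder_sih, sder_sih]
  simp only [sih, Deformation.ih_sub, Deformation.ih_smul]

/-! ### The correspondence between `J` and `Θ` on a patch -/

section Patch

variable {B Bt : Set (Fin 2 → ℂ)} (hBc : Convex ℝ B) (hBtc : Convex ℝ Bt) (hsub : B ×ˢ Bt ⊆ U)
  (hWV : ∀ q : P × Base, q ∈ W ↔ q.2 ∈ B ×ˢ Bt)

include hBc hU hK hF hsub hWV

/-- Put `b = J⁻¹ * ∂̃J` and solve `iħ b = A[Θ]` for the first derivatives of `Θ`. With `Θ = iħ f`
they must be `∂_α f = r_α = (g_{α0̃} b_1 - g_{α1̃} b_0)/G̃`. Yang's equation is exactly the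
closedness of `r` in `(w, z)`, so the Poincaré lemma provides `f`. -/
theorem exists_theta {J : FSeries P} (hJ : IsExpQ n W J) (hY : IsYang S g W J) :
    ∃ Θ : FSeries P, IsQ n W Θ.divIħ ∧
      (∀ i, EqOver W (connOfJ S J i) (connOfTheta g G Θ i)) := by
  have hW : ∀ q ∈ W, q.2 ∈ U := fun q hq => hsub ((hWV q).1 hq)
  set b : Fin 2 → SAlg S W := fun β => toAlg S W (starInv S J) * sder (.inr β) (toAlg S W J) with hb
  have hbQ : ∀ β, IsQAlg (b β) := fun β => by
    rw [hb]
    dsimp only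
    rw [← toAlg_logDeriv hJ]
    exact isQAlg_toAlg (isQ_logDeriv hJ _)
  have htr : strace hU hW hK (fun α β => sder (.inl α) (b β)) = 0 := by
    rw [isYang_iff hW hK, eqOver_zero_iff (S := S)
      (isA_kahlerTrace hU hW hK fun _ _ => isA_d (isA_logDeriv hJ _) _),
      toAlg_kahlerTrace hU hW hK fun _ _ => isA_d (isA_logDeriv hJ _) _] at hY
    simpa only [toAlg_d (isA_logDeriv hJ _), toAlg_logDeriv hJ] using hY
  set Gi : BaseFun n W := baseFun hU hW (fun p => (Gt p.2)⁻¹) (hF.differentiableOn_right_inv hU hK)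
    with hGi
  set γ : Fin 2 → Fin 2 → BaseFun n W := fun α β => metricB hU hW hK α β with hγ
  have hdg : ∀ α β, DifferentiableOn ℂ (fun p : Base => (Gt p.2)⁻¹ * g α β p) U := fun α β =>
    (hF.differentiableOn_right_inv hU hK).mul (hK.holomorphic α β)
  have hpd : ∀ α β δ, DifferentiableOn ℂ (fun p : Base => (Gt p.2)⁻¹ * pd (.inl δ) (g α β) p) U :=
    fun α β δ => (hF.differentiableOn_right_inv hU hK).mul
      (differentiableOn_pd hU (hK.holomorphic α β) _)
  set d : Fin 2 → Fin 2 → Fin 2 → BaseFun n W := fun α β δ =>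
    baseFun hU hW _ (hpd α β δ) with hd
  have hder : ∀ α β δ (x : SAlg S W), sder (.inl δ) ((Gi * γ α β) • x) =
      d α β δ • x + (Gi * γ α β) • sder (.inl δ) x := by
    intro α β δ x
    refine sder_smul _ _ _ _ fun q hq => ?_
    have hUq := hU.mem_nhds (hW q hq)
    have h1 := (hF.differentiableOn_right_inv hU hK).differentiableAt hUq
    change (Gt q.2.2)⁻¹ * pd (.inl δ) (g α β) q.2 = pd _ (fun p => (Gt p.2)⁻¹ * g α β p) q.2
    rw [pd_mul h1 ((hK.holomorphic α β).differentiableAt hUq),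
      pd_comp_snd (f := fun w => (Gt w)⁻¹) _ _ h1, zero_mul, zero_add]
  -- The terms of the curl of `r` in which the metric is differentiated cancel by `dΩ = 0`.
  have hdd : ∀ β (x : SAlg S W), d 0 β 1 • x = d 1 β 0 • x := fun β x =>
    smul_eq_smul _ fun q hq => by
      change _ * pd _ _ _ = _ * pd _ _ _
      rw [hK.closed_left q.2 (hW q hq) 0 1 β]
  set r : Fin 2 → SAlg S W := fun α => (Gi * γ α 0) • b 1 - (Gi * γ α 1) • b 0 with hr
  have hcl : sder (.inl 1) (r 0) = sder (.inl 0) (r 1) := by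
    rw [hr]
    simp only [map_sub, hder, hdd]
    rw [← sub_eq_zero]
    rw [strace] at htr
    change γ 0 1 • sder (.inl 1) (b 0) + γ 1 0 • sder (.inl 0) (b 1)
      - γ 0 0 • sder (.inl 1) (b 1) - γ 1 1 • sder (.inl 0) (b 0) = 0 at htr
    have h2 : Gi • (γ 0 1 • sder (.inl 1) (b 0) + γ 1 0 • sder (.inl 0) (b 1)
      - γ 0 0 • sder (.inl 1) (b 1) - γ 1 1 • sder (.inl 0) (b 0)) = 0 := by rw [htr, smul_zero]
    rw [← neg_eq_zero, ← h2]
    module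
  obtain ⟨b₀, hb₀⟩ := exists_center B
  obtain ⟨f, hf, hfQ⟩ := (retractionLeft (Bt := Bt) hBc b₀ hb₀).exists_primitive_alg hWV r
    (fun α β => by
      fin_cases α <;> fin_cases β
      · rfl
      · exact hcl
      · exact hcl.symm
      · rfl)
  have hfQ := hfQ fun α => isQAlg_sub (isQAlg_smul _ (hbQ _)) (isQAlg_smul _ (hbQ _))
  have hf0 : sder (.inl 0) f = r 0 := hf 0
  have hf1 : sder (.inl 1) f = r 1 := hf 1
  have hfA : IsA n W (ofAlg f) := isA_ofAlg f
  refine ⟨mulIħ (ofAlg f), ?_, fun i => ?_⟩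
  · rw [divIħ_mulIħ]
    exact isQ_ofAlg hfQ
  have hA := isA_connOfTheta (n := n) (W := W) hU hW hK hF (isA_mulIħ hfA) i
  cases i with
  | inl α => exact fun m k q _ => rfl
  | inr α =>
    rw [← toAlg_eq_iff (S := S) (isA_connOfJ hJ _) hA, congrFun (toAlg_connOfJ hJ) (.inr α),
      connOfTheta_mulIħ hU hW hK hF hfA, toAlg_connOfTheta hU hW hK hF hfA, toAlg_ofAlg, hf0, hf1]
    congr 1
    change b α = _
    -- Substituting `r` back into `A[Θ]` multiplies `b` by the adjugate identity, hence by
    -- `det(g)/(G G̃) = 1`.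
    have hscal : ∀ q ∈ W, (Gt q.2.2)⁻¹ * (G q.2.1)⁻¹ * (g 0 0 q.2 * g 1 1 q.2
        - g 0 1 q.2 * g 1 0 q.2) = 1 := fun q hq => by
      have h1 := hF q.2 (hW q hq)
      obtain ⟨hG0, hGt0⟩ := hF.ne_zero hK (hW q hq)
      rw [← g.det_mat, h1]
      field_simp
    set κ : Fin 2 → Fin 2 → BaseFun n W := fun β α => coeffB hU hW hK hF β α with hκ
    have h1 : κ 1 α • r 0 - κ 0 α • r 1 = (Gi * (κ 1 α * γ 0 0 - κ 0 α * γ 1 0)) • b 1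
        + (Gi * (κ 0 α * γ 1 1 - κ 1 α * γ 0 1)) • b 0 := by
      rw [hr]
      module
    refine Eq.trans ?_ h1.symm
    fin_cases α
    · have e1 : (Gi * (κ 1 0 * γ 0 0 - κ 0 0 * γ 1 0)) • b 1 = (0 : BaseFun n W) • b 1 :=
        smul_eq_smul _ fun q hq => by
          change (Gt q.2.2)⁻¹ * ((G q.2.1)⁻¹ * g 1 0 q.2 * g 0 0 q.2
            - (G q.2.1)⁻¹ * g 0 0 q.2 * g 1 0 q.2) = 0
          ring
      have e2 : (Gi * (κ 0 0 * γ 1 1 - κ 1 0 * γ 0 1)) • b 0 = (1 : BaseFun n W) • b 0 :=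
        smul_eq_smul _ fun q hq => by
          refine Eq.trans ?_ (hscal q hq)
          change (Gt q.2.2)⁻¹ * ((G q.2.1)⁻¹ * g 0 0 q.2 * g 1 1 q.2
            - (G q.2.1)⁻¹ * g 1 0 q.2 * g 0 1 q.2) = _
          ring
      simp only [Fin.zero_eta]
      rw [e1, e2, zero_smul, one_smul, zero_add]
    · have e1 : (Gi * (κ 1 1 * γ 0 0 - κ 0 1 * γ 1 0)) • b 1 = (1 : BaseFun n W) • b 1 :=
        smul_eq_smul _ fun q hq => by
          refine Eq.trans ?_ (hscal q hq)
          change (Gt q.2.2)⁻¹ * ((G q.2.1)⁻¹ * g 1 1 q.2 * g 0 0 q.2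
            - (G q.2.1)⁻¹ * g 0 1 q.2 * g 1 0 q.2) = _
          ring
      have e2 : (Gi * (κ 0 1 * γ 1 1 - κ 1 1 * γ 0 1)) • b 0 = (0 : BaseFun n W) • b 0 :=
        smul_eq_smul _ fun q hq => by
          change (Gt q.2.2)⁻¹ * ((G q.2.1)⁻¹ * g 0 1 q.2 * g 1 1 q.2
            - (G q.2.1)⁻¹ * g 1 1 q.2 * g 0 1 q.2) = 0
          ring
      simp only [Fin.mk_one]
      rw [e1, e2, zero_smul, one_smul, add_zero]

/-- Yang's equation for `J` and the master equation for `Θ` are both the SDYM equations, for one and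
the same connection. -/
theorem isYang_iff_exists_theta {J : FSeries P} (hJ : IsExpQ n W J) :
    IsYang S g W J ↔ ∃ Θ : FSeries P, IsQ n W Θ.divIħ ∧
      (∀ i, EqOver W (connOfJ S J i) (connOfTheta g G Θ i)) ∧ IsMaster S g G W Θ := by
  have hW : ∀ q ∈ W, q.2 ∈ U := fun q hq => hsub ((hWV q).1 hq)
  have hA : ∀ {Θ : FSeries P}, IsQ n W Θ.divIħ → IsA n W Θ := fun {Θ} h => by
    rw [← mulIħ_divIħ Θ]; exact isA_mulIħ h.toIsA
  constructor
  · intro hY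
    obtain ⟨Θ, hΘ, he⟩ := exists_theta hU hK hF hBc hsub hWV hJ hY
    exact ⟨Θ, hΘ, he, (isSDYM_connOfTheta_iff hU hW hK hF (hA hΘ)).1
      (((isSDYM_connOfJ_iff hU hW hK hJ).2 hY).congr (isA_connOfJ hJ) he)⟩
  · rintro ⟨Θ, hΘ, he, hM⟩
    exact (isSDYM_connOfJ_iff hU hW hK hJ).1
      (((isSDYM_connOfTheta_iff hU hW hK hF (hA hΘ)).2 hM).congr
        (isA_connOfTheta hU hW hK hF (hA hΘ)) fun i m k q hq => (he i m k q hq).symm)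

include hBtc

/-- The master equation makes `A[Θ]` flat along `(w̃, z̃)`, and a solution `h` of `∂̃h = h * a` is
the required `J`. -/
theorem isMaster_iff_exists_J {Θ : FSeries P} (hΘ : IsQ n W Θ.divIħ) :
    IsMaster S g G W Θ ↔ ∃ J : FSeries P, IsExpQ n W J ∧
      (∀ i, EqOver W (connOfJ S J i) (connOfTheta g G Θ i)) ∧ IsYang S g W J := by
  have hW : ∀ q ∈ W, q.2 ∈ U := fun q hq => hsub ((hWV q).1 hq)
  have hA : IsA n W Θ := by rw [← mulIħ_divIħ Θ]; exact isA_mulIħ hΘ.toIsA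
  have hAc := isA_connOfTheta (n := n) (W := W) hU hW hK hF hA
  constructor
  · intro hM
    have hs := (isSDYM_connOfTheta_iff hU hW hK hF hA).2 hM
    set a : Idx → SAlg S W := fun i => toAlg S W (connOfTheta g G Θ.divIħ i) with ha
    have hAa : (fun i => toAlg S W (connOfTheta g G Θ i)) = fun i => sih (a i) := by
      funext i
      cases i with
      | inl α =>
        change toAlg S W 0 = sih (toAlg S W 0)
        rw [toAlg_zero, sih, Deformation.ih_zero]
      | inr α =>
        rw [ha, ← connOfTheta_mulIħ hU hW hK hF hΘ.toIsA, mulIħ_divIħ]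
    have haQ : ∀ α, IsQAlg (a (.inr α)) := fun α => by
      have hq := isQAlg_toAlg (S := S) hΘ
      rw [ha]
      dsimp only
      rw [toAlg_connOfTheta hU hW hK hF hΘ.toIsA]
      exact isQAlg_sub (isQAlg_smul _ (isQAlg_sder hq _)) (isQAlg_smul _ (isQAlg_sder hq _))
    have h0 := ((isSDYM_iff_alg hU hW hK hAc).1 hs).2.2
    rw [hAa, scurv_sih] at h0
    replace h0 := Deformation.ih_injective (ι := iB W) (h0.trans (Deformation.ih_zero _).symm)
    obtain ⟨bt, hbt⟩ := exists_center Bt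
    obtain ⟨h, hhQ, hh⟩ := (retractionRight (B := B) hBtc bt hbt).exists_gauge hWV
      (fun α => a (.inr α)) haQ (fun α β => by
        change sder (.inr β) (a (.inr α)) - sder (.inr α) (a (.inr β))
          + (a (.inr β) * a (.inr α) - a (.inr α) * a (.inr β)) = 0
        fin_cases α <;> fin_cases β
        · simp
        · rw [← neg_eq_zero, ← h0]; simp only [Fin.zero_eta, Fin.mk_one]; abel
        · exact h0
        · simp)
    have hJ := isExpQ_ofAlg hhQ
    have he : ∀ i, EqOver W (connOfJ S (ofAlg h) i) (connOfTheta g G Θ i) := by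
      intro i
      rw [← toAlg_eq_iff (S := S) (isA_connOfJ hJ i) (hAc i), congrFun hAa i,
        congrFun (toAlg_connOfJ hJ) i]
      congr 1
      cases i with
      | inl α =>
        change 0 = toAlg S W 0
        rw [toAlg_zero]
      | inr α =>
        have h1 : sder (.inr α) h = h * a (.inr α) := hh α
        have h2 := toAlg_starInv_mul (S := S) hJ
        rw [toAlg_ofAlg] at h2
        rw [Sum.elim_inr, toAlg_ofAlg, h1, ← mul_assoc, h2, one_mul]
    exact ⟨ofAlg h, hJ, he, (isSDYM_connOfJ_iff hU hW hK hJ).1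
      (hs.congr hAc fun i m k q hq => (he i m k q hq).symm)⟩
  · rintro ⟨J, hJ, he, hY⟩
    exact (isSDYM_connOfTheta_iff hU hW hK hF hA).1
      (((isSDYM_connOfJ_iff hU hW hK hJ).2 hY).congr (isA_connOfJ hJ) he)

end Patch

end Master

end StarSDYM

namespace StarSDYM

/-! ### The top power of a nondegenerate alternating form -/

section Pfaffian

variable {V : Type*} [AddCommGroup V] [Module ℂ V]

/-- The product of the values of a bilinear form on pairs of vectors. -/
def pairProd (B : V →ₗ[ℂ] V →ₗ[ℂ] ℂ) (n : ℕ) :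
    MultilinearMap ℂ (fun _ : Fin n × Fin 2 => V) ℂ where
  toFun v := ∏ i, B (v (i, 0)) (v (i, 1))
  map_update_add' {_} v j x y := by
    obtain ⟨i, b⟩ := j
    have h : ∀ z, ∏ k, B (Function.update v (i, b) z (k, 0)) (Function.update v (i, b) z (k, 1)) =
        B (Function.update v (i, b) z (i, 0)) (Function.update v (i, b) z (i, 1)) *
          ∏ k ∈ Finset.univ.erase i, B (v (k, 0)) (v (k, 1)) := by
      intro z
      rw [← Finset.mul_prod_erase _ _ (Finset.mem_univ i)]
      congr 1
      refine Finset.prod_congr rfl fun k hk => ?_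
      have hk : k ≠ i := Finset.ne_of_mem_erase hk
      rw [Function.update_of_ne (by simp [hk]), Function.update_of_ne (by simp [hk])]
    convert (?_ : _ = _) using 1
    rw [h x, h y, ← add_mul]
    refine (h (x + y)).trans ?_
    congr 1
    fin_cases b <;> simp [Function.update_of_ne]
  map_update_smul' {_} v j c x := by
    obtain ⟨i, b⟩ := j
    have h : ∀ z, ∏ k, B (Function.update v (i, b) z (k, 0)) (Function.update v (i, b) z (k, 1)) =
        B (Function.update v (i, b) z (i, 0)) (Function.update v (i, b) z (i, 1)) *
          ∏ k ∈ Finset.univ.erase i, B (v (k, 0)) (v (k, 1)) := by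
      intro z
      rw [← Finset.mul_prod_erase _ _ (Finset.mem_univ i)]
      congr 1
      refine Finset.prod_congr rfl fun k hk => ?_
      have hk : k ≠ i := Finset.ne_of_mem_erase hk
      rw [Function.update_of_ne (by simp [hk]), Function.update_of_ne (by simp [hk])]
    convert (?_ : _ = _) using 1
    rw [h x, smul_eq_mul, ← mul_assoc]
    refine (h (c • x)).trans ?_
    congr 1
    fin_cases b <;> simp [Function.update_of_ne]

/-- The standard symplectic pairing of the indices of a symplectic family. -/
def stdPair {n : ℕ} (a b : Fin n × Fin 2) : ℂ :=
  if a.1 = b.1 then (if a.2 = 0 ∧ b.2 = 1 then 1 else if a.2 = 1 ∧ b.2 = 0 then -1 else 0) else 0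

/-- The terms of the Pfaffian of the standard pairing are `0` or `1`. -/
theorem sign_mul_prod_stdPair {n : ℕ} (σ : Equiv.Perm (Fin n × Fin 2))
    (h : ∀ i, stdPair (σ (i, 0)) (σ (i, 1)) ≠ 0) :
    ((Equiv.Perm.sign σ : ℤ) : ℂ) * ∏ i, stdPair (σ (i, 0)) (σ (i, 1)) = 1 := by
  have h1 : ∀ i, (σ (i, 0)).1 = (σ (i, 1)).1 := fun i => by
    by_contra hne
    exact h i (by simp [stdPair, hne])
  have hb : ∀ i, ((σ (i, 0)).2 = 0 ∧ (σ (i, 1)).2 = 1) ∨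
      ((σ (i, 0)).2 = 1 ∧ (σ (i, 1)).2 = 0) := fun i => by
    by_contra hne
    push Not at hne
    refine h i ?_
    rw [stdPair, if_pos (h1 i), if_neg (fun hh => hne.1 hh.1 hh.2),
      if_neg (fun hh => hne.2 hh.1 hh.2)]
  let f : Fin n → Equiv.Perm (Fin 2) := fun i => if (σ (i, 0)).2 = 0 then 1 else Equiv.swap 0 1
  have hf : ∀ i b, f i b = (σ (i, b)).2 := by
    intro i b
    rcases hb i with ⟨h0, h1⟩ | ⟨h0, h1⟩ <;> fin_cases b <;> simp [f, h0, h1]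
  have hfst : ∀ i b, (σ (i, b)).1 = (σ (i, 0)).1 := by
    intro i b
    fin_cases b
    · rfl
    · exact (h1 i).symm
  have hinj : Function.Injective fun i => (σ (i, 0)).1 := by
    intro i j hij
    have : σ (i, (f i).symm 0) = σ (j, (f j).symm 0) := by
      refine Prod.ext ?_ ?_
      · rw [hfst, hfst j]; exact hij
      · rw [← hf, ← hf]; simp
    exact congrArg Prod.fst (σ.injective this)
  let π : Equiv.Perm (Fin n) := Equiv.ofBijective _ (Finite.injective_iff_bijective.1 hinj)
  -- A permutation with nonzero term permutes the pairs and then flips within some of them.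
  -- Permuting pairs moves two copies at once and is even; each flip contributes `-1` to the sign
  -- and `-1` to the product.
  have hσ : σ = (Equiv.prodCongrLeft fun _ : Fin 2 => π) * Equiv.prodCongrRight f := by
    ext ⟨i, b⟩ : 1
    refine Prod.ext ?_ ?_
    · rw [hfst]; rfl
    · rw [← hf]; rfl
  have hsign : Equiv.Perm.sign σ = ∏ i, Equiv.Perm.sign (f i) := by
    conv_lhs => rw [hσ]
    rw [Equiv.Perm.sign_mul, Equiv.Perm.sign_prodCongrLeft, Equiv.Perm.sign_prodCongrRight]
    simp
  rw [hsign]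
  push_cast
  rw [← Finset.prod_mul_distrib]
  refine Finset.prod_eq_one fun i _ => ?_
  rcases hb i with ⟨h2, h3⟩ | ⟨h2, h3⟩
  · simp [stdPair, h1 i, h2, h3, f]
  · simp [stdPair, h1 i, h2, h3, f]

/-- All terms are `0` or `1` and the identity contributes `1`, so the sum is a positive natural
number. -/
theorem sum_sign_stdPair_ne_zero (n : ℕ) :
    ∑ σ : Equiv.Perm (Fin n × Fin 2), ((Equiv.Perm.sign σ : ℤ) : ℂ) *
      ∏ i, stdPair (σ (i, 0)) (σ (i, 1)) ≠ 0 := by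
  classical
  have h : ∀ σ : Equiv.Perm (Fin n × Fin 2), ((Equiv.Perm.sign σ : ℤ) : ℂ) *
      ∏ i, stdPair (σ (i, 0)) (σ (i, 1)) =
        ((if ∀ i, stdPair (σ (i, 0)) (σ (i, 1)) ≠ 0 then 1 else 0 : ℕ) : ℂ) := by
    intro σ
    split_ifs with hσ
    · rw [sign_mul_prod_stdPair σ hσ, Nat.cast_one]
    · push Not at hσ
      obtain ⟨i, hi⟩ := hσ
      rw [Finset.prod_eq_zero (Finset.mem_univ i) hi, mul_zero, Nat.cast_zero]
  rw [Finset.sum_congr rfl fun σ _ => h σ, ← Nat.cast_sum, Nat.cast_ne_zero]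
  have h1 := Finset.single_le_sum (f := fun σ : Equiv.Perm (Fin n × Fin 2) =>
    if ∀ i, stdPair (σ (i, 0)) (σ (i, 1)) ≠ 0 then 1 else 0) (fun _ _ => Nat.zero_le _)
    (Finset.mem_univ 1)
  have h2 : ∀ i : Fin n, stdPair ((1 : Equiv.Perm (Fin n × Fin 2)) (i, 0))
      ((1 : Equiv.Perm (Fin n × Fin 2)) (i, 1)) ≠ 0 := fun i => by simp [stdPair]
  simp only [h2, not_false_eq_true, implies_true, if_true, ne_eq] at h1
  exact Nat.one_le_iff_ne_zero.1 h1

variable [FiniteDimensional ℂ V] {B : V →ₗ[ℂ] V →ₗ[ℂ] ℂ}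

/-- A nondegenerate alternating form has a symplectic family of the maximal size. -/
theorem exists_symplectic_family (halt : ∀ v, B v v = 0) (hnd : ∀ v, (∀ u, B v u = 0) → v = 0)
    (k : ℕ) (hk : 2 * k ≤ Module.finrank ℂ V) :
    ∃ e : Fin k × Fin 2 → V, ∀ a b, B (e a) (e b) = stdPair a b := by
  have hskew : ∀ u v, B v u = -B u v := fun u v => by
    have h := halt (u + v)
    simp only [map_add, LinearMap.add_apply, halt, zero_add, add_zero] at h
    exact eq_neg_of_add_eq_zero_left h
  induction k with
  | zero => exact ⟨fun a => a.1.elim0, fun a => a.1.elim0⟩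
  | succ k ih =>
    obtain ⟨e, he⟩ := ih (by omega)
    -- The projection onto the symplectic complement of the family found so far. A vector outside
    -- its span has nonzero image, which is completed to the next hyperbolic pair inside the
    -- complement.
    let pr : V → V := fun v => v - ∑ i, (B v (e (i, 1)) • e (i, 0) - B v (e (i, 0)) • e (i, 1))
    have hpr : ∀ v a, B (pr v) (e a) = 0 := by
      rintro v ⟨j, b⟩
      have h1 : B (pr v) (e (j, b)) = B v (e (j, b)) - ∑ i, (B v (e (i, 1)) * stdPair (i, 0) (j, b)
          - B v (e (i, 0)) * stdPair (i, 1) (j, b)) := by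
        simp [pr, map_sub, map_sum, LinearMap.sub_apply, LinearMap.sum_apply, he]
      rw [h1, Finset.sum_eq_single j (fun i _ hij => by simp [stdPair, hij]) (by simp)]
      fin_cases b <;> simp [stdPair]
    have hpr' : ∀ u v, (∀ a, B u (e a) = 0) → B u (pr v) = B u v := by
      intro u v hu
      simp [pr, map_sub, map_sum, hu]
    have hspan : Submodule.span ℂ (range e) ≠ ⊤ := by
      intro htop
      have h1 := finrank_range_le_card (R := ℂ) e
      rw [Set.finrank, htop, finrank_top, Fintype.card_prod, Fintype.card_fin,
        Fintype.card_fin] at h1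
      omega
    obtain ⟨v, hv⟩ : ∃ v, v ∉ Submodule.span ℂ (range e) := by
      by_contra hall
      push Not at hall
      exact hspan (eq_top_iff.2 fun v _ => hall v)
    have hpv : pr v ≠ 0 := by
      intro h0
      refine hv ?_
      rw [sub_eq_zero.1 h0]
      exact Submodule.sum_mem _ fun i _ => Submodule.sub_mem _
        (Submodule.smul_mem _ _ (Submodule.subset_span ⟨_, rfl⟩))
        (Submodule.smul_mem _ _ (Submodule.subset_span ⟨_, rfl⟩))
    obtain ⟨u, hu⟩ : ∃ u, B (pr v) u ≠ 0 := by
      by_contra hall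
      push Not at hall
      exact hpv (hnd _ hall)
    let x := pr v
    let y := (B (pr v) u)⁻¹ • pr u
    have hxy : B x y = 1 := by
      simp only [x, y, map_smul, smul_eq_mul]
      rw [hpr' _ _ (hpr v), inv_mul_cancel₀ hu]
    have hxe : ∀ a, B x (e a) = 0 := hpr v
    have hye : ∀ a, B y (e a) = 0 := fun a => by simp [y, hpr u a]
    let z : Fin 2 → V := ![x, y]
    have hz : ∀ b c : Fin 2, B (z b) (z c) = if b = 0 ∧ c = 1 then 1 else
        if b = 1 ∧ c = 0 then -1 else 0 := by
      intro b c
      have hyx := hskew x y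
      rw [hxy] at hyx
      fin_cases b <;> fin_cases c <;> simp [z, halt, hxy, hyx]
    have hze : ∀ b a, B (z b) (e a) = 0 := by
      intro b a
      fin_cases b
      · exact hxe a
      · exact hye a
    refine ⟨fun a => Fin.lastCases (motive := fun _ => V) (z a.2) (fun i => e (i, a.2)) a.1, ?_⟩
    rintro ⟨i, b⟩ ⟨j, c⟩
    refine Fin.lastCases ?_ (fun i => ?_) i <;> refine Fin.lastCases ?_ (fun j => ?_) j
    · simp [hz, stdPair]
    · simp [hze, stdPair, (Fin.castSucc_lt_last j).ne']
    · simp only [Fin.lastCases_last, Fin.lastCases_castSucc]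
      rw [hskew, hze]
      simp [stdPair, (Fin.castSucc_lt_last i).ne]
    · simp [he, stdPair]

theorem alternatization_pairProd_ne_zero {n : ℕ} (hn : Module.finrank ℂ V = 2 * n)
    (halt : ∀ v, B v v = 0) (hnd : ∀ v, (∀ u, B v u = 0) → v = 0) :
    (pairProd B n).alternatization ≠ 0 := by
  obtain ⟨e, he⟩ := exists_symplectic_family halt hnd n hn.ge
  intro h0
  have h1 := DFunLike.congr_fun h0 e
  rw [MultilinearMap.alternatization_apply] at h1
  refine sum_sign_stdPair_ne_zero n (Eq.trans (Finset.sum_congr rfl fun σ _ => ?_) h1)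
  simp only [MultilinearMap.domDomCongr_apply, pairProd, MultilinearMap.coe_mk, he]
  rw [Units.smul_def, zsmul_eq_mul]

/-- The indices of the coordinates of the phase space, in pairs. -/
def pairEquiv (n : ℕ) : Fin n × Fin 2 ≃ Fin (2 * n) where
  toFun a := ⟨2 * a.1.1 + a.2.1, by omega⟩
  invFun i := (⟨i.1 / 2, by omega⟩, ⟨i.1 % 2, by omega⟩)
  left_inv a := by
    refine Prod.ext (Fin.ext ?_) (Fin.ext ?_)
    · simp only; omega
    · simp only; omega
  right_inv i := Fin.ext (by simp only; omega)

end Pfaffian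

/-! ### Nonvanishing of the density of `ω^n` -/

section TopPower

variable {n : ℕ} {P : Type*} [TopologicalSpace P] [ChartedSpace (Phase n) P]
  [IsManifold 𝓘(ℂ, Phase n) ω P]

/-- Up to `2^{-n}` the density is the alternatization of `∏ ω(v_{2i}, v_{2i+1})` on the coordinate
basis, pulled back by the invertible derivative of the chart. A top-degree alternating map that
vanishes on one basis is zero, and this one is nonzero on a symplectic basis. -/
theorem SymplecticForm.topPower_ne_zero (Ω : SymplecticForm n P) (x : P) :
    Ω.topPower (chartAt (Phase n) x) (chartAt (Phase n) x x) ≠ 0 := by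
  set φ := chartAt (Phase n) x with hφ
  have hx : x ∈ φ.source := mem_chart_source _ x
  have hmd : φ.symm.MDifferentiable 𝓘(ℂ, Phase n) 𝓘(ℂ, Phase n) := by
    have : IsManifold 𝓘(ℂ, Phase n) 1 P := IsManifold.of_le (n := ω) (by simp)
    exact (mdifferentiable_chart x).symm
  set y := φ x with hy
  have hyt : y ∈ φ.symm.source := φ.map_source hx
  let T : Phase n →ₗ[ℂ] TangentSpace 𝓘(ℂ, Phase n) (φ.symm y) :=
    (mfderiv 𝓘(ℂ, Phase n) 𝓘(ℂ, Phase n) φ.symm y).toLinearMap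
  have hT : Function.Bijective T := hmd.mfderiv_bijective hyt
  let B : Phase n →ₗ[ℂ] Phase n →ₗ[ℂ] ℂ :=
    LinearMap.mk₂ ℂ (fun v u => Ω.form (φ.symm y) (T v) (T u))
      (fun v v' u => by simp) (fun c v u => by simp) (fun v u u' => by simp) (fun c v u => by simp)
  have halt : ∀ v, B v v = 0 := fun v => Ω.alternating _ _
  have hnd : ∀ v, (∀ u, B v u = 0) → v = 0 := by
    intro v hv
    have h1 : T v = 0 := Ω.nondegenerate _ _ fun u' => by
      obtain ⟨u, rfl⟩ := hT.2 u'
      exact hv u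
    exact hT.1 (h1.trans (map_zero T).symm)
  have hne := alternatization_pairProd_ne_zero (n := n) (by simp) halt hnd
  have hb := mt ((AlternatingMap.map_basis_eq_zero_iff
    ((Pi.basisFun ℂ (Fin (2 * n))).reindex (pairEquiv n).symm) _).1) hne
  rw [SymplecticForm.topPower]
  refine mul_ne_zero (by simp) fun h0 => hb ?_
  rw [MultilinearMap.alternatization_apply, ← h0]
  refine Fintype.sum_equiv (pairEquiv n).permCongr _ _ fun σ => ?_
  rw [Equiv.Perm.sign_permCongr, Units.smul_def, zsmul_eq_mul]
  congr 1
  simp only [MultilinearMap.domDomCongr_apply, pairProd, MultilinearMap.coe_mk]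
  refine Finset.prod_congr rfl fun i _ => ?_
  have h2 : (⟨2 * i.1, by omega⟩ : Fin (2 * n)) = pairEquiv n (i, 0) := rfl
  have h3 : (⟨2 * i.1 + 1, by omega⟩ : Fin (2 * n)) = pairEquiv n (i, 1) := rfl
  rw [h2, h3, Equiv.permCongr_apply, Equiv.permCongr_apply, Equiv.symm_apply_apply,
    Equiv.symm_apply_apply]
  simp [Module.Basis.reindex_apply, formComp, B, T]
  rfl

end TopPower

end StarSDYM

namespace StarSDYM

/-! ### Integrals over products of tori -/

section Torus

open MeasureTheory

/-- The box of angles. -/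
abbrev angleBox (n : ℕ) : Set (Fin n → ℝ) := Icc 0 fun _ => 2 * Real.pi

/-- The Jacobian of the parametrization of a torus. -/
def torusJac {n : ℕ} (R : Fin n → ℝ) (θ : Fin n → ℝ) : ℂ :=
  ∏ i, R i * Complex.exp (θ i * Complex.I) * Complex.I

theorem continuous_torusJac {n : ℕ} (R : Fin n → ℝ) : Continuous (torusJac R) := by
  unfold torusJac
  fun_prop

theorem continuous_torusMap {n : ℕ} (c : Fin n → ℂ) (R : Fin n → ℝ) :
    Continuous (torusMap c R) := by
  unfold torusMap
  fun_prop

theorem torusMap_mem_torusSet {n : ℕ} (c : Fin n → ℂ) {R : Fin n → ℝ} (hR : ∀ i, 0 < R i)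
    (θ : Fin n → ℝ) : torusMap c R θ ∈ torusSet c R := fun i => by
  simp [torusMap, abs_of_pos (hR i)]

theorem torusIntegral_eq {n : ℕ} (f : (Fin n → ℂ) → ℂ) (c : Fin n → ℂ) (R : Fin n → ℝ) :
    torusIntegral f c R = ∫ θ in angleBox n, torusJac R θ * f (torusMap c R θ) := rfl

section Product

variable {X Y Z : Type*} [TopologicalSpace X] [TopologicalSpace Y] [TopologicalSpace Z]
  [T2Space X] [T2Space Y] [T2Space Z] [SecondCountableTopology X] [SecondCountableTopology Y]
  [SecondCountableTopology Z] [MeasureSpace X] [MeasureSpace Y] [MeasureSpace Z] [BorelSpace X]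
  [BorelSpace Y] [BorelSpace Z] [IsFiniteMeasureOnCompacts (volume : Measure X)]
  [IsFiniteMeasureOnCompacts (volume : Measure Y)] [IsFiniteMeasureOnCompacts (volume : Measure Z)]
  [SFinite (volume : Measure X)] [SFinite (volume : Measure Y)] [SFinite (volume : Measure Z)]
  {s : Set X} {t : Set Y} {r : Set Z} (hs : IsCompact s) (ht : IsCompact t) (hr : IsCompact r)
  [IsFiniteMeasureOnCompacts (volume : Measure (X × Y))]
  [IsFiniteMeasureOnCompacts (volume : Measure (Y × Z))]
  [IsFiniteMeasureOnCompacts (volume : Measure (X × Y × Z))]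

include hs ht

theorem setIntegral_prod_of_continuous {K : X × Y → ℂ} (hK : Continuous K) :
    ∫ z in s ×ˢ t, K z = ∫ x in s, ∫ y in t, K (x, y) :=
  setIntegral_prod (μ := volume) (ν := volume) K
    (hK.continuousOn.integrableOn_compact (μ := (volume : Measure (X × Y))) (hs.prod ht))

theorem setIntegral_eq_zero_of_left {K : X × Y → ℂ} (hK : Continuous K)
    (h : ∀ y, ∫ x in s, K (x, y) = 0) : ∫ z in s ×ˢ t, K z = 0 := by
  have hi : IntegrableOn K (s ×ˢ t) ((volume : Measure X).prod (volume : Measure Y)) :=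
    hK.continuousOn.integrableOn_compact (μ := (volume : Measure (X × Y))) (hs.prod ht)
  have h1 := setIntegral_prod_swap (μ := (volume : Measure X)) (ν := (volume : Measure Y)) s t K
  refine h1.symm.trans ?_
  rw [setIntegral_prod (μ := (volume : Measure Y)) (ν := (volume : Measure X)) _ ?_]
  · simp [h]
  · exact hi.swap

include hr

theorem setIntegral_prod_prod_of_continuous {K : X × Y × Z → ℂ} (hK : Continuous K) :
    ∫ z in s ×ˢ (t ×ˢ r), K z = ∫ x in s, ∫ y in t, ∫ z in r, K (x, y, z) := by
  refine (setIntegral_prod (μ := (volume : Measure X)) (ν := (volume : Measure (Y × Z))) K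
    (hK.continuousOn.integrableOn_compact (μ := (volume : Measure (X × Y × Z)))
      (hs.prod (ht.prod hr)))).trans ?_
  congr 1
  funext x
  exact setIntegral_prod_of_continuous ht hr (K := fun w => K (x, w)) (by fun_prop)

end Product

variable {N : ℕ} {c : Fin N → ℂ} {R : Fin N → ℝ} {c₁ c₂ : Fin 2 → ℂ} {R₁ R₂ : Fin 2 → ℝ}

/-- The integral over a product of three tori. -/
def tripleIntegral (c : Fin N → ℂ) (R : Fin N → ℝ) (c₁ : Fin 2 → ℂ) (R₁ : Fin 2 → ℝ)
    (c₂ : Fin 2 → ℂ) (R₂ : Fin 2 → ℝ) (F : (Fin N → ℂ) × Base → ℂ) : ℂ :=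
  torusIntegral (fun y => torusIntegral (fun u => torusIntegral (fun v => F (y, (u, v)))
    c₂ R₂) c₁ R₁) c R

/-- The product of three tori. -/
def tripleSet (c : Fin N → ℂ) (R : Fin N → ℝ) (c₁ : Fin 2 → ℂ) (R₁ : Fin 2 → ℝ)
    (c₂ : Fin 2 → ℂ) (R₂ : Fin 2 → ℝ) : Set ((Fin N → ℂ) × Base) :=
  torusSet c R ×ˢ (torusSet c₁ R₁ ×ˢ torusSet c₂ R₂)

/-- The integrand of an integral over a product of three tori, as a function of the angles. -/
def angleFun (c : Fin N → ℂ) (R : Fin N → ℝ) (c₁ : Fin 2 → ℂ) (R₁ : Fin 2 → ℝ)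
    (c₂ : Fin 2 → ℂ) (R₂ : Fin 2 → ℝ) (F : (Fin N → ℂ) × Base → ℂ) (θ : (Fin N → ℝ) × (Fin 2 → ℝ) × (Fin 2 → ℝ)) : ℂ :=
  torusJac R θ.1 * (torusJac R₁ θ.2.1 * (torusJac R₂ θ.2.2 *
    F (torusMap c R θ.1, (torusMap c₁ R₁ θ.2.1, torusMap c₂ R₂ θ.2.2))))

variable (hR : ∀ i, 0 < R i) (hR₁ : ∀ i, 0 < R₁ i) (hR₂ : ∀ i, 0 < R₂ i)
  {F H : (Fin N → ℂ) × Base → ℂ}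

include hR hR₁ hR₂

theorem tripleMap_mem (θ : (Fin N → ℝ) × (Fin 2 → ℝ) × (Fin 2 → ℝ)) :
    ((torusMap c R θ.1, (torusMap c₁ R₁ θ.2.1, torusMap c₂ R₂ θ.2.2)) : (Fin N → ℂ) × Base) ∈
      tripleSet c R c₁ R₁ c₂ R₂ :=
  ⟨torusMap_mem_torusSet c hR _, torusMap_mem_torusSet c₁ hR₁ _, torusMap_mem_torusSet c₂ hR₂ _⟩

theorem continuous_angleFun (hF : ContinuousOn F (tripleSet c R c₁ R₁ c₂ R₂)) :
    Continuous (angleFun c R c₁ R₁ c₂ R₂ F) := by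
  have h1 := continuous_torusJac R
  have h2 := continuous_torusJac R₁
  have h3 := continuous_torusJac R₂
  have h4 := continuous_torusMap c R
  have h5 := continuous_torusMap c₁ R₁
  have h6 := continuous_torusMap c₂ R₂
  have h7 := hF.comp_continuous (f := fun θ : (Fin N → ℝ) × (Fin 2 → ℝ) × (Fin 2 → ℝ) =>
    ((torusMap c R θ.1, (torusMap c₁ R₁ θ.2.1, torusMap c₂ R₂ θ.2.2)) : (Fin N → ℂ) × Base))
    (by fun_prop) (tripleMap_mem hR hR₁ hR₂)
  exact (h1.comp continuous_fst).mul ((h2.comp (by fun_prop)).mul ((h3.comp (by fun_prop)).mul h7))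

theorem tripleIntegral_eq (hF : ContinuousOn F (tripleSet c R c₁ R₁ c₂ R₂)) :
    tripleIntegral c R c₁ R₁ c₂ R₂ F =
      ∫ θ in angleBox N ×ˢ (angleBox 2 ×ˢ angleBox 2), angleFun c R c₁ R₁ c₂ R₂ F θ := by
  rw [setIntegral_prod_prod_of_continuous isCompact_Icc isCompact_Icc isCompact_Icc
    (continuous_angleFun hR hR₁ hR₂ hF)]
  simp only [angleFun, integral_const_mul]
  rfl

theorem tripleIntegral_congr (h : EqOn F H (tripleSet c R c₁ R₁ c₂ R₂)) :
    tripleIntegral c R c₁ R₁ c₂ R₂ F = tripleIntegral c R c₁ R₁ c₂ R₂ H := by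
  simp only [tripleIntegral, torusIntegral_eq]
  congr 1
  funext θ
  congr 2
  funext θ₁
  congr 2
  funext θ₂
  rw [h (tripleMap_mem hR hR₁ hR₂ (θ, θ₁, θ₂))]

theorem integrableOn_angleFun (hF : ContinuousOn F (tripleSet c R c₁ R₁ c₂ R₂)) :
    IntegrableOn (angleFun c R c₁ R₁ c₂ R₂ F) (angleBox N ×ˢ (angleBox 2 ×ˢ angleBox 2)) :=
  (continuous_angleFun hR hR₁ hR₂ hF).continuousOn.integrableOn_compact
    (isCompact_Icc.prod (isCompact_Icc.prod isCompact_Icc))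

theorem tripleIntegral_add (hF : ContinuousOn F (tripleSet c R c₁ R₁ c₂ R₂))
    (hH : ContinuousOn H (tripleSet c R c₁ R₁ c₂ R₂)) :
    tripleIntegral c R c₁ R₁ c₂ R₂ (fun z => F z + H z) =
      tripleIntegral c R c₁ R₁ c₂ R₂ F + tripleIntegral c R c₁ R₁ c₂ R₂ H := by
  rw [tripleIntegral_eq hR hR₁ hR₂ (hF.fun_add hH), tripleIntegral_eq hR hR₁ hR₂ hF,
    tripleIntegral_eq hR hR₁ hR₂ hH, ← integral_add (integrableOn_angleFun hR hR₁ hR₂ hF)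
      (integrableOn_angleFun hR hR₁ hR₂ hH)]
  congr 1
  funext θ
  simp only [angleFun]
  ring

omit hR hR₁ hR₂ in
theorem tripleIntegral_const_mul (a : ℂ) (F : (Fin N → ℂ) × Base → ℂ) :
    tripleIntegral c R c₁ R₁ c₂ R₂ (fun z => a * F z) =
      a * tripleIntegral c R c₁ R₁ c₂ R₂ F := by
  simp only [tripleIntegral, torusIntegral_const_mul]

/-- The vanishing of a commutator's integral concerns the phase torus alone, which is the outermost
integration; Fubini brings it inside. -/
theorem tripleIntegral_eq_zero_of_first (hF : ContinuousOn F (tripleSet c R c₁ R₁ c₂ R₂))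
    (h : ∀ u ∈ torusSet c₁ R₁, ∀ v ∈ torusSet c₂ R₂,
      torusIntegral (fun y => F (y, (u, v))) c R = 0) :
    tripleIntegral c R c₁ R₁ c₂ R₂ F = 0 := by
  rw [tripleIntegral_eq hR hR₁ hR₂ hF]
  refine setIntegral_eq_zero_of_left isCompact_Icc (isCompact_Icc.prod isCompact_Icc)
    (continuous_angleFun hR hR₁ hR₂ hF) fun w => ?_
  have h1 := h _ (torusMap_mem_torusSet c₁ hR₁ w.1) _ (torusMap_mem_torusSet c₂ hR₂ w.2)
  rw [torusIntegral_eq] at h1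
  have h2 : ∀ x, angleFun c R c₁ R₁ c₂ R₂ F (x, w) = torusJac R₁ w.1 * torusJac R₂ w.2 *
      (torusJac R x * F (torusMap c R x, (torusMap c₁ R₁ w.1, torusMap c₂ R₂ w.2))) := fun x => by
    simp only [angleFun]
    ring
  simp only [h2, integral_const_mul, h1, mul_zero]

theorem tripleIntegral_eq_zero_of_second (hF : ContinuousOn F (tripleSet c R c₁ R₁ c₂ R₂))
    (h : ∀ y ∈ torusSet c R, ∀ v ∈ torusSet c₂ R₂,
      torusIntegral (fun u => F (y, (u, v))) c₁ R₁ = 0) :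
    tripleIntegral c R c₁ R₁ c₂ R₂ F = 0 := by
  have hc := continuous_angleFun hR hR₁ hR₂ hF
  rw [tripleIntegral_eq hR hR₁ hR₂ hF, setIntegral_prod_of_continuous isCompact_Icc
    (isCompact_Icc.prod isCompact_Icc) hc]
  have h0 : ∀ x, ∫ w in angleBox 2 ×ˢ angleBox 2, angleFun c R c₁ R₁ c₂ R₂ F (x, w) = 0 := by
    intro x
    refine setIntegral_eq_zero_of_left isCompact_Icc isCompact_Icc
      (K := fun w => angleFun c R c₁ R₁ c₂ R₂ F (x, w)) (by fun_prop) fun w => ?_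
    have h1 := h _ (torusMap_mem_torusSet c hR x) _ (torusMap_mem_torusSet c₂ hR₂ w)
    rw [torusIntegral_eq] at h1
    have h2 : ∀ y, angleFun c R c₁ R₁ c₂ R₂ F (x, (y, w)) = torusJac R x * torusJac R₂ w *
        (torusJac R₁ y * F (torusMap c R x, (torusMap c₁ R₁ y, torusMap c₂ R₂ w))) := fun x => by
      simp only [angleFun]
      ring
    simp only [h2, integral_const_mul, h1, mul_zero]
  simp only [h0, integral_zero]

theorem tripleIntegral_eq_zero_of_third
    (h : ∀ y ∈ torusSet c R, ∀ u ∈ torusSet c₁ R₁,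
      torusIntegral (fun v => F (y, (u, v))) c₂ R₂ = 0) :
    tripleIntegral c R c₁ R₁ c₂ R₂ F = 0 := by
  simp only [tripleIntegral, torusIntegral_eq]
  simp only [torusIntegral_eq] at h
  simp only [fun x y => h _ (torusMap_mem_torusSet c hR x) _ (torusMap_mem_torusSet c₁ hR₁ y),
    mul_zero, integral_zero]

omit hR hR₁ hR₂

theorem torusIntegrable_of_continuousOn {f : (Fin N → ℂ) → ℂ} (hR : ∀ i, 0 < R i)
    (hf : ContinuousOn f (torusSet c R)) : TorusIntegrable f c R :=
  (hf.comp_continuous (continuous_torusMap c R)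
    (torusMap_mem_torusSet c hR)).continuousOn.integrableOn_compact isCompact_Icc

theorem hasDerivAt_insertNth (k : Fin 2) (x y : ℂ) :
    HasDerivAt (fun y : ℂ => (k.insertNth x fun _ : Fin 1 => y : Fin 2 → ℂ))
      (Pi.single (k.succAbove 0) 1) y := by
  refine hasDerivAt_pi.2 fun j => ?_
  fin_cases k <;> fin_cases j
  · simpa [Fin.insertNth_apply_same] using hasDerivAt_const y x
  · simpa [Fin.succAbove, Fin.insertNth, Fin.succAboveCases] using hasDerivAt_id' y
  · simpa [Fin.succAbove, Fin.insertNth, Fin.succAboveCases] using hasDerivAt_id' y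
  · simpa [Fin.succAbove] using hasDerivAt_const y x

/-- The integral of a derivative over a torus vanishes. -/
theorem torusIntegral_fderiv (hR₁ : ∀ i, 0 < R₁ i) {f : (Fin 2 → ℂ) → ℂ}
    {O : Set (Fin 2 → ℂ)} (hO : IsOpen O) (hf : DifferentiableOn ℂ f O)
    (hsub : torusSet c₁ R₁ ⊆ O) (i : Fin 2) :
    torusIntegral (fun u => fderiv ℂ f u (Pi.single i 1)) c₁ R₁ = 0 := by
  obtain ⟨k, rfl⟩ : ∃ k : Fin 2, i = k.succAbove 0 := by
    fin_cases i
    · exact ⟨1, rfl⟩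
    · exact ⟨0, rfl⟩
  have hc : ContinuousOn (fun u => fderiv ℂ f u (Pi.single (k.succAbove 0) 1))
      (torusSet c₁ R₁) :=
    (differentiableOn_fderiv_apply hO hf _).continuousOn.mono hsub
  -- Here `k` is the other coordinate. Peeling it off leaves innermost the integral of a derivative
  -- over a closed circle.
  rw [torusIntegral_succAbove (torusIntegrable_of_continuousOn hR₁ hc) k]
  rw [circleIntegral.integral_congr (g := fun _ => 0) (hR₁ k).le fun x hx => ?_]
  · simp [circleIntegral]
  rw [torusIntegral_dim1]
  refine circleIntegral.integral_eq_zero_of_hasDerivWithinAt'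
    (f := fun y => f (k.insertNth x fun _ : Fin 1 => y)) fun y hy => ?_
  rw [Function.comp_apply, Function.comp_apply, abs_of_pos (hR₁ _)] at hy
  have hm : (k.insertNth x (fun _ : Fin 1 => y) : Fin 2 → ℂ) ∈ torusSet c₁ R₁ := by
    intro j
    refine Fin.succAboveCases k ?_ (fun l => ?_) j
    · simpa using mem_sphere_iff_norm.1 hx
    · rw [Fin.insertNth_apply_succAbove, Subsingleton.elim l 0]
      simpa using mem_sphere_iff_norm.1 hy
  exact ((hf.differentiableAt (hO.mem_nhds (hsub hm))).hasFDerivAt.comp_hasDerivAt y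
    (hasDerivAt_insertNth k x y)).hasDerivWithinAt

end Torus

end StarSDYM

namespace StarSDYM

open TopologicalSpace (Opens)
open FSeries

/-! ### The trace, and the variation of the action -/

section Trace

variable {n : ℕ} {P : Type*} [TopologicalSpace P] [ChartedSpace (Phase n) P]
  {Ω : SymplecticForm n P}

theorem SymplecticForm.continuousOn_topPower (Ω : SymplecticForm n P)
    {φ : OpenPartialHomeomorph P (Phase n)}
    (hφ : φ ∈ IsManifold.maximalAtlas 𝓘(ℂ, Phase n) ω P) :
    ContinuousOn (Ω.topPower φ) φ.target := by
  unfold SymplecticForm.topPower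
  exact continuousOn_const.mul (continuousOn_finsetSum _ fun σ _ => continuousOn_const.mul
    (continuousOn_finsetProd _ fun i _ => (Ω.holomorphic φ hφ _ _).continuousOn))

variable [IsManifold 𝓘(ℂ, Phase n) ω P] {S : StarProduct Ω} {W : Opens (P × Base)}

/-- The contour in the coordinates of its chart. -/
abbrev Contour.coordSet (T : Contour n P) : Set (Phase n × Base) :=
  tripleSet T.c T.R T.c₁ T.R₁ T.c₂ T.R₂

theorem Contour.coordSet_subset {T : Contour n P} (hT : T.carrier ⊆ W) :
    T.coordSet ⊆ hatDom T.chart W := fun _ hz =>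
  ⟨T.torus_subset hz.1, hT ⟨mem_image_of_mem _ hz.1, hz.2⟩⟩

theorem Contour.continuousOn_integrand {T : Contour n P} (hT : T.carrier ⊆ W) (F : HolFun n W) :
    ContinuousOn (fun z => Ω.topPower T.chart z.1 * hat T.chart F.1 z) T.coordSet := by
  have h1 := (F.2.1.differentiableOn_hat T.chart_mem W.isOpen).continuousOn.mono
    (Contour.coordSet_subset hT)
  exact ((Ω.continuousOn_topPower T.chart_mem).comp continuousOn_fst
    fun _ hz => T.torus_subset hz.1).mul h1

variable (Ω) in
/-- The integral of a holomorphic function over a contour, with the weight `ω^n`. -/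
def Contour.integral (T : Contour n P) (hT : T.carrier ⊆ W) : HolFun n W →+ ℂ where
  toFun F := tripleIntegral T.c T.R T.c₁ T.R₁ T.c₂ T.R₂
    fun z => Ω.topPower T.chart z.1 * hat T.chart F.1 z
  map_zero' := by
    have h : ∀ z, hat T.chart (0 : HolFun n W).1 z = 0 := fun _ => rfl
    simp only [h, mul_zero]
    simp [tripleIntegral, torusIntegral_eq]
  map_add' F H := by
    rw [← tripleIntegral_add T.R_pos T.R₁_pos T.R₂_pos (T.continuousOn_integrand hT F)
      (T.continuousOn_integrand hT H)]
    congr 1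
    funext z
    simp only [hat, HolFun.add_apply]
    ring

theorem Contour.integral_apply (T : Contour n P) (hT : T.carrier ⊆ W) (F : HolFun n W) :
    T.integral Ω hT F = tripleIntegral T.c T.R T.c₁ T.R₁ T.c₂ T.R₂
      fun z => Ω.topPower T.chart z.1 * hat T.chart F.1 z := rfl

theorem Contour.integral_smul (T : Contour n P) (hT : T.carrier ⊆ W) (s : ℂ) (F : HolFun n W) :
    T.integral Ω hT (constB (n := n) W s • F) = s * T.integral Ω hT F := by
  rw [Contour.integral_apply, Contour.integral_apply, ← tripleIntegral_const_mul]
  refine congrArg _ (funext fun z => ?_)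
  have h : hat T.chart (constB (n := n) W s • F).1 z = s * hat T.chart F.1 z := rfl
  rw [h]
  ring

/-- The trace axiom at each point of the base tori, multiplied by `n!`. -/
theorem Contour.integral_Δ_comm (T : Contour n P) (hT : T.carrier ⊆ W) (k : ℕ)
    (F H : HolFun n W) : T.integral Ω hT ((deform S W).Δ k F H) =
      T.integral Ω hT ((deform S W).Δ k H F) := by
  rw [← sub_eq_zero, ← map_sub, Contour.integral_apply]
  refine tripleIntegral_eq_zero_of_first T.R_pos T.R₁_pos T.R₂_pos
    (T.continuousOn_integrand hT _) fun u hu v hv => ?_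
  have hm : ∀ y ∈ torusSet T.c T.R, (T.chart.symm y, ((u, v) : Base)) ∈ W := fun y hy =>
    hT ⟨mem_image_of_mem _ hy, hu, hv⟩
  have h := S.trace T.chart T.chart_mem T.c T.R T.R_pos T.torus_subset
    (fun x => F.1 (x, (u, v))) (fun x => H.1 (x, (u, v)))
    (fun y hy => ⟨F.2.1.holAt W.isOpen (hm y hy), H.2.1.holAt W.isOpen (hm y hy)⟩) k
  have h2 := torusIntegral_const_mul (n.factorial : ℂ) (fun y =>
    (Ω.topPower T.chart y / (n.factorial : ℂ)) *
      (S.Δ k (fun x => F.1 (x, (u, v))) (fun x => H.1 (x, (u, v))) (T.chart.symm y)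
        - S.Δ k (fun x => H.1 (x, (u, v))) (fun x => F.1 (x, (u, v))) (T.chart.symm y))) T.c T.R
  rw [h, mul_zero] at h2
  rw [← h2, torusIntegral_eq, torusIntegral_eq]
  congr 1
  funext θ
  have hθ := torusMap_mem_torusSet T.c T.R_pos θ
  have hf : (n.factorial : ℂ) ≠ 0 := Nat.cast_ne_zero.2 n.factorial_ne_zero
  simp only [hat]
  rw [HolFun.sub_apply, deform_apply _ _ _ (hm _ hθ), deform_apply _ _ _ (hm _ hθ)]
  field_simp

/-- The weight `ω^n` depends only on the phase point, so a base derivative of `F` is integrated over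
a closed torus with a constant weight. -/
theorem Contour.integral_der (T : Contour n P) (hT : T.carrier ⊆ W) (i : Idx) (F : HolFun n W) :
    T.integral Ω hT (der W i F) = 0 := by
  have hm : ∀ y ∈ torusSet T.c T.R, ∀ u ∈ torusSet T.c₁ T.R₁, ∀ v ∈ torusSet T.c₂ T.R₂,
      (T.chart.symm y, ((u, v) : Base)) ∈ W := fun y hy u hu v hv =>
    hT ⟨mem_image_of_mem _ hy, hu, hv⟩
  have hd : ∀ y, DifferentiableOn ℂ (fun p => F.1 (T.chart.symm y, p))
      (slice W (T.chart.symm y)) := fun y => differentiableOn_slice F.2.1 _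
  rw [Contour.integral_apply]
  cases i with
  | inl α =>
    refine tripleIntegral_eq_zero_of_second T.R_pos T.R₁_pos T.R₂_pos
      (T.continuousOn_integrand hT _) fun y hy v hv => ?_
    have hO := (isOpen_slice W (T.chart.symm y)).preimage
      (by fun_prop : Continuous fun u : Fin 2 → ℂ => ((u, v) : Base))
    have h1 := torusIntegral_fderiv T.R₁_pos hO
      ((hd y).comp (f := fun u : Fin 2 → ℂ => ((u, v) : Base)) (by fun_prop) fun u hu => hu)
      (fun u hu => hm y hy u hu v hv) α
    have h2 := torusIntegral_const_mul (Ω.topPower T.chart y) _ _ _ |>.trans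
      (congrArg (Ω.topPower T.chart y * ·) h1)
    refine Eq.trans ?_ (h2.trans (mul_zero _))
    rw [torusIntegral_eq, torusIntegral_eq]
    congr 1
    funext θ
    have hθ := hm y hy _ (torusMap_mem_torusSet T.c₁ T.R₁_pos θ) v hv
    congr 2
    change (der W _ F).1 _ = _
    rw [der_apply _ _ hθ]
    exact fderiv_slice_left (F := fun p => F.1 (T.chart.symm y, p))
      ((hd y).differentiableAt ((isOpen_slice W _).mem_nhds hθ)) (Pi.single α 1)
  | inr α =>
    refine tripleIntegral_eq_zero_of_third T.R_pos T.R₁_pos T.R₂_pos fun y hy u hu => ?_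
    have hO := (isOpen_slice W (T.chart.symm y)).preimage
      (by fun_prop : Continuous fun v : Fin 2 → ℂ => ((u, v) : Base))
    have h1 := torusIntegral_fderiv T.R₂_pos hO
      ((hd y).comp (f := fun v : Fin 2 → ℂ => ((u, v) : Base)) (by fun_prop) fun v hv => hv)
      (fun v hv => hm y hy u hu v hv) α
    have h2 := torusIntegral_const_mul (Ω.topPower T.chart y) _ _ _ |>.trans
      (congrArg (Ω.topPower T.chart y * ·) h1)
    refine Eq.trans ?_ (h2.trans (mul_zero _))
    rw [torusIntegral_eq, torusIntegral_eq]
    congr 1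
    funext θ
    have hθ := hm y hy u hu _ (torusMap_mem_torusSet T.c₂ T.R₂_pos θ)
    congr 2
    change (der W _ F).1 _ = _
    rw [der_apply _ _ hθ]
    exact fderiv_slice_right (F := fun p => F.1 (T.chart.symm y, p))
      ((hd y).differentiableAt ((isOpen_slice W _).mem_nhds hθ)) (Pi.single α 1)

/-- The coefficients of the integral of a formal series over a contour. -/
def Contour.tr (T : Contour n P) (hT : T.carrier ⊆ W) (m j : ℕ) : SAlg S W →+ ℂ where
  toFun a := T.integral Ω hT (Deformation.cf a m j)
  map_zero' := by rw [Deformation.cf_zero, map_zero]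
  map_add' a b := by rw [Deformation.cf_add, map_add]

variable {T : Contour n P} {hT : T.carrier ⊆ W} {m j : ℕ}

theorem Contour.tr_apply (a : SAlg S W) :
    T.tr hT m j a = T.integral Ω hT (Deformation.cf a m j) := rfl

theorem Contour.tr_smul (s : ℂ) (a : SAlg S W) :
    T.tr hT m j (constB (n := n) W s • a) = s * T.tr hT m j a := by
  rw [Contour.tr_apply, Deformation.cf_smul, Contour.integral_smul]
  rfl

theorem Contour.tr_sder (i : Idx) (a : SAlg S W) : T.tr hT m j (sder i a) = 0 := by
  rw [Contour.tr_apply, cf_sder, Contour.integral_der]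

theorem Contour.tr_mul_comm (a b : SAlg S W) : T.tr hT m j (a * b) = T.tr hT m j (b * a) := by
  simp only [Contour.tr_apply, Deformation.cf_mul, map_sum]
  rw [← Finset.Nat.sum_antidiagonal_swap]
  refine Finset.sum_congr rfl fun mm _ => Finset.sum_congr rfl fun sr _ => ?_
  rw [← Finset.Nat.sum_antidiagonal_swap]
  exact Finset.sum_congr rfl fun jj _ => T.integral_Δ_comm hT _ _ _

theorem Contour.tr_sbr (a b : SAlg S W) : T.tr hT m j (sbr a b) = 0 := by
  rw [Contour.tr_apply, sbr, Deformation.br, Deformation.cf_ofCf]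
  change T.integral Ω hT (constB (n := n) W Complex.I⁻¹ • _) = 0
  rw [Contour.integral_smul, ← Contour.tr_apply, map_sub, Contour.tr_mul_comm, sub_self, mul_zero]

/-- Invariance of the trace form: `a{b,c}` and `b{c,a}` differ by a sum of brackets. The scalar `κ`
can be absorbed into one entry of each bracket, whose trace vanishes. -/
theorem Contour.tr_smul_mul_sbr (κ : BaseFun n W) (a b c : SAlg S W) :
    T.tr hT m j (κ • (a * sbr b c)) = T.tr hT m j (κ • (b * sbr c a)) := by
  have h : a * sbr b c = b * sbr c a + (sbr a (b * c) + sbr b (a * c)) := by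
    refine Deformation.ih_injective (ι := iB W) ?_
    simp only [Deformation.ih_add, ← Deformation.mul_ih, sbr, Deformation.ih_br]
    noncomm_ring
  rw [h, smul_add, smul_add, map_add, map_add, ← Deformation.br_smul_left,
    ← Deformation.br_smul_left]
  have h1 := Contour.tr_sbr (hT := hT) (m := m) (j := j) (κ • a) (b * c)
  have h2 := Contour.tr_sbr (hT := hT) (m := m) (j := j) (κ • b) (a * c)
  rw [sbr] at h1 h2
  rw [h1, h2, add_zero, add_zero]

theorem Contour.tr_smul_sder {κ : BaseFun n W} {i : Idx} (hκ : ∀ q ∈ W, pd i κ.1 q.2 = 0)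
    (a : SAlg S W) : T.tr hT m j (κ • sder i a) = 0 := by
  have h := sder_smul κ 0 a i fun q hq => (hκ q hq).symm
  rw [zero_smul, zero_add] at h
  rw [← h, Contour.tr_sder]

/-! ### The first variation of the action -/

section Variation

variable {g : Metric} {U : Set Base} {G Gt : (Fin 2 → ℂ) → ℂ}
  (hU : IsOpen U) (hW : ∀ q ∈ W, q.2 ∈ U) (hK : g.IsKahler U) (hF : g.Factors U G Gt)

/-- The derivatives of the components of the metric, as functions over `W`. -/
def metricDB (i : Idx) (α β : Fin 2) : BaseFun n W :=
  baseFun hU hW _ (differentiableOn_pd hU (hK.holomorphic α β) i)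

theorem sder_metricB_smul (i : Idx) (α β : Fin 2) (a : SAlg S W) :
    sder i (metricB (n := n) hU hW hK α β • a) =
      metricDB (n := n) hU hW hK i α β • a + metricB (n := n) hU hW hK α β • sder i a :=
  sder_smul _ _ _ _ fun _ _ => rfl

/-- Because `dΩ = 0`, the contraction of a derivative with the Kähler form is a total divergence. -/
theorem Contour.tr_strace_left (x : Fin 2 → SAlg S W) :
    T.tr hT m j (strace hU hW hK fun α β => sder (.inl α) (x β)) = 0 := by
  have h1 : ∀ (β : Fin 2) (a : SAlg S W),
      metricDB (n := n) hU hW hK (.inl 1) 0 β • a = metricDB (n := n) hU hW hK (.inl 0) 1 β • a := fun β a =>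
    smul_eq_smul _ fun q hq => hK.closed_left q.2 (hW q hq) 0 1 β
  have h : strace hU hW hK (fun α β => sder (.inl α) (x β)) =
      sder (.inl 1) (metricB (n := n) hU hW hK 0 1 • x 0) + sder (.inl 0) (metricB (n := n) hU hW hK 1 0 • x 1)
      - sder (.inl 1) (metricB (n := n) hU hW hK 0 0 • x 1)
      - sder (.inl 0) (metricB (n := n) hU hW hK 1 1 • x 0) := by
    simp only [sder_metricB_smul, h1, strace]
    abel
  rw [h, map_sub, map_sub, map_add, tr_sder, tr_sder, tr_sder, tr_sder]
  simp

theorem Contour.tr_strace_right (x : Fin 2 → SAlg S W) :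
    T.tr hT m j (strace hU hW hK fun α β => sder (.inr β) (x α)) = 0 := by
  have h1 : ∀ (α : Fin 2) (a : SAlg S W),
      metricDB (n := n) hU hW hK (.inr 1) α 0 • a = metricDB (n := n) hU hW hK (.inr 0) α 1 • a := fun α a =>
    smul_eq_smul _ fun q hq => hK.closed_right q.2 (hW q hq) α 0 1
  have h : strace hU hW hK (fun α β => sder (.inr β) (x α)) =
      sder (.inr 0) (metricB (n := n) hU hW hK 0 1 • x 1) + sder (.inr 1) (metricB (n := n) hU hW hK 1 0 • x 0)
      - sder (.inr 1) (metricB (n := n) hU hW hK 0 0 • x 1)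
      - sder (.inr 0) (metricB (n := n) hU hW hK 1 1 • x 0) := by
    simp only [sder_metricB_smul, h1, strace]
    abel
  rw [h, map_sub, map_sub, map_add, tr_sder, tr_sder, tr_sder, tr_sder]
  simp

theorem strace_mul_left (a : SAlg S W) (x : Fin 2 → Fin 2 → SAlg S W) :
    strace hU hW hK (fun α β => a * x α β) = a * strace hU hW hK x := by
  simp only [strace, mul_add, mul_sub, mul_smul_comm]

theorem strace_mul_right (a : SAlg S W) (x : Fin 2 → Fin 2 → SAlg S W) :
    strace hU hW hK (fun α β => x α β * a) = strace hU hW hK x * a := by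
  simp only [strace, add_mul, sub_mul, smul_mul_assoc]

theorem strace_add (x y : Fin 2 → Fin 2 → SAlg S W) :
    strace hU hW hK (fun α β => x α β + y α β) = strace hU hW hK x + strace hU hW hK y := by
  simp only [strace, smul_add]
  abel

theorem strace_smul (c : BaseFun n W) (x : Fin 2 → Fin 2 → SAlg S W) :
    strace hU hW hK (fun α β => c • x α β) = c • strace hU hW hK x := by
  simp only [strace]
  module

/-- The factor `G̃` of the determinant, as a function over `W`. -/
def rightB : BaseFun n W := baseFun hU hW _ (hF.differentiableOn_right hU hK)

theorem pd_rightB (α : Fin 2) {q : P × Base} (hq : q ∈ W) :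
    pd (.inl α) (rightB (n := n) (W := W) hU hW hK hF).1 q.2 = 0 :=
  pd_comp_snd _ _ ((hF.differentiableOn_right hU hK).differentiableAt (hU.mem_nhds (hW q hq)))

/-- The cubic part of the Lagrangian, as a trilinear expression. -/
def cubic (a b c : SAlg S W) : SAlg S W :=
  rightB (n := n) hU hW hK hF • (a * sbr (sder (.inl 0) b) (sder (.inl 1) c))

/-- The quadratic part of the Lagrangian, as a bilinear expression. -/
def quadratic (a b : SAlg S W) : SAlg S W :=
  strace hU hW hK fun α β => sder (.inl α) a * sder (.inr β) b

/-- The Euler-Lagrange expression. -/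
def euler (θ : SAlg S W) : SAlg S W :=
  rightB (n := n) hU hW hK hF • sbr (sder (.inl 0) θ) (sder (.inl 1) θ)
    - strace hU hW hK fun α β => sder (.inr β) (sder (.inl α) θ)

/-- Cyclicity brings `∂_wη` and `∂_zη` to the front in the last two terms, and parts are integrated
in `w` and `z`, on which `G̃` does not depend. The terms with `∂_w∂_zθ` cancel between the two, so
together they give twice the first term. -/
theorem Contour.tr_cubic (θ η : SAlg S W) :
    T.tr hT m j (cubic hU hW hK hF η θ θ + cubic hU hW hK hF θ η θ + cubic hU hW hK hF θ θ η) =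
      3 * T.tr hT m j (η * (rightB (n := n) hU hW hK hF •
        sbr (sder (.inl 0) θ) (sder (.inl 1) θ))) := by
  set κ := rightB (n := n) (W := W) hU hW hK hF with hκ
  set x := sder (.inl 0) θ with hx
  set y := sder (.inl 1) θ with hy
  have hd : sder (.inl 0) y = sder (.inl 1) x := sder_comm _ _ _
  have h1 := Contour.tr_smul_sder (hT := hT) (m := m) (j := j) (κ := κ)
    (fun q hq => pd_rightB (n := n) hU hW hK hF 0 hq) (η * sbr y θ)
  have h2 := Contour.tr_smul_sder (hT := hT) (m := m) (j := j) (κ := κ)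
    (fun q hq => pd_rightB (n := n) hU hW hK hF 1 hq) (η * sbr θ x)
  have s1 : sbr y x = -sbr x y := Deformation.br_swap _ _
  have s2 : sbr θ (sder (.inl 1) x) = -sbr (sder (.inl 1) x) θ := Deformation.br_swap _ _
  rw [sder_mul, sder_sbr, hd, ← hx, s1, smul_add, map_add] at h1
  rw [sder_mul, sder_sbr, ← hy, s1, s2, smul_add, map_add] at h2
  simp only [map_add, cubic, ← hκ, ← hx, ← hy]
  rw [Contour.tr_smul_mul_sbr κ θ (sder (.inl 0) η) y,
    Contour.tr_smul_mul_sbr κ θ x (sder (.inl 1) η),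
    Contour.tr_smul_mul_sbr κ x (sder (.inl 1) η) θ]
  rw [eq_neg_of_add_eq_zero_left h1, eq_neg_of_add_eq_zero_left h2]
  simp only [mul_add, mul_neg, smul_add, smul_neg, map_add, map_neg, mul_smul_comm]
  ring

/-- One integration by parts in the untilded directions and one in the tilded directions give the
same second-order expression. -/
theorem Contour.tr_quadratic (θ η : SAlg S W) :
    T.tr hT m j (quadratic hU hW hK η θ + quadratic hU hW hK θ η) =
      -2 * T.tr hT m j (η * strace hU hW hK fun α β => sder (.inr β) (sder (.inl α) θ)) := by
  have h1 := Contour.tr_strace_left (hT := hT) (m := m) (j := j) hU hW hK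
    fun β => η * sder (.inr β) θ
  have h2 := Contour.tr_strace_right (hT := hT) (m := m) (j := j) hU hW hK
    fun α => sder (.inl α) θ * η
  simp only [sder_mul, strace_add, strace_mul_left, strace_mul_right, map_add] at h1 h2
  rw [Contour.tr_mul_comm] at h2
  simp only [sder_comm (.inl _) (.inr _)] at h1
  rw [map_add, quadratic, quadratic]
  linear_combination h1 + h2

/-- The Lagrangian, in the algebra. -/
def slag (θ : SAlg S W) : SAlg S W :=
  -- `2/3` is twice the `1/3` of the action: both orders of `∂_wΘ` and `∂_zΘ` in `{∂Θ, ∂Θ}`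
  -- contribute equally.
  constB (n := n) W (2 / 3) • cubic hU hW hK hF θ θ θ + quadratic hU hW hK θ θ

/-- The linear term of the variation of the Lagrangian. -/
def slagVar (θ η : SAlg S W) : SAlg S W :=
  constB (n := n) W (2 / 3) • (cubic hU hW hK hF η θ θ + cubic hU hW hK hF θ η θ
    + cubic hU hW hK hF θ θ η) + (quadratic hU hW hK η θ + quadratic hU hW hK θ η)

theorem Contour.tr_slagVar (θ η : SAlg S W) :
    T.tr hT m j (slagVar hU hW hK hF θ η) = 2 * T.tr hT m j (η * euler hU hW hK hF θ) := by
  rw [slagVar, map_add, Contour.tr_smul, Contour.tr_cubic, Contour.tr_quadratic, euler, mul_sub,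
    map_sub]
  ring

theorem sder_constB_smul (s : ℂ) (i : Idx) (a : SAlg S W) :
    sder i (constB (n := n) W s • a) = constB (n := n) W s • sder i a := by
  have h := sder_smul (constB (n := n) W s) 0 a i fun q _ => by simp [constB, pd]
  rwa [zero_smul, zero_add] at h

/-- The Lagrangian is cubic in `θ`, so along `θ + sη` the action is a polynomial in `s`, and its
derivative at `0` is read off from the linear coefficient without differentiating under the
integral. -/
theorem exists_slag_add (θ η : SAlg S W) : ∃ l₂ l₃ : SAlg S W, ∀ s : ℂ,
    slag hU hW hK hF (θ + constB (n := n) W s • η) = slag hU hW hK hF θ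
      + constB (n := n) W s • slagVar hU hW hK hF θ η + constB (n := n) W (s ^ 2) • l₂
      + constB (n := n) W (s ^ 3) • l₃ := by
  refine ⟨constB (n := n) W (2 / 3) • (cubic hU hW hK hF θ η η + cubic hU hW hK hF η θ η
    + cubic hU hW hK hF η η θ) + quadratic hU hW hK η η,
    constB (n := n) W (2 / 3) • cubic hU hW hK hF η η η, fun s => ?_⟩
  have h2 : constB (n := n) W (s ^ 2) = constB (n := n) W s * constB (n := n) W s :=
    Subtype.ext (funext fun _ => pow_two s)
  have h3 : constB (n := n) W (s ^ 3) =
      constB (n := n) W s * constB (n := n) W s * constB (n := n) W s :=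
    Subtype.ext (funext fun _ => (pow_succ s 2).trans (congrArg (· * s) (pow_two s)))
  rw [h2, h3]
  generalize hc : constB (n := n) W s = c
  have hd : ∀ i (a : SAlg S W), sder i (c • a) = c • sder i a := fun i a => by
    rw [← hc, sder_constB_smul]
  simp only [slag, slagVar, cubic, quadratic, map_add, hd, sbr, Deformation.br_add_left,
    Deformation.br_add_right, Deformation.br_smul_left, Deformation.br_smul_right, add_mul,
    mul_add, smul_mul_assoc, mul_smul_comm, strace_add, strace_smul]
  module

end Variation

end Trace

end StarSDYM

namespace StarSDYM

open TopologicalSpace (Opens)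
open FSeries

/-! ### Stationary points of the action -/

section Stationary

variable {n : ℕ} {P : Type*} [TopologicalSpace P] [ChartedSpace (Phase n) P]
  [IsManifold 𝓘(ℂ, Phase n) ω P] {Ω : SymplecticForm n P} {S : StarProduct Ω}
  {W : Opens (P × Base)} {g : Metric} {U : Set Base} {G Gt : (Fin 2 → ℂ) → ℂ}
  (hU : IsOpen U) (hW : ∀ q ∈ W, q.2 ∈ U) (hK : g.IsKahler U) (hF : g.Factors U G Gt)
  {Θ η : FSeries P}

theorem lagrangian_eq : lagrangian S g Gt Θ =
    bmul (rightB (n := n) hU hW hK hF).1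
      (bmul (constB (n := n) W (1 / 3)).1
          (FSeries.star S Θ (bracket S (Θ.d (.inl 0)) (Θ.d (.inl 1))))
        - bmul (constB (n := n) W (1 / 3)).1
          (FSeries.star S Θ (bracket S (Θ.d (.inl 1)) (Θ.d (.inl 0)))))
    + kahlerTrace g fun α β => FSeries.star S (Θ.d (.inl α)) (Θ.d (.inr β)) := by
  funext m k q
  rw [lagrangian, wedge_mul_epsTilde, wedge_kahlerForm]
  simp only [twoForm, typeHH, typeHT, sub_zero]
  rfl

include hU hW hK hF in
theorem isA_lagrangian (hΘ : IsA n W Θ) : IsA n W (lagrangian S g Gt Θ) := by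
  have h1 := fun i j => isA_star (S := S) hΘ (isA_bracket (S := S) (isA_d hΘ i) (isA_d hΘ j))
  rw [lagrangian_eq (n := n) hU hW hK hF]
  exact isA_add (isA_bmul _ (isA_sub (isA_bmul _ (h1 _ _)) (isA_bmul _ (h1 _ _))))
    (isA_kahlerTrace hU hW hK fun _ _ => isA_star (isA_d hΘ _) (isA_d hΘ _))

theorem toAlg_lagrangian (hΘ : IsA n W Θ) :
    toAlg S W (lagrangian S g Gt Θ) = slag hU hW hK hF (toAlg S W Θ) := by
  have hb := fun i j => isA_bracket (S := S) (isA_d hΘ i) (isA_d hΘ j)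
  have h1 := fun i j => isA_star (S := S) hΘ (hb i j)
  have h2 := fun i j => isA_star (S := S) (isA_d hΘ i) (isA_d hΘ j)
  have h3 := fun i j => isA_bmul (constB (n := n) W (1 / 3)) (h1 i j)
  rw [lagrangian_eq (n := n) hU hW hK hF, toAlg_add (isA_bmul _ (isA_sub (h3 _ _) (h3 _ _)))
    (isA_kahlerTrace hU hW hK fun _ _ => h2 _ _), toAlg_bmul _ (isA_sub (h3 _ _) (h3 _ _)),
    toAlg_sub (h3 _ _) (h3 _ _), toAlg_bmul _ (h1 _ _), toAlg_bmul _ (h1 _ _),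
    toAlg_star hΘ (hb _ _), toAlg_star hΘ (hb _ _), toAlg_bracket (isA_d hΘ _) (isA_d hΘ _),
    toAlg_bracket (isA_d hΘ _) (isA_d hΘ _), toAlg_kahlerTrace hU hW hK fun _ _ => h2 _ _]
  simp only [toAlg_star (isA_d hΘ _) (isA_d hΘ _), toAlg_d hΘ]
  have s1 : sbr (sder (.inl 1) (toAlg S W Θ)) (sder (.inl 0) (toAlg S W Θ)) =
    -sbr (sder (.inl 0) (toAlg S W Θ)) (sder (.inl 1) (toAlg S W Θ)) := Deformation.br_swap _ _
  have s2 : constB (n := n) W (2 / 3) = constB (n := n) W (1 / 3) + constB (n := n) W (1 / 3) :=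
    Subtype.ext (funext fun _ => show (2 / 3 : ℂ) = 1 / 3 + 1 / 3 by norm_num)
  rw [s1, slag, s2, cubic, quadratic, mul_neg]
  congr 1
  module

theorem action_eq {T : Contour n P} (hT : T.carrier ⊆ W) (hΘ : IsA n W Θ) (m : ℕ) (k : ℤ) :
    action S g Gt T Θ m k = if k + m < 0 then 0 else
      1 / 2 * T.tr hT m (k + m).toNat (slag hU hW hK hF (toAlg S W Θ)) := by
  have hL := isA_lagrangian (S := S) hU hW hK hF hΘ
  have h : action S g Gt T Θ m k = 1 / 2 * tripleIntegral T.c T.R T.c₁ T.R₁ T.c₂ T.R₂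
    fun z => Ω.topPower T.chart z.1 * hat T.chart (lagrangian S g Gt Θ m k) z := rfl
  rw [h]
  split_ifs with hk
  · have h0 : tripleIntegral T.c T.R T.c₁ T.R₁ T.c₂ T.R₂
        (fun z => Ω.topPower T.chart z.1 * hat T.chart (lagrangian S g Gt Θ m k) z) =
        tripleIntegral T.c T.R T.c₁ T.R₁ T.c₂ T.R₂ fun _ => 0 * 0 := by
      refine tripleIntegral_congr T.R_pos T.R₁_pos T.R₂_pos fun z hz => ?_
      have hz' := (Contour.coordSet_subset hT hz).2
      have := apply_eq_zero hL m k hk hz'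
      simp only [hat, this, mul_zero]
    rw [h0, tripleIntegral_const_mul, zero_mul, mul_zero]
  · congr 1
    rw [← toAlg_lagrangian hU hW hK hF hΘ, Contour.tr_apply, Contour.integral_apply]
    refine tripleIntegral_congr T.R_pos T.R₁_pos T.R₂_pos fun z hz => ?_
    have hz' := (Contour.coordSet_subset hT hz).2
    have := apply_eq_cf (S := S) hL m k (not_lt.1 hk) hz'
    simp only [hat, this]

/-- The factor `1/2` of the action cancels the `2` of `Contour.tr_slagVar`, so the first variation
is exactly the pairing of `η` with the Euler-Lagrange expression. -/
theorem hasDerivAt_action {T : Contour n P} (hT : T.carrier ⊆ W) (hΘ : IsA n W Θ)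
    (hη : IsA n W η) (m : ℕ) (k : ℤ) :
    HasDerivAt (fun s : ℂ => action S g Gt T (Θ + s • η) m k) (if k + m < 0 then 0 else
      T.tr hT m (k + m).toNat (toAlg S W η * euler hU hW hK hF (toAlg S W Θ))) 0 := by
  have hs : ∀ s : ℂ, s • η = bmul (constB (n := n) W s).1 η := fun s => rfl
  have hsA : ∀ s : ℂ, IsA n W (Θ + s • η) := fun s => by
    rw [hs]; exact isA_add hΘ (isA_bmul _ hη)
  have hsT : ∀ s : ℂ, toAlg S W (Θ + s • η) =
      toAlg S W Θ + constB (n := n) W s • toAlg S W η := fun s => by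
    rw [hs, toAlg_add hΘ (isA_bmul _ hη), toAlg_bmul _ hη]
  simp only [fun s => action_eq (S := S) hU hW hK hF hT (hsA s) m k, hsT]
  split_ifs with hk
  · exact hasDerivAt_const _ _
  obtain ⟨l₂, l₃, hl⟩ := exists_slag_add (S := S) hU hW hK hF (toAlg S W Θ) (toAlg S W η)
  simp only [hl, map_add, Contour.tr_smul, Contour.tr_slagVar]
  set a₀ := T.tr hT m (k + m).toNat (slag hU hW hK hF (toAlg S W Θ))
  set a₁ := T.tr hT m (k + m).toNat (toAlg S W η * euler hU hW hK hF (toAlg S W Θ))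
  set a₂ := T.tr hT m (k + m).toNat l₂
  set a₃ := T.tr hT m (k + m).toNat l₃
  have h1 := hasDerivAt_id (0 : ℂ)
  have h2 := ((((h1.mul_const (2 * a₁)).const_add a₀).add ((h1.pow 2).mul_const a₂)).add
    ((h1.pow 3).mul_const a₃)).const_mul (1 / 2)
  refine (h2.congr_deriv ?_).congr_of_eventuallyEq (Eventually.of_forall fun s => ?_)
  · norm_num
    ring
  · change _ = 1 / 2 * (a₀ + s * (2 * a₁) + s ^ 2 * a₂ + s ^ 3 * a₃)
    rfl

/-- The Euler-Lagrange expression, as a formal series. -/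
def eulerSeries (S : StarProduct Ω) (g : Metric) (Gt : (Fin 2 → ℂ) → ℂ) (Θ : FSeries P) :
    FSeries P :=
  bmul (fun p => Gt p.2) (bracket S (Θ.d (.inl 0)) (Θ.d (.inl 1)))
    - kahlerTrace g fun α β => (Θ.d (.inl α)).d (.inr β)

include hU hW hK hF in
theorem isA_eulerSeries (hΘ : IsA n W Θ) : IsA n W (eulerSeries S g Gt Θ) :=
  isA_sub (isA_bmul (rightB (n := n) hU hW hK hF) (isA_bracket (isA_d hΘ _) (isA_d hΘ _)))
    (isA_kahlerTrace hU hW hK fun _ _ => isA_d (isA_d hΘ _) _)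

theorem toAlg_eulerSeries (hΘ : IsA n W Θ) :
    toAlg S W (eulerSeries S g Gt Θ) = euler hU hW hK hF (toAlg S W Θ) := by
  have h1 := isA_bracket (S := S) (isA_d hΘ (.inl 0)) (isA_d hΘ (.inl 1))
  have h2 := fun i j => isA_d (isA_d hΘ i) j
  have h3 := toAlg_bmul (S := S) (rightB (n := n) hU hW hK hF) h1
  have h4 : eulerSeries S g Gt Θ = bmul (rightB (n := n) (W := W) hU hW hK hF).1
      (bracket S (Θ.d (.inl 0)) (Θ.d (.inl 1)))
      - kahlerTrace g fun α β => (Θ.d (.inl α)).d (.inr β) := rfl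
  rw [h4, toAlg_sub (isA_bmul (rightB (n := n) hU hW hK hF) h1)
    (isA_kahlerTrace hU hW hK fun α β => h2 (.inl α) (.inr β)),
    toAlg_kahlerTrace hU hW hK fun α β => h2 (.inl α) (.inr β)]
  simp only [toAlg_d (isA_d hΘ _), toAlg_d hΘ]
  rw [toAlg_bracket (isA_d hΘ _) (isA_d hΘ _), toAlg_d hΘ, toAlg_d hΘ] at h3
  rw [euler, ← h3]

-- `det(g)/G = G̃` matches the bracket terms, and `sum_inv_mul` matches the second-order terms; as
-- `det(g)` never vanishes, the two equations are equivalent.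
include hK hF in
theorem eulerSeries_eq (m : ℕ) (k : ℤ) {q : P × Base} (hq : q.2 ∈ U) :
    eulerSeries S g Gt Θ m k q = (g.mat q.2).det * masterExpr S g G Θ m k q := by
  have h1 := sum_inv_mul (g := g) q.2 fun α β => (Θ.d (.inl α)).d (.inr β) m k q
  have h2 : masterExpr S g G Θ m k q = (∑ β, ∑ α, g.inv β α q.2 *
      (Θ.d (.inl α)).d (.inr β) m k q)
        + (G q.2.1)⁻¹ * bracket S (Θ.d (.inl 0)) (Θ.d (.inl 1)) m k q :=
    masterExpr_apply (S := S) m k q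
  have hd := hK.nondegenerate _ hq
  obtain ⟨hG, -⟩ := hF.ne_zero hK hq
  have h3 : (g.mat q.2).det * (G q.2.1)⁻¹ = Gt q.2.2 := by
    rw [hF _ hq, mul_comm (G q.2.1), mul_inv_cancel_right₀ hG]
  have h4 : eulerSeries S g Gt Θ m k q = Gt q.2.2 *
      bracket S (Θ.d (.inl 0)) (Θ.d (.inl 1)) m k q
      - kahlerTrace g (fun α β => (Θ.d (.inl α)).d (.inr β)) m k q := rfl
  rw [h2, mul_add, ← mul_assoc, h3, h1, ← mul_assoc, mul_neg, mul_inv_cancel₀ hd, h4, kahlerTrace]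
  ring

include hU hK hF in
theorem IsMaster.isStationary (hΘ : IsQ n (univ ×ˢ U) Θ)
    (hM : IsMaster S g G (univ ×ˢ U) Θ) : IsStationary S g Gt U Θ := by
  intro T hTU W₀ hW₀ hTW η hη m k
  -- The variation is defined only near the contour, so `Θ` and `η` are compared in the algebra over
  -- the common domain.
  let W : Opens (P × Base) := ⟨W₀ ∩ univ ×ˢ U, hW₀.inter (isOpen_univ.prod hU)⟩
  have hW : ∀ q ∈ W, q.2 ∈ U := fun q hq => hq.2.2
  have hT : T.carrier ⊆ W := subset_inter hTW hTU
  have hΘ' : IsA n W Θ := ⟨fun m k => (hΘ.holomorphic m k).mono inter_subset_right,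
    fun m k hk q hq => hΘ.support m k hk q hq.2⟩
  have hη' : IsA n W η := ⟨fun m k => (hη.holomorphic m k).mono inter_subset_left,
    fun m k hk q hq => hη.support m k hk q hq.1⟩
  have h0 : euler hU hW hK hF (toAlg S W Θ) = 0 := by
    rw [← toAlg_eulerSeries hU hW hK hF hΘ', ← eqOver_zero_iff
      (isA_eulerSeries hU hW hK hF hΘ')]
    intro m k q hq
    rw [eulerSeries_eq hK hF m k (hW q hq), hM m k q hq.2]
    exact mul_zero _
  have h := hasDerivAt_action (S := S) hU hW hK hF hT hΘ' hη' m k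
  rw [h0, mul_zero, map_zero, ite_self] at h
  exact h

end Stationary

/-! ### Recovering the value at a point from integrals over small tori -/

section MeanValue

open MeasureTheory

variable {N : ℕ}

/-- The Cauchy kernel of a polydisc. -/
def cauchyKernel {ι : Type*} [Fintype ι] (c y : ι → ℂ) : ℂ := ∏ i, (y i - c i)⁻¹

/-- The Cauchy kernel cancels the Jacobian up to a constant, so integrals against it are plain
averages over the angles, and continuity alone suffices to pass to the centre. -/
theorem torusJac_mul_cauchyKernel (c : Fin N → ℂ) {r : ℝ} (hr : 0 < r) (θ : Fin N → ℝ) :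
    torusJac (fun _ => r) θ * cauchyKernel c (torusMap c (fun _ => r) θ) = Complex.I ^ N := by
  rw [torusJac, cauchyKernel, ← Finset.prod_mul_distrib]
  have h : ∀ i, (r : ℂ) * Complex.exp (θ i * Complex.I) * Complex.I *
      (torusMap c (fun _ => r) θ i - c i)⁻¹ = Complex.I := by
    intro i
    have h1 : (r : ℂ) ≠ 0 := by exact_mod_cast hr.ne'
    have h2 := Complex.exp_ne_zero (θ i * Complex.I)
    simp only [torusMap, add_sub_cancel_left]
    field_simp
  rw [Finset.prod_congr rfl fun i _ => h i, Finset.prod_const, Finset.card_univ, Fintype.card_fin]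

theorem norm_sub_le_of_mem_torusSet {ι : Type*} [Fintype ι] {c y : ι → ℂ} {r : ℝ} (hr : 0 < r)
    (hy : y ∈ torusSet c fun _ => r) : ‖y - c‖ ≤ r :=
  (pi_norm_le_iff_of_nonneg hr.le).2 fun i => (hy i).le

theorem ne_of_mem_torusSet {ι : Type*} {c y : ι → ℂ} {r : ℝ} (hr : 0 < r)
    (hy : y ∈ torusSet c fun _ => r) (i : ι) : y i ≠ c i := fun h => by
  have := hy i
  rw [h, sub_self, norm_zero] at this
  exact hr.ne this

/-- A continuous function whose integrals against the Cauchy kernel over all small tori vanish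
is zero at the centre. -/
theorem eq_zero_of_tripleIntegral {f : (Fin N → ℂ) × Base → ℂ} (c : Fin N → ℂ)
    (c₁ c₂ : Fin 2 → ℂ) (hf : ContinuousAt f (c, (c₁, c₂)))
    (hfc : ∀ᶠ r in 𝓝[>] (0 : ℝ),
      ContinuousOn f (tripleSet c (fun _ => r) c₁ (fun _ => r) c₂ fun _ => r))
    (h : ∀ᶠ r in 𝓝[>] (0 : ℝ), tripleIntegral c (fun _ => r) c₁ (fun _ => r) c₂ (fun _ => r)
      (fun z => cauchyKernel c z.1 * cauchyKernel c₁ z.2.1 * cauchyKernel c₂ z.2.2 * f z) = 0) :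
    f (c, (c₁, c₂)) = 0 := by
  by_contra hne
  have hpos : 0 < ‖f (c, (c₁, c₂))‖ := norm_pos_iff.2 hne
  obtain ⟨δ, hδ, hδf⟩ := Metric.continuousAt_iff.1 hf (‖f (c, (c₁, c₂))‖ / 2) (by positivity)
  have hr0 : ∀ᶠ r : ℝ in 𝓝[>] 0, r ∈ Ioo 0 δ := Ioo_mem_nhdsGT hδ
  obtain ⟨r, hrc, hr, hr0, hrδ⟩ := (hfc.and (h.and hr0)).exists
  have hp : ∀ i : Fin N, 0 < (fun _ => r : Fin N → ℝ) i := fun _ => hr0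
  have hp2 : ∀ i : Fin 2, 0 < (fun _ => r : Fin 2 → ℝ) i := fun _ => hr0
  set box := angleBox N ×ˢ (angleBox 2 ×ˢ angleBox 2) with hbox
  have hbc : IsCompact box := isCompact_Icc.prod (isCompact_Icc.prod isCompact_Icc)
  let mp : (Fin N → ℝ) × (Fin 2 → ℝ) × (Fin 2 → ℝ) → (Fin N → ℂ) × Base := fun θ =>
    (torusMap c (fun _ => r) θ.1, (torusMap c₁ (fun _ => r) θ.2.1, torusMap c₂ (fun _ => r) θ.2.2))
  have hmp : Continuous mp := by
    have h4 := continuous_torusMap c (fun _ => r)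
    have h5 := continuous_torusMap c₁ (fun _ => r)
    have h6 := continuous_torusMap c₂ (fun _ => r)
    fun_prop
  have hfm : Continuous fun θ => f (mp θ) :=
    hrc.comp_continuous hmp (tripleMap_mem hp hp2 hp2)
  have hk : ∀ {M : ℕ} (c : Fin M → ℂ), ContinuousOn (cauchyKernel c)
      (torusSet c fun _ => r) := by
    intro M c
    unfold cauchyKernel
    exact continuousOn_finsetProd _ fun i _ => ContinuousOn.inv₀ (by fun_prop) fun y hy =>
      sub_ne_zero.2 (ne_of_mem_torusSet hr0 hy i)
  have hkc : ContinuousOn (fun z : (Fin N → ℂ) × Base =>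
      cauchyKernel c z.1 * cauchyKernel c₁ z.2.1 * cauchyKernel c₂ z.2.2 * f z)
      (tripleSet c (fun _ => r) c₁ (fun _ => r) c₂ fun _ => r) :=
    ((((hk c).comp continuousOn_fst fun z hz => hz.1).mul
      ((hk c₁).comp (continuous_fst.comp continuous_snd).continuousOn fun z hz => hz.2.1)).mul
      ((hk c₂).comp (continuous_snd.comp continuous_snd).continuousOn fun z hz => hz.2.2)).mul hrc
  rw [tripleIntegral_eq hp hp2 hp2 hkc] at hr
  have ha : ∀ θ, angleFun c (fun _ => r) c₁ (fun _ => r) c₂ (fun _ => r)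
      (fun z => cauchyKernel c z.1 * cauchyKernel c₁ z.2.1 * cauchyKernel c₂ z.2.2 * f z) θ =
      (Complex.I ^ N * (Complex.I ^ 2 * Complex.I ^ 2)) * f (mp θ) := by
    intro θ
    rw [← torusJac_mul_cauchyKernel c hr0 θ.1]
    nth_rewrite 1 [← torusJac_mul_cauchyKernel c₁ hr0 θ.2.1]
    rw [← torusJac_mul_cauchyKernel c₂ hr0 θ.2.2]
    simp only [angleFun, mp]
    ring
  simp only [ha, integral_const_mul] at hr
  replace hr := (mul_eq_zero.1 hr).resolve_left
    (mul_ne_zero (pow_ne_zero _ Complex.I_ne_zero)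
      (mul_ne_zero (pow_ne_zero _ Complex.I_ne_zero) (pow_ne_zero _ Complex.I_ne_zero)))
  have hvol : 0 < volume.real box := by
    have h1 : ∀ M : ℕ, volume.real (angleBox M) = (2 * Real.pi) ^ M := by
      intro M
      rw [Measure.real, Real.volume_Icc_pi_toReal (fun i => by
        simpa using Real.two_pi_pos.le)]
      simp
    have h2 : volume.real box = volume.real (angleBox N) *
        (volume.real (angleBox 2) * volume.real (angleBox 2)) := by
      simp only [hbox, Measure.real, Measure.volume_eq_prod, Measure.prod_prod, ENNReal.toReal_mul]
    rw [h2, h1, h1]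
    positivity
  -- The average of `f` is zero while `f` stays within half of `‖f (c, (c₁, c₂))‖` of its value at
  -- the centre, a contradiction.
  have hle : ‖∫ θ in box, (f (mp θ) - f (c, (c₁, c₂)))‖ ≤
      ‖f (c, (c₁, c₂))‖ / 2 * volume.real box := by
    refine norm_setIntegral_le_of_norm_le_const hbc.measure_lt_top fun θ _ => ?_
    have hd : dist (mp θ) (c, (c₁, c₂)) < δ := by
      refine lt_of_le_of_lt ?_ hrδ
      rw [dist_eq_norm]
      have hm := tripleMap_mem (c := c) (c₁ := c₁) (c₂ := c₂) hp hp2 hp2 θ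
      exact max_le (norm_sub_le_of_mem_torusSet hr0 hm.1)
        (max_le (norm_sub_le_of_mem_torusSet hr0 hm.2.1) (norm_sub_le_of_mem_torusSet hr0 hm.2.2))
    have := hδf hd
    rw [dist_eq_norm] at this
    exact this.le
  rw [integral_sub (hfm.continuousOn.integrableOn_compact hbc)
    (continuousOn_const.integrableOn_compact hbc), hr, zero_sub, norm_neg, setIntegral_const,
    norm_smul, Real.norm_of_nonneg hvol.le] at hle
  nlinarith

end MeanValue

end StarSDYM

namespace StarSDYM

open TopologicalSpace (Opens)
open FSeries

/-! ### The Euler-Lagrange equation of the action -/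

section EulerLagrange

variable {n : ℕ} {P : Type*} [TopologicalSpace P] [ChartedSpace (Phase n) P]

/-- The Cauchy kernel in the chart `φ` and the coordinates of the base. -/
def chartKernel (φ : OpenPartialHomeomorph P (Phase n)) (c : Phase n) (c₁ c₂ : Fin 2 → ℂ)
    (q : P × Base) : ℂ :=
  cauchyKernel c (φ q.1) * cauchyKernel c₁ q.2.1 * cauchyKernel c₂ q.2.2

/-- The domain of the Cauchy kernel. -/
def chartKernelDom (φ : OpenPartialHomeomorph P (Phase n)) (c : Phase n) (c₁ c₂ : Fin 2 → ℂ) :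
    Set (P × Base) :=
  {q | q.1 ∈ φ.source ∧ (∀ i, φ q.1 i ≠ c i) ∧ (∀ i, q.2.1 i ≠ c₁ i) ∧ ∀ i, q.2.2 i ≠ c₂ i}

variable (φ : OpenPartialHomeomorph P (Phase n)) (c : Phase n) (c₁ c₂ : Fin 2 → ℂ)

theorem isOpen_forall_ne {ι : Type*} [Finite ι] (c : ι → ℂ) :
    IsOpen {y : ι → ℂ | ∀ i, y i ≠ c i} := by
  have h : {y : ι → ℂ | ∀ i, y i ≠ c i} = ⋂ i, (fun y : ι → ℂ => y i) ⁻¹' {c i}ᶜ := by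
    ext y
    simp
  rw [h]
  exact isOpen_iInter_of_finite fun i => isOpen_compl_singleton.preimage (continuous_apply i)

theorem isOpen_chartKernelDom : IsOpen (chartKernelDom φ c c₁ c₂) := by
  have h := (φ.isOpen_inter_preimage (isOpen_forall_ne c)).prod
    ((isOpen_forall_ne c₁).prod (isOpen_forall_ne c₂))
  convert h using 1
  ext q
  simp [chartKernelDom, and_assoc]

theorem differentiableAt_cauchyKernel {ι : Type*} [Fintype ι] {c y : ι → ℂ}
    (h : ∀ i, y i ≠ c i) : DifferentiableAt ℂ (cauchyKernel c) y := by
  unfold cauchyKernel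
  have h1 : ∀ i, DifferentiableAt ℂ (fun y : ι → ℂ => (y i - c i)⁻¹) y := fun i =>
    DifferentiableAt.fun_inv (by fun_prop) (sub_ne_zero.2 (h i))
  classical
  exact (HasFDerivAt.finsetProd fun i _ => (h1 i).hasFDerivAt).differentiableAt

variable {φ c c₁ c₂}

theorem eventually_tripleSet_subset {N : ℕ} {c : Fin N → ℂ} {c₁ c₂ : Fin 2 → ℂ}
    {O : Set ((Fin N → ℂ) × Base)} (hO : O ∈ 𝓝 (c, (c₁, c₂))) : ∀ᶠ r in 𝓝[>] (0 : ℝ),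
      tripleSet c (fun _ => r) c₁ (fun _ => r) c₂ (fun _ => r) ⊆ O ∧
        ∀ y ∈ torusSet c fun _ => r, (y, (c₁, c₂)) ∈ O := by
  obtain ⟨δ, hδ, hδO⟩ := Metric.mem_nhds_iff.1 hO
  filter_upwards [Ioo_mem_nhdsGT hδ] with r hr
  refine ⟨fun z hz => hδO ?_, fun y hy => hδO ?_⟩
  · refine lt_of_le_of_lt ?_ hr.2
    rw [dist_eq_norm]
    exact max_le (norm_sub_le_of_mem_torusSet hr.1 hz.1)
      (max_le (norm_sub_le_of_mem_torusSet hr.1 hz.2.1) (norm_sub_le_of_mem_torusSet hr.1 hz.2.2))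
  · refine lt_of_le_of_lt ?_ hr.2
    rw [dist_eq_norm]
    refine max_le (norm_sub_le_of_mem_torusSet hr.1 hy) ?_
    simp [hr.1.le]

variable [IsManifold 𝓘(ℂ, Phase n) ω P]

theorem hol_chartKernel (hφ : φ ∈ IsManifold.maximalAtlas 𝓘(ℂ, Phase n) ω P) :
    Hol n (chartKernel φ c c₁ c₂) (chartKernelDom φ c c₁ c₂) := by
  refine hol_of_hat fun q hq => ⟨φ, hφ, hq.1, ?_⟩
  have h1 : DifferentiableAt ℂ (fun z : Phase n × Base =>
      cauchyKernel c z.1 * cauchyKernel c₁ z.2.1 * cauchyKernel c₂ z.2.2) (φ q.1, q.2) :=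
    ((DifferentiableAt.comp (φ q.1, q.2) (f := Prod.fst) (g := cauchyKernel c)
      (differentiableAt_cauchyKernel hq.2.1) differentiableAt_fst).mul
      (DifferentiableAt.comp (φ q.1, q.2) (f := fun z : Phase n × Base => z.2.1)
        (g := cauchyKernel c₁) (differentiableAt_cauchyKernel hq.2.2.1) (by fun_prop))).mul
      (DifferentiableAt.comp (φ q.1, q.2) (f := fun z : Phase n × Base => z.2.2)
        (g := cauchyKernel c₂) (differentiableAt_cauchyKernel hq.2.2.2) (by fun_prop))
  refine h1.congr_of_eventuallyEq ?_
  have h2 : φ.target ×ˢ (univ : Set Base) ∈ 𝓝 (φ q.1, q.2) :=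
    (φ.open_target.prod isOpen_univ).mem_nhds ⟨φ.map_source hq.1, mem_univ _⟩
  filter_upwards [h2] with z hz
  simp only [hat, chartKernel, φ.right_inv hz.1]

/-- The variation with a single coefficient, at `t ħ⁻¹`. -/
def singleSeries (F : P × Base → ℂ) : FSeries P := fun m k => if m = 1 ∧ k = -1 then F else 0

theorem isQ_singleSeries {F : P × Base → ℂ} {W : Set (P × Base)} (hF : Hol n F W) :
    IsQ n W (singleSeries F) where
  holomorphic m k := by
    unfold singleSeries
    split_ifs
    · exact hF
    · exact mdifferentiableOn_const
  support m k hk q _ := by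
    rw [singleSeries, if_neg (by omega)]
    rfl
  free k q _ := by
    rw [singleSeries, if_neg (by omega)]
    rfl

variable {Ω : SymplecticForm n P} {S : StarProduct Ω}

theorem cf_toAlg_singleSeries {F : P × Base → ℂ} {W : Opens (P × Base)} (hF : Hol n F W)
    (m j : ℕ) : Deformation.cf (toAlg S W (singleSeries F)) m j =
      if m = 1 ∧ j = 0 then res n W F else 0 := by
  refine HolFun.ext_on fun q hq => ?_
  rw [cf_toAlg (isQ_singleSeries hF).toIsA m j hq, singleSeries]
  by_cases h : m = 1 ∧ j = 0
  · rw [if_pos h, if_pos (by omega), res_apply hF hq]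
  · rw [if_neg h, if_neg (by omega)]
    rfl

/-- Multiplication by `F τ` shifts the `τ`-degree by one. At order `ħ^j` the operators `Δ_s` with `s
> 0` meet only coefficients of `b` of order below `j`, which vanish by hypothesis, so the pointwise
product with the coefficient of order `j` is isolated. -/
theorem cf_singleSeries_mul {F : P × Base → ℂ} {W : Opens (P × Base)} (hF : Hol n F W)
    (b : SAlg S W) (m j : ℕ) (hb : ∀ i < j, Deformation.cf b m i = 0) :
    Deformation.cf (toAlg S W (singleSeries F) * b) (m + 1) j =
      (deform S W).Δ 0 (res n W F) (Deformation.cf b m j) := by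
  rw [Deformation.cf_mul]
  rw [Finset.sum_eq_single (1, m), Finset.sum_eq_single (0, j), Finset.sum_eq_single (0, j)]
  · simp [cf_toAlg_singleSeries hF]
  · rintro ⟨i, i'⟩ hi hne
    have h0 : i ≠ 0 := fun h => hne (by
      have := Finset.HasAntidiagonal.mem_antidiagonal.1 hi
      simp only [Prod.mk.injEq] at this ⊢
      omega)
    simp [cf_toAlg_singleSeries hF, h0]
  · intro h
    exact absurd (Finset.HasAntidiagonal.mem_antidiagonal.2 (zero_add j)) h
  · rintro ⟨s, r⟩ hs hne
    have hs' := Finset.HasAntidiagonal.mem_antidiagonal.1 hs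
    have hr : r < j := by
      simp only [ne_eq, Prod.mk.injEq] at hs' hne
      omega
    refine Finset.sum_eq_zero fun jj hjj => ?_
    have h1 := Finset.HasAntidiagonal.mem_antidiagonal.1 hjj
    simp only at h1
    rw [hb jj.2 (by omega)]
    simp
  · intro h
    exact absurd (Finset.HasAntidiagonal.mem_antidiagonal.2 (zero_add j)) h
  · rintro ⟨a, b'⟩ ha hne
    have h0 : a ≠ 1 := fun h => hne (by
      have := Finset.HasAntidiagonal.mem_antidiagonal.1 ha
      simp only [Prod.mk.injEq] at this ⊢
      omega)
    simp [cf_toAlg_singleSeries hF, h0]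
  · intro h
    exact absurd (Finset.HasAntidiagonal.mem_antidiagonal.2 (add_comm 1 m)) h

variable {g : Metric} {U : Set Base} {G Gt : (Fin 2 → ℂ) → ℂ} {Θ : FSeries P}

/-- Induction on the power of `ħ` for fixed `m`. Testing with the Cauchy kernel at a point, at the
lowest order allowed in `𝒬`, shows that the current coefficient times the density of `ω^n` has zero
mean on all small tori around the point, hence vanishes there. -/
theorem IsStationary.eulerSeries_eq_zero (hU : IsOpen U) (hK : g.IsKahler U)
    (hF : g.Factors U G Gt) (hΘ : IsQ n (univ ×ˢ U) Θ) (hS : IsStationary S g Gt U Θ) (m j : ℕ) :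
    ∀ q ∈ (univ : Set P) ×ˢ U, eulerSeries S g Gt Θ m ((j : ℤ) - m) q = 0 := by
  induction j using Nat.strong_induction_on with
  | _ j ih =>
  rintro ⟨x, ⟨c₁, c₂⟩⟩ hq
  set φ := chartAt (Phase n) x with hφ
  have hφm := chartAt_mem (n := n) x
  have hx : x ∈ φ.source := mem_chart_source _ x
  set c := φ x with hc
  have hUo : IsOpen ((univ : Set P) ×ˢ U) := isOpen_univ.prod hU
  let W₁ : Opens (P × Base) := ⟨univ ×ˢ U, hUo⟩
  have hW₁ : ∀ q ∈ W₁, q.2 ∈ U := fun q hq => hq.2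
  set E := eulerSeries S g Gt Θ m ((j : ℤ) - m) with hE
  have hEh : Hol n E (univ ×ˢ U) :=
    (isA_eulerSeries (S := S) (W := W₁) hU hW₁ hK hF hΘ.toIsA).holomorphic _ _
  -- The kernel is singular on the coordinate hyperplanes through the centre. The test variation is
  -- holomorphic only off them, and the contours avoid them.
  let W : Opens (P × Base) := ⟨chartKernelDom φ c c₁ c₂ ∩ univ ×ˢ U,
    (isOpen_chartKernelDom φ c c₁ c₂).inter hUo⟩
  have hW : ∀ q ∈ W, q.2 ∈ U := fun q hq => hq.2.2
  have hκ : Hol n (chartKernel φ c c₁ c₂) W := (hol_chartKernel hφm).mono inter_subset_left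
  have hΘ' : IsA n W Θ := ⟨fun m k => (hΘ.holomorphic m k).mono inter_subset_right,
    fun m k hk q hq => hΘ.support m k hk q hq.2⟩
  have hEW := isA_eulerSeries (S := S) hU hW hK hF hΘ'
  have hO : hatDom φ ((univ : Set P) ×ˢ U) ∈ 𝓝 (c, (c₁, c₂)) :=
    (isOpen_hatDom φ hUo).mem_nhds (mem_hatDom hx hq)
  have hcont : ContinuousOn (fun z => Ω.topPower φ z.1 * hat φ E z) (hatDom φ (univ ×ˢ U)) :=
    ((Ω.continuousOn_topPower hφm).comp continuousOn_fst fun _ hz => hz.1).mul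
      (hEh.differentiableOn_hat hφm hUo).continuousOn
  have hev := eventually_tripleSet_subset hO
  have key := eq_zero_of_tripleIntegral c c₁ c₂ (hcont.continuousAt hO)
    (hev.mono fun r hr => hcont.mono hr.1) ?_
  · have h1 : hat φ E (c, (c₁, c₂)) = E (x, (c₁, c₂)) := hat_apply E (q := (x, (c₁, c₂))) hx
    simp only [h1] at key
    exact (mul_eq_zero.1 key).resolve_left (Ω.topPower_ne_zero x)
  filter_upwards [hev, self_mem_nhdsWithin] with r hr hr0
  replace hr0 : 0 < r := hr0
  let T : Contour n P :=
    { chart := φ, chart_mem := hφm, c := c, R := fun _ => r, c₁ := c₁, R₁ := fun _ => r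
      c₂ := c₂, R₂ := fun _ => r, R_pos := fun _ => hr0, R₁_pos := fun _ => hr0
      R₂_pos := fun _ => hr0, torus_subset := fun y hy => (hr.2 y hy).1 }
  have hTU : T.carrier ⊆ univ ×ˢ U := by
    rintro ⟨_, p⟩ ⟨⟨y, hy, rfl⟩, hp⟩
    exact (hr.1 (show (y, p) ∈ tripleSet _ _ _ _ _ _ from ⟨hy, hp⟩)).2
  have hTW : T.carrier ⊆ W := by
    refine subset_inter ?_ hTU
    rintro ⟨_, p⟩ ⟨⟨y, hy, rfl⟩, hp⟩
    have hyt := (hr.2 y hy).1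
    refine ⟨φ.map_target hyt, fun i => ?_, ne_of_mem_torusSet hr0 hp.1,
      ne_of_mem_torusSet hr0 hp.2⟩
    change φ (φ.symm y) i ≠ c i
    rw [φ.right_inv hyt]
    exact ne_of_mem_torusSet hr0 hy i
  have hη := isQ_singleSeries (W := (W : Set (P × Base))) hκ
  -- The test variation has degree one in `τ`, so the coefficient `τ^m ħ^j` of the Euler-Lagrange
  -- expression is seen in the action at `τ^{m+1} ħ^j`, that is, at `t^{m+1} ħ^{j-(m+1)}`.
  have h1 := hS T hTU W W.isOpen hTW _ hη (m + 1) ((j : ℤ) - (m + 1 : ℕ))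
  have h2 := h1.unique (hasDerivAt_action (S := S) hU hW hK hF hTW hΘ' hη.toIsA (m + 1)
    ((j : ℤ) - (m + 1 : ℕ)))
  rw [if_neg (by omega), sub_add_cancel, Int.toNat_natCast, Contour.tr_apply,
    ← toAlg_eulerSeries hU hW hK hF hΘ', cf_singleSeries_mul hκ _ m j fun i hi =>
      HolFun.ext_on fun q hq => (cf_toAlg hEW m i hq).trans (ih i hi q hq.2),
    Contour.integral_apply] at h2
  refine Eq.trans (tripleIntegral_congr T.R_pos T.R₁_pos T.R₂_pos fun z hz => ?_) h2.symm
  have hz' := (Contour.coordSet_subset hTW hz)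
  have hzt : z.1 ∈ φ.target := hz'.1
  have hzW : (φ.symm z.1, z.2) ∈ W := hz'.2
  have h3 := (res n W (chartKernel φ c c₁ c₂)).2.1.holAt W.isOpen hzW
  have h4 := (Deformation.cf (toAlg S W (eulerSeries S g Gt Θ)) m j).2.1.holAt W.isOpen hzW
  change _ = Ω.topPower φ z.1 * ((deform S W).Δ 0 _ _).1 (φ.symm z.1, z.2)
  rw [deform_apply _ _ _ hzW, S.zeroth _ _ _ h3 h4, res_apply hκ hzW, cf_toAlg hEW m j hzW,
    chartKernel, φ.right_inv hzt]
  simp only [hat, hE]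
  ring

theorem IsStationary.isMaster (hU : IsOpen U) (hK : g.IsKahler U)
    (hF : g.Factors U G Gt) (hΘ : IsQ n (univ ×ˢ U) Θ) (hS : IsStationary S g Gt U Θ) :
    IsMaster S g G (univ ×ˢ U) Θ := by
  intro m k q hq
  let W : Opens (P × Base) := ⟨univ ×ˢ U, isOpen_univ.prod hU⟩
  have hW : ∀ q ∈ W, q.2 ∈ U := fun q hq => hq.2
  have h0 : eulerSeries S g Gt Θ m k q = 0 := by
    rcases lt_or_ge (k + m) 0 with hk | hk
    · exact apply_eq_zero (isA_eulerSeries (S := S) hU hW hK hF hΘ.toIsA) m k hk hq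
    · have h := hS.eulerSeries_eq_zero hU hK hF hΘ m (k + m).toNat q hq
      rwa [Int.toNat_of_nonneg hk, add_sub_cancel_right] at h
  rw [eulerSeries_eq hK hF m k hq.2] at h0
  exact (mul_eq_zero.1 h0).resolve_left (hK.nondegenerate _ hq.2)

end EulerLagrange

end StarSDYM

end

/-! ### Assembly of the six statements, over patches and over `U` -/

theorem mainTheorem2 (n : ℕ) {P : Type*} [TopologicalSpace P]
    [ChartedSpace (StarSDYM.Phase n) P] [IsManifold 𝓘(ℂ, StarSDYM.Phase n) ω P]
    (Ω : StarSDYM.SymplecticForm n P) (S : StarSDYM.StarProduct Ω)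
    (U : Set StarSDYM.Base) (hU : IsOpen U) (g : StarSDYM.Metric)
    (hK : g.IsKahler U) (hH : g.IsHeavenly U) :
    -- on a convex coordinate patch the determinant of the metric is a product
    (∀ B Bt : Set (Fin 2 → ℂ), IsOpen B → IsOpen Bt → Convex ℝ B → Convex ℝ Bt → B ×ˢ Bt ⊆ U →
      ∃ G Gt : (Fin 2 → ℂ) → ℂ, DifferentiableOn ℂ G B ∧ DifferentiableOn ℂ Gt Bt ∧
        g.Factors (B ×ˢ Bt) G Gt) ∧
    -- on such a patch every solution can be brought to the gauge `A = iħ J⁻¹ * ∂̃J`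
    (∀ B Bt : Set (Fin 2 → ℂ), IsOpen B → IsOpen Bt → Convex ℝ B → Convex ℝ Bt → B ×ˢ Bt ⊆ U →
      ∀ A : StarSDYM.Idx → StarSDYM.FSeries P,
        (∀ i, StarSDYM.FSeries.IsQ n (univ ×ˢ (B ×ˢ Bt)) (A i).divIħ) →
        StarSDYM.IsSDYM S g (univ ×ˢ (B ×ˢ Bt)) A →
        ∃ c J : StarSDYM.FSeries P,
          StarSDYM.FSeries.IsExpQ n (univ ×ˢ (B ×ˢ Bt)) c ∧
          StarSDYM.FSeries.IsExpQ n (univ ×ˢ (B ×ˢ Bt)) J ∧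
          ∀ i, StarSDYM.FSeries.EqOver (univ ×ˢ (B ×ˢ Bt))
            (StarSDYM.gaugeTransform S c A i) (StarSDYM.connOfJ S J i)) ∧
    -- in that gauge the equations are Yang's equation
    (∀ J : StarSDYM.FSeries P, StarSDYM.FSeries.IsExpQ n (univ ×ˢ U) J →
      (∀ i, StarSDYM.FSeries.IsQ n (univ ×ˢ U) (StarSDYM.connOfJ S J i).divIħ) ∧
      (StarSDYM.IsSDYM S g (univ ×ˢ U) (StarSDYM.connOfJ S J) ↔
        StarSDYM.IsYang S g (univ ×ˢ U) J)) ∧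
    ∀ G Gt : (Fin 2 → ℂ) → ℂ, g.Factors U G Gt →
      -- the connection built from `Θ` solves the equations iff `Θ` solves the master equation
      (∀ Θ : StarSDYM.FSeries P, StarSDYM.FSeries.IsQ n (univ ×ˢ U) Θ →
        (StarSDYM.IsSDYM S g (univ ×ˢ U) (StarSDYM.connOfTheta g G Θ) ↔
          StarSDYM.IsMaster S g G (univ ×ˢ U) Θ)) ∧
      -- on a convex patch, Yang's equation for `J` and the master equation for `Θ` correspond
      (∀ B Bt : Set (Fin 2 → ℂ), IsOpen B → IsOpen Bt → Convex ℝ B → Convex ℝ Bt → B ×ˢ Bt ⊆ U →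
        (∀ J : StarSDYM.FSeries P, StarSDYM.FSeries.IsExpQ n (univ ×ˢ (B ×ˢ Bt)) J →
          (StarSDYM.IsYang S g (univ ×ˢ (B ×ˢ Bt)) J ↔
            ∃ Θ : StarSDYM.FSeries P,
              StarSDYM.FSeries.IsQ n (univ ×ˢ (B ×ˢ Bt)) Θ.divIħ ∧
              (∀ i, StarSDYM.FSeries.EqOver (univ ×ˢ (B ×ˢ Bt))
                (StarSDYM.connOfJ S J i) (StarSDYM.connOfTheta g G Θ i)) ∧
              StarSDYM.IsMaster S g G (univ ×ˢ (B ×ˢ Bt)) Θ)) ∧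
        (∀ Θ : StarSDYM.FSeries P, StarSDYM.FSeries.IsQ n (univ ×ˢ (B ×ˢ Bt)) Θ.divIħ →
          (StarSDYM.IsMaster S g G (univ ×ˢ (B ×ˢ Bt)) Θ ↔
            ∃ J : StarSDYM.FSeries P,
              StarSDYM.FSeries.IsExpQ n (univ ×ˢ (B ×ˢ Bt)) J ∧
              (∀ i, StarSDYM.FSeries.EqOver (univ ×ˢ (B ×ˢ Bt))
                (StarSDYM.connOfJ S J i) (StarSDYM.connOfTheta g G Θ i)) ∧
              StarSDYM.IsYang S g (univ ×ˢ (B ×ˢ Bt)) J))) ∧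
      -- the master equation is the stationarity condition of the action
      (∀ Θ : StarSDYM.FSeries P, StarSDYM.FSeries.IsQ n (univ ×ˢ U) Θ →
        (StarSDYM.IsStationary S g Gt U Θ ↔ StarSDYM.IsMaster S g G (univ ×ˢ U) Θ)) := by
  have hW : ∀ V : Set StarSDYM.Base, V ⊆ U → ∀ q ∈ (univ ×ˢ V : Set (P × StarSDYM.Base)),
      q.2 ∈ U := fun V hV q hq => hV hq.2
  have hWV : ∀ (V : Set StarSDYM.Base) (q : P × StarSDYM.Base),
      q ∈ (univ ×ˢ V : Set (P × StarSDYM.Base)) ↔ q.2 ∈ V := fun V q => by simp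
  refine ⟨fun B Bt hB hBt hBc hBtc hs => hH.exists_factors hU hK hB hBt hBc hBtc hs,
    fun B Bt hB hBt hBc hBtc hs A hA hSD => ?_, fun J hJ => ?_, fun G Gt hF =>
    ⟨fun Θ hΘ => ?_, fun B Bt hB hBt hBc hBtc hs => ⟨fun J hJ => ?_, fun Θ hΘ => ?_⟩,
      fun Θ hΘ => ?_⟩⟩
  · exact StarSDYM.exists_gauge_to_connOfJ (W := ⟨_, isOpen_univ.prod (hB.prod hBt)⟩) hBc hBtc hU
      hK hs (hWV _) hA hSD
  · exact ⟨StarSDYM.isQ_divIħ_connOfJ (W := ⟨_, isOpen_univ.prod hU⟩) hJ,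
      StarSDYM.isSDYM_connOfJ_iff (W := ⟨_, isOpen_univ.prod hU⟩) hU (hW U subset_rfl) hK hJ⟩
  · exact StarSDYM.isSDYM_connOfTheta_iff (W := ⟨_, isOpen_univ.prod hU⟩) hU (hW U subset_rfl) hK
      hF hΘ.toIsA
  · exact StarSDYM.isYang_iff_exists_theta (W := ⟨_, isOpen_univ.prod (hB.prod hBt)⟩) hU hK hF hBc
      hs (hWV _) hJ
  · exact StarSDYM.isMaster_iff_exists_J (W := ⟨_, isOpen_univ.prod (hB.prod hBt)⟩) hU hK hF hBc
      hBtc hs (hWV _) hΘ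
  · exact ⟨StarSDYM.IsStationary.isMaster hU hK hF hΘ,
      StarSDYM.IsMaster.isStationary hU hK hF hΘ⟩
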